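/- **Definitions.** A *rank-one construction* is given by a natural number $h_1\ge 1$, integers $r_j\ge 2$ and integers $s_j(1),\dots,s_j(r_j)\ge 0$ ($j\ge1$). Put $h_{j+1}=h_jr_j+\sum_{i=1}^{r_j}s_j(i)$. It is an invertible transformation $T$ of a set $X\subset\mathbb R$ preserving Lebesgue measure $\mu$, with half-intervals $E_j\subset X$ such that for every $j$ the floors $E_j,TE_j,\dots,T^{h_j-1}E_j$ are disjoint half-intervals of equal length, $T$ acts on every floor except the last one as a translation, $E_j$ is the disjoint union of half-intervals $E_j^1,\dots,E_j^{r_j}$ of equal length with $E_{j+1}=E_j^1$ and $T^{h_j+s_j(i)}E_j^i=E_j^{i+1}$ for $i<r_j$, and the tower of stage $j+1$ consists of the columns $X_{i,j}=\bigsqcup_{0\le k<h_j}T^kE_j^i$, each followed by the $s_j(i)$ additional floors $T^{h_j}E_j^i,\dots,T^{h_j+s_j(i)-1}E_j^i$, which are disjoint from the tower $X_j=\bigsqcup_{0\le k<h_j}T^kE_j$; finally $X=\bigcup_jX_j$. The construction is *Sidon* if for all $j$ and all $h_j<m\le h_{j+1}$ the set $T^mX_j\cap X_j$ is contained in one of the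 columns $X_{i,j}$, $1\le i\le r_j$. The unitary operator induced by $T$ on $L_2(X,\mu)$ is $f\mapsto f\circ T$; it is denoted by $T$ too. A unitary operator $S$ on a separable Hilbert space is unitarily equivalent to the operator $f(t,k)\mapsto t f(t,k)$ on $L_2(\mathbb T\times\mathbb N,\hat\sigma)$ for some Borel probability measure $\hat\sigma$ on $\mathbb T\times\mathbb N$, where $\mathbb T$ is the unit circle; the projection $\sigma$ of such a $\hat\sigma$ to $\mathbb T$ is called a spectral measure of $S$ (it is unique up to equivalence of measures). The spectrum of $S$ is singular (absolutely continuous) if $\sigma$ is singular (absolutely continuous) with respect to Lebesgue measure on $\mathbb T$. **Theorem.** For every natural $n>1$ there is a Sidon rank-one construction $T$ on a space $X$ with $\mu(X)=\infty$ such that for the induced unitary operator $T$ the tensor power $T^{\otimes n}$ has singular spectrum and the tensor power $T^{\otimes(n+1)}$ has absolutely continuous spectrum. Moreover, for every spectral measure $\sigma$ of $T$ the convolution power $\sigma^{*n}$ is singular and the convolution power $\sigma^{*(n+1)}$ is absolutely continuous with respect to Lebesgue measure on $\mathbb T$. -/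

import Mathlib

open MeasureTheory Set
open scoped TensorProduct

noncomputable section

/-! ### Rank-one (cutting and stacking) constructions

Stages and columns are numbered from `0`. -/

/-- Parameters of a rank-one construction: the height of the initial tower, the number `r j` of
columns into which the tower of stage `j` is cut, and the number `s j i` of spacers put above the
`i`-th column (`i < r j`). -/
structure RankOneParams where
  h₀ : ℕ
  r : ℕ → ℕ
  s : ℕ → ℕ → ℕ
  h₀_pos : 0 < h₀
  two_le_r : ∀ j, 2 ≤ r j

namespace RankOneParams

/-- The height of the tower of stage `j`. -/
def height (P : RankOneParams) : ℕ → ℕ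
  | 0 => P.h₀
  | j + 1 => P.height j * P.r j + ∑ i ∈ Finset.range (P.r j), P.s j i

/-- The position, in the tower of stage `j + 1`, of the bottom of the `i`-th column of the tower
of stage `j`. -/
def offset (P : RankOneParams) (j i : ℕ) : ℕ :=
  i * P.height j + ∑ l ∈ Finset.range i, P.s j l

end RankOneParams

/-- Lebesgue measure on a subset of the line. -/
def lebesgueOn (X : Set ℝ) : Measure X := (volume : Measure ℝ).comap ((↑) : X → ℝ)

/-- A rank-one construction with parameters `P`: an invertible measure preserving transformation
`T` of a subset `X` of the line (with Lebesgue measure), and the bases `E j` of its towers. -/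
structure RankOneConstruction (P : RankOneParams) where
  X : Set ℝ
  T : X ≃ᵐ X
  E : ℕ → Set X
  /-- the common length of the floors of the tower of stage `j` -/
  width : ℕ → ℝ
  width_pos : ∀ j, 0 < width j
  measurePreserving : MeasurePreserving T (lebesgueOn X) (lebesgueOn X)
  /-- the floors are half-intervals -/
  floor_eq : ∀ j, ∀ k < P.height j,
    ∃ a : ℝ, ((↑) : X → ℝ) '' (T^[k] '' E j) = Ico a (a + width j)
  /-- the floors of one tower are disjoint -/
  floor_disjoint : ∀ j, ∀ k < P.height j, ∀ l < P.height j, k ≠ l →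
    Disjoint (T^[k] '' E j) (T^[l] '' E j)
  /-- `T` maps each floor but the top one to the next floor by a translation -/
  floor_translation : ∀ j k, k + 1 < P.height j →
    ∃ c : ℝ, ∀ x ∈ T^[k] '' E j, (T x : ℝ) = (x : ℝ) + c
  /-- the base of stage `j` is cut into `r j` pieces, `T^[offset j i] '' E (j + 1)`; the first one
  is the base of stage `j + 1`, and the piece number `i` returns to the piece number `i + 1` after
  `height j + s j i` steps -/
  base_cut : ∀ j, E j = ⋃ i < P.r j, T^[P.offset j i] '' E (j + 1)
  /-- the space is the union of the towers -/
  exhaust : (⋃ j, ⋃ k < P.height j, T^[k] '' E j) = univ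

namespace RankOneConstruction

variable {P : RankOneParams}

/-- The tower of stage `j` (the union of its floors). -/
def tower (R : RankOneConstruction P) (j : ℕ) : Set R.X :=
  ⋃ k < P.height j, R.T^[k] '' R.E j

/-- The `i`-th column of the tower of stage `j`. -/
def column (R : RankOneConstruction P) (j i : ℕ) : Set R.X :=
  ⋃ k < P.height j, R.T^[k] '' (R.T^[P.offset j i] '' R.E (j + 1))

/-- The Sidon property: for `h_j < m ≤ h_{j+1}`, the part of the tower of stage `j` covered by its
`m`-th image lies in a single column. -/
def IsSidon (R : RankOneConstruction P) : Prop :=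
  ∀ j m, P.height j < m → m ≤ P.height (j + 1) →
    ∃ i < P.r j, (R.T^[m] '' R.tower j) ∩ R.tower j ⊆ R.column j i

end RankOneConstruction

/-! ### Unitary operators and their tensor powers -/

/-- A complex Hilbert space together with a unitary operator on it. -/
structure UnitaryOperator where
  space : Type
  [normed : NormedAddCommGroup space]
  [inner : InnerProductSpace ℂ space]
  [complete : CompleteSpace space]
  op : space ≃ₗᵢ[ℂ] space

attribute [instance] UnitaryOperator.normed UnitaryOperator.inner UnitaryOperator.complete

/-- The extension of a surjective linear isometry to the completions. -/
def completionIsometryEquiv {E F : Type} [NormedAddCommGroup E] [InnerProductSpace ℂ E]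
    [NormedAddCommGroup F] [InnerProductSpace ℂ F] (e : E ≃ₗᵢ[ℂ] F) :
    UniformSpace.Completion E ≃ₗᵢ[ℂ] UniformSpace.Completion F where
  toLinearEquiv := LinearEquiv.ofLinearMap
    (e.toContinuousLinearEquiv : E →L[ℂ] F).completion.toLinearMap
    (e.symm.toContinuousLinearEquiv : F →L[ℂ] E).completion.toLinearMap
    (by
      ext x
      induction x using UniformSpace.Completion.induction_on with
      | hp =>
        exact isClosed_eq (((e.toContinuousLinearEquiv : E →L[ℂ] F).completion.continuous).comp
          ((e.symm.toContinuousLinearEquiv : F →L[ℂ] E).completion.continuous)) continuous_id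
      | ih a => simp)
    (by
      ext x
      induction x using UniformSpace.Completion.induction_on with
      | hp =>
        exact isClosed_eq (((e.symm.toContinuousLinearEquiv : F →L[ℂ] E).completion.continuous).comp
          ((e.toContinuousLinearEquiv : E →L[ℂ] F).completion.continuous)) continuous_id
      | ih a => simp)
  norm_map' x := by
    change ‖(e.toContinuousLinearEquiv : E →L[ℂ] F).completion x‖ = ‖x‖
    induction x using UniformSpace.Completion.induction_on with
    | hp =>
      exact isClosed_eq
        ((e.toContinuousLinearEquiv : E →L[ℂ] F).completion.continuous.norm) continuous_norm
    | ih a => simp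

namespace UnitaryOperator

/-- The tensor product of two unitary operators, on the Hilbert space tensor product (the
completion of the algebraic one). -/
def tensor (A B : UnitaryOperator) : UnitaryOperator where
  space := UniformSpace.Completion (A.space ⊗[ℂ] B.space)
  op := completionIsometryEquiv (TensorProduct.congrIsometry A.op B.op)

/-- The tensor power `U^{⊗n}`. -/
def tensorPower (U : UnitaryOperator) : ℕ → UnitaryOperator
  | 0 => ⟨ℂ, LinearIsometryEquiv.refl ℂ ℂ⟩
  | n + 1 => (tensorPower U n).tensor U

end UnitaryOperator

/-- The unitary operator `f ↦ f ∘ T` on `L²(μ)` induced by an automorphism `T`. -/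
def koopman {α : Type} [MeasurableSpace α] {μ : Measure α} (T : α ≃ᵐ α)
    (hT : MeasurePreserving T μ μ) : UnitaryOperator where
  space := Lp ℂ 2 μ
  op := LinearIsometryEquiv.ofSurjective (Lp.compMeasurePreservingₗᵢ ℂ T hT) (by
    intro g
    refine ⟨Lp.compMeasurePreserving T.symm (hT.symm T) g, ?_⟩
    change Lp.compMeasurePreserving T hT (Lp.compMeasurePreserving T.symm (hT.symm T) g) = g
    apply Lp.ext
    have h1 := Lp.coeFn_compMeasurePreserving (Lp.compMeasurePreserving T.symm (hT.symm T) g) hT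
    have h2 := hT.quasiMeasurePreserving.ae_eq_comp
      (Lp.coeFn_compMeasurePreserving g (hT.symm T))
    refine h1.trans (h2.trans (Filter.Eventually.of_forall fun x => ?_))
    simp)

/-- The unitary operator induced by a rank-one construction. -/
def RankOneConstruction.operator {P : RankOneParams} (R : RankOneConstruction P) :
    UnitaryOperator :=
  koopman R.T R.measurePreserving

/-! ### Spectral type -/

instance Circle.instMeasurableSpaceBorel : MeasurableSpace Circle := borel Circle

instance Circle.instBorelSpaceBorel : BorelSpace Circle := ⟨rfl⟩

/-- Normalized Lebesgue measure on the unit circle. -/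
def circleLebesgue : Measure Circle := Measure.haarMeasure ⊤

namespace UnitaryOperator

/-- `U` is unitarily equivalent to the operator `f(t, k) ↦ t f(t, k)` on `L²(𝕋 × ℕ, σ)`. -/
def IsModel (U : UnitaryOperator) (σ : Measure (Circle × ℕ)) : Prop :=
  ∃ W : U.space ≃ₗᵢ[ℂ] Lp ℂ 2 σ,
    ∀ x, (W (U.op x) : Circle × ℕ → ℂ) =ᵐ[σ] fun p => (p.1 : ℂ) * (W x : Circle × ℕ → ℂ) p

/-- `ρ` is a spectral measure of `U`: the projection to the circle of a normalized measure `σ` for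
which `U` is multiplication by the circle coordinate on `L²(𝕋 × ℕ, σ)`. -/
def IsSpectralMeasure (U : UnitaryOperator) (ρ : Measure Circle) : Prop :=
  ∃ σ : Measure (Circle × ℕ), IsProbabilityMeasure σ ∧ U.IsModel σ ∧ ρ = σ.map Prod.fst

/-- The spectrum of `U` is singular. -/
def HasSingularSpectrum (U : UnitaryOperator) : Prop :=
  ∃ ρ, U.IsSpectralMeasure ρ ∧ ρ.MutuallySingular circleLebesgue

/-- The spectrum of `U` is absolutely continuous. -/
def HasAbsolutelyContinuousSpectrum (U : UnitaryOperator) : Prop :=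
  ∃ ρ, U.IsSpectralMeasure ρ ∧ ρ.AbsolutelyContinuous circleLebesgue

end UnitaryOperator

/-- The convolution power `ρ^{*n}` of a measure on the circle. -/
def convPower (ρ : Measure Circle) : ℕ → Measure Circle
  | 0 => Measure.dirac 1
  | n + 1 => (convPower ρ n).mconv ρ

end

/-! Put the columns of stage `j` at the offsets `h j * (3 ^ i - 1)`. For `i ≠ i'` the differences `h
j * (3 ^ i - 3 ^ i')` are pairwise distinct (`powDiff_injective`) and are even multiples of `h j`,
so the windows of radius `h j` about them are disjoint (`eq_of_abs_sub_mul_lt`). Hence a return time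
`m > h j` determines the pair of columns involved, which is the Sidon property, and the correlations
can be computed exactly.

Let `e J` be the normalized indicator of the base of stage `J`. It is `r_J ^ (-1/2)` times a sum of
shifts of `e (J + 1)`, and it has no returns before time `2 * h J`. So its spectral measure `ν J`
is, formally, the Riesz product of the factors `|∑ i, z ^ (h j * 3 ^ i)| ^ 2 / r j`, `j ≥ J`. Each
stage keeps the Fourier coefficients already found and adds `r_N ^ 2 - r_N` disjoint copies of them,
scaled by `1 / r_N`.

Power `n + 1`. Because the copies are disjoint, the coefficients of the convolution power satisfy `∑
|c| ^ 2 ≤ ∏ (1 + r_j ^ (-2n))` (`sum_corr_pow_le`). If `∑ r_j ^ (-2n)` converges, the coefficients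
are square summable and the measure is absolutely continuous (`absolutelyContinuous_of_coeff`).

Power `n`. The coefficient at each difference of stage `j` is `ε j = r_j ^ (-n)`. Test the measure
with `∑ j, ε j * diffPoly (h j) (r j)`: under Lebesgue measure the mean is `0`, under the
convolution power it is comparable with `∑ r_j ^ (2 - 2n)`. Different stages are uncorrelated and
under both measures the variance is at most twice that same mean. If the series diverges,
Chebyshev's inequality separates the two measures (`IsRieszCoeff.mutuallySingular`). Taking `r_j` of
order `j ^ (1 / (2n - 2))` meets both conditions on the series.

From vectors to operators. The cyclic subspaces of the `e J` increase and together are total, and an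
elementary tensor has the convolution of the spectral measures of its factors. Thus every spectral
measure of `U`, its convolution powers, and some spectral measure of each tensor power are dominated
by sums of convolution powers of the `ν J` (`IsRankOneSequence.spectrum`).

Finally the transformation is built explicitly out of half-intervals. Columns are stacked from right
to left, so that the bases shrink to a point they do not contain; this makes the map defined and
invertible everywhere, not merely almost everywhere. -/

/-! ### Fourier coefficients of measures on the circle -/

/-- The character `z ↦ z ^ k` of the circle. -/
noncomputable def circlePow (k : ℤ) : C(Circle, ℂ) where
  toFun z := ((z ^ k : Circle) : ℂ)
  continuous_toFun := by
    have h : Continuous fun z : Circle => (z : ℂ) := by fun_prop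
    exact h.comp (continuous_zpow k)

lemma circlePow_apply (k : ℤ) (z : Circle) : circlePow k z = ((z ^ k : Circle) : ℂ) := rfl

lemma circlePow_add (k l : ℤ) : circlePow (k + l) = circlePow k * circlePow l := by
  ext z; simp [circlePow_apply, zpow_add]

lemma circlePow_zero : circlePow 0 = 1 := by ext z; simp [circlePow_apply]

lemma norm_circlePow_apply (k : ℤ) (z : Circle) : ‖circlePow k z‖ = 1 := by
  rw [circlePow_apply]; exact Circle.norm_coe _

lemma star_circlePow_apply (k : ℤ) (z : Circle) :
    (starRingEnd ℂ) (circlePow k z) = circlePow (-k) z := by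
  rw [circlePow_apply, circlePow_apply, zpow_neg, Circle.coe_inv_eq_conj]

lemma integrable_continuousMap {X : Type*} [TopologicalSpace X] [CompactSpace X]
    [MeasurableSpace X] [OpensMeasurableSpace X] (μ : Measure X) [IsFiniteMeasure μ]
    (f : C(X, ℂ)) : Integrable f μ :=
  f.continuous.integrable_of_hasCompactSupport (HasCompactSupport.of_compactSpace _)

/-- The Fourier coefficients of a measure on the circle. -/
noncomputable def circleCoeff (μ : Measure Circle) (k : ℤ) : ℂ := ∫ z, circlePow k z ∂μ

/-- Stone–Weierstrass: the characters form a monoid, so the algebra they generate is their linear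
span, and it is closed under conjugation because conjugation inverts a character. -/
lemma span_circlePow_closure_eq_top :
    (Submodule.span ℂ (range circlePow)).topologicalClosure = ⊤ := by
  let S : Submonoid C(Circle, ℂ) :=
    { carrier := range circlePow
      mul_mem' := by
        rintro _ _ ⟨k, rfl⟩ ⟨l, rfl⟩
        exact ⟨k + l, circlePow_add k l⟩
      one_mem' := ⟨0, circlePow_zero⟩ }
  let A : StarSubalgebra ℂ C(Circle, ℂ) :=
    { toSubalgebra := Algebra.adjoin ℂ (range circlePow)
      star_mem' := by
        change Algebra.adjoin ℂ (range circlePow) ≤ star (Algebra.adjoin ℂ (range circlePow))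
        refine Algebra.adjoin_le ?_
        rintro _ ⟨k, rfl⟩
        refine Algebra.subset_adjoin ⟨-k, ?_⟩
        ext z
        exact (star_circlePow_apply k z).symm }
  have hA : (A.toSubalgebra).toSubmodule = Submodule.span ℂ (range circlePow) := by
    change (Algebra.adjoin ℂ (range circlePow)).toSubmodule = _
    rw [Algebra.adjoin_eq_span]
    congr 1
    exact congrArg SetLike.coe (Submonoid.closure_eq S)
  have hsep : A.SeparatesPoints := by
    intro x y hxy
    refine ⟨_, ⟨circlePow 1, Algebra.subset_adjoin ⟨1, rfl⟩, rfl⟩, ?_⟩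
    simpa [circlePow_apply, Circle.ext_iff] using hxy
  rw [← hA]
  exact congrArg (fun B : StarSubalgebra ℂ C(Circle, ℂ) => B.toSubalgebra.toSubmodule)
    (ContinuousMap.starSubalgebra_topologicalClosure_eq_top_of_separatesPoints A hsep)

/-- A closed property of continuous functions holds for all of them if it holds for trigonometric
polynomials. -/
lemma circle_trigPoly_induction {p : C(Circle, ℂ) → Prop} (hp : IsClosed {f | p f})
    (h : ∀ f ∈ Submodule.span ℂ (range circlePow), p f) (f : C(Circle, ℂ)) : p f := by
  have hf : f ∈ (Submodule.span ℂ (range circlePow)).topologicalClosure := by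
    rw [span_circlePow_closure_eq_top]; trivial
  exact closure_minimal (fun g hg => h g hg) hp hf

lemma continuous_integral_continuousMap {X : Type*} [TopologicalSpace X] [CompactSpace X]
    [MeasurableSpace X] [BorelSpace X] (μ : Measure X) [IsFiniteMeasure μ] :
    Continuous fun f : C(X, ℂ) => ∫ z, f z ∂μ := by
  refine LipschitzWith.continuous (K := ⟨μ.real univ, measureReal_nonneg⟩) ?_
  refine LipschitzWith.of_dist_le_mul fun f g => ?_
  rw [dist_eq_norm, ← integral_sub (integrable_continuousMap μ f) (integrable_continuousMap μ g)]
  refine (norm_integral_le_of_norm_le_const (C := dist f g)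
    (Filter.Eventually.of_forall fun x => ?_)).trans (le_of_eq (mul_comm _ _))
  rw [← dist_eq_norm]
  exact ContinuousMap.dist_apply_le_dist x

lemma circle_integral_congr {μ ν : Measure Circle} [IsFiniteMeasure μ] [IsFiniteMeasure ν]
    (h : ∀ k, circleCoeff μ k = circleCoeff ν k) (f : C(Circle, ℂ)) :
    ∫ z, f z ∂μ = ∫ z, f z ∂ν := by
  refine circle_trigPoly_induction (p := fun f => ∫ z, f z ∂μ = ∫ z, f z ∂ν) ?_ ?_ f
  · exact isClosed_eq (continuous_integral_continuousMap μ) (continuous_integral_continuousMap ν)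
  · intro f hf
    induction hf using Submodule.span_induction with
    | mem x hx => obtain ⟨k, rfl⟩ := hx; exact h k
    | zero => simp
    | add x y _ _ hx hy =>
      simp only [ContinuousMap.add_apply]
      rw [integral_add (integrable_continuousMap μ x) (integrable_continuousMap μ y),
        integral_add (integrable_continuousMap ν x) (integrable_continuousMap ν y), hx, hy]
    | smul a x _ hx =>
      simp only [ContinuousMap.smul_apply]
      rw [integral_smul, integral_smul, hx]

/-- A finite measure on the circle is determined by its Fourier coefficients. -/
theorem circleMeasure_ext {μ ν : Measure Circle} [IsFiniteMeasure μ] [IsFiniteMeasure ν]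
    (h : ∀ k, circleCoeff μ k = circleCoeff ν k) : μ = ν := by
  refine ext_of_forall_integral_eq_of_IsFiniteMeasure fun f => ?_
  have := circle_integral_congr h ⟨fun z => (f z : ℂ), by fun_prop⟩
  simp only [ContinuousMap.coe_mk] at this
  rw [integral_complex_ofReal, integral_complex_ofReal] at this
  exact_mod_cast this

lemma circleCoeff_mconv (μ ν : Measure Circle) [IsFiniteMeasure μ] [IsFiniteMeasure ν] (k : ℤ) :
    circleCoeff (μ.mconv ν) k = circleCoeff μ k * circleCoeff ν k := by
  unfold circleCoeff
  rw [integral_mconv (integrable_continuousMap _ _), ← integral_mul_const]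
  refine integral_congr_ae (Filter.Eventually.of_forall fun x => ?_)
  simp only
  rw [← integral_const_mul]
  refine integral_congr_ae (Filter.Eventually.of_forall fun y => ?_)
  simp [circlePow_apply, mul_zpow]

instance isFiniteMeasure_convPower (ρ : Measure Circle) [IsFiniteMeasure ρ] (n : ℕ) :
    IsFiniteMeasure (convPower ρ n) := by
  induction n with
  | zero => unfold convPower; infer_instance
  | succ n ih => unfold convPower; infer_instance

instance isProbabilityMeasure_convPower (ρ : Measure Circle) [IsProbabilityMeasure ρ] (n : ℕ) :
    IsProbabilityMeasure (convPower ρ n) := by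
  induction n with
  | zero => unfold convPower; infer_instance
  | succ n ih => unfold convPower; infer_instance

lemma circleCoeff_convPower (ρ : Measure Circle) [IsFiniteMeasure ρ] (n : ℕ) (k : ℤ) :
    circleCoeff (convPower ρ n) k = circleCoeff ρ k ^ n := by
  induction n with
  | zero => simp [convPower, circleCoeff, circlePow_apply]
  | succ n ih => rw [convPower, circleCoeff_mconv, ih, pow_succ]

instance : IsProbabilityMeasure circleLebesgue := ⟨by
  have := Measure.haarMeasure_self (K₀ := (⊤ : TopologicalSpace.PositiveCompacts Circle))
  simpa [circleLebesgue] using this⟩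

instance : circleLebesgue.IsMulLeftInvariant := by unfold circleLebesgue; infer_instance

lemma circleCoeff_circleLebesgue (k : ℤ) :
    circleCoeff circleLebesgue k = if k = 0 then 1 else 0 := by
  split_ifs with hk
  · simp [hk, circleCoeff, circlePow_zero]
  -- Rotation by `exp (iπ/k)` changes the sign of `z ^ k`, so by invariance the integral equals its
  -- own negative.
  · let g : Circle := Circle.exp (Real.pi / k)
    have hg : g ^ k = Circle.exp Real.pi := by
      rw [← Circle.exp_zsmul, zsmul_eq_mul, mul_div_cancel₀]
      exact_mod_cast hk
    have h := integral_mul_left_eq_self (μ := circleLebesgue) (fun z => circlePow k z) g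
    have h2 : (fun z : Circle => circlePow k (g * z)) = fun z => -circlePow k z := by
      funext z
      rw [circlePow_apply, mul_zpow, hg, Circle.coe_mul]
      simp [circlePow_apply]
    rw [h2, integral_neg] at h
    unfold circleCoeff
    linear_combination (-1 / 2 : ℂ) * h

lemma integral_trigPoly (μ : Measure Circle) [IsFiniteMeasure μ] (a : ℤ →₀ ℂ) :
    ∫ z, (a.sum fun k c => c • circlePow k) z ∂μ = a.sum fun k c => c * circleCoeff μ k := by
  simp only [Finsupp.sum, ContinuousMap.coe_sum, Finset.sum_apply, ContinuousMap.coe_smul,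
    Pi.smul_apply, smul_eq_mul]
  rw [integral_finsetSum]
  · refine Finset.sum_congr rfl fun k _ => ?_
    rw [integral_const_mul]; rfl
  · intro k _
    exact (integrable_continuousMap μ (circlePow k)).const_mul _

/-- Parseval's identity for trigonometric polynomials. -/
lemma integral_norm_sq_trigPoly (a : ℤ →₀ ℂ) :
    ∫ z, ‖(a.sum fun k c => c • circlePow k) z‖ ^ 2 ∂circleLebesgue = a.sum fun _ c => ‖c‖ ^ 2 := by
  have h : ∀ z, ((‖(a.sum fun k c => c • circlePow k) z‖ ^ 2 : ℝ) : ℂ) =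
      ∑ k ∈ a.support, ∑ l ∈ a.support,
        (a k * (starRingEnd ℂ) (a l)) * circlePow (k - l) z := by
    intro z
    push_cast
    rw [← Complex.mul_conj']
    simp only [Finsupp.sum, ContinuousMap.coe_sum, Finset.sum_apply, ContinuousMap.coe_smul,
      Pi.smul_apply, smul_eq_mul, map_sum, map_mul, star_circlePow_apply]
    rw [Finset.sum_mul_sum]
    refine Finset.sum_congr rfl fun k _ => Finset.sum_congr rfl fun l _ => ?_
    rw [sub_eq_add_neg, circlePow_add, ContinuousMap.mul_apply]
    ring
  have h2 : ((∫ z, ‖(a.sum fun k c => c • circlePow k) z‖ ^ 2 ∂circleLebesgue : ℝ) : ℂ) =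
      ((a.sum fun _ c => ‖c‖ ^ 2 : ℝ) : ℂ) := by
    rw [← integral_complex_ofReal]
    simp_rw [h]
    rw [integral_finsetSum]
    · simp only [Finsupp.sum]
      push_cast
      refine Finset.sum_congr rfl fun k hk => ?_
      rw [integral_finsetSum]
      · simp_rw [integral_const_mul]
        change ∑ l ∈ a.support, a k * (starRingEnd ℂ) (a l) * circleCoeff circleLebesgue (k - l) = _
        simp_rw [circleCoeff_circleLebesgue, sub_eq_zero]
        rw [Finset.sum_eq_single k]
        · simp [Complex.mul_conj']
        · intro l _ hl; simp [hl.symm]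
        · intro hk'; exact absurd hk hk'
      · intro l _
        exact (integrable_continuousMap _ (circlePow _)).const_mul _
    · intro k _
      refine integrable_finsetSum _ fun l _ => ?_
      exact (integrable_continuousMap _ (circlePow _)).const_mul _
  exact_mod_cast h2

/-- Cauchy–Schwarz and Parseval for trigonometric polynomials; both sides are continuous in the sup
norm, so the bound passes to all continuous functions. -/
lemma norm_integral_sq_le_of_coeff {μ : Measure Circle} [IsFiniteMeasure μ] {C : ℝ}
    (hC : ∀ F : Finset ℤ, ∑ k ∈ F, ‖circleCoeff μ k‖ ^ 2 ≤ C) (f : C(Circle, ℂ)) :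
    ‖∫ z, f z ∂μ‖ ^ 2 ≤ C * ∫ z, ‖f z‖ ^ 2 ∂circleLebesgue := by
  have hC0 : 0 ≤ C := by simpa using hC ∅
  refine circle_trigPoly_induction
    (p := fun f => ‖∫ z, f z ∂μ‖ ^ 2 ≤ C * ∫ z, ‖f z‖ ^ 2 ∂circleLebesgue) ?_ ?_ f
  · refine isClosed_le (((continuous_integral_continuousMap μ).norm).pow 2)
      (continuous_const.mul ?_)
    have h1 : Continuous fun f : C(Circle, ℂ) => ∫ z, (star f * f) z ∂circleLebesgue :=
      (continuous_integral_continuousMap circleLebesgue).comp (by fun_prop)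
    have h2 : (fun f : C(Circle, ℂ) => ∫ z, ‖f z‖ ^ 2 ∂circleLebesgue) =
        fun f => (∫ z, (star f * f) z ∂circleLebesgue).re := by
      funext f
      have : ∀ z, (star f * f) z = ((‖f z‖ ^ 2 : ℝ) : ℂ) := by
        intro z
        push_cast
        rw [← Complex.conj_mul']; rfl
      simp_rw [this]
      rw [integral_complex_ofReal, Complex.ofReal_re]
    rw [h2]
    exact Complex.continuous_re.comp h1
  · intro f hf
    obtain ⟨a, rfl⟩ := (Finsupp.mem_span_range_iff_exists_finsupp).1 hf
    rw [integral_trigPoly, integral_norm_sq_trigPoly]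
    simp only [Finsupp.sum]
    calc ‖∑ k ∈ a.support, a k * circleCoeff μ k‖ ^ 2
        ≤ (∑ k ∈ a.support, ‖a k‖ * ‖circleCoeff μ k‖) ^ 2 := by
          gcongr
          refine (norm_sum_le _ _).trans (le_of_eq ?_)
          simp
      _ ≤ (∑ k ∈ a.support, ‖a k‖ ^ 2) * ∑ k ∈ a.support, ‖circleCoeff μ k‖ ^ 2 :=
          Finset.sum_mul_sq_le_sq_mul_sq _ _ _
      _ ≤ (∑ k ∈ a.support, ‖a k‖ ^ 2) * C := by
          gcongr
          exact hC _
      _ = _ := mul_comm _ _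

/-- A measure with square summable Fourier coefficients is absolutely continuous. -/
theorem absolutelyContinuous_of_coeff {μ : Measure Circle} [IsFiniteMeasure μ] {C : ℝ}
    (hC : ∀ F : Finset ℤ, ∑ k ∈ F, ‖circleCoeff μ k‖ ^ 2 ≤ C) : μ ≪ circleLebesgue := by
  have hC0 : 0 ≤ C := by simpa using hC ∅
  refine Measure.AbsolutelyContinuous.mk fun N hN hN0 => ?_
  -- By inner regularity a compact null set suffices. Its indicator is approximated from above by
  -- continuous functions with values in `[0, 1]`, for which the square is at most the function, so
  -- the `L²` bound tends to `0`.
  rw [hN.measure_eq_iSup_isCompact_of_ne_top (measure_ne_top μ N)]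
  simp only [ENNReal.iSup_eq_zero]
  intro K hKN hK
  have hK0 : circleLebesgue K = 0 := measure_mono_null hKN hN0
  have hlim := HasOuterApproxClosed.tendsto_lintegral_apprSeq hK.isClosed circleLebesgue
  rw [hK0] at hlim
  have hreal : Filter.Tendsto (fun n => C * ∫ x, (hK.isClosed.apprSeq n x : ℝ) ∂circleLebesgue)
      Filter.atTop (nhds 0) := by
    have := ((ENNReal.tendsto_toReal ENNReal.zero_ne_top).comp hlim).const_mul C
    simp only [ENNReal.toReal_zero, mul_zero] at this
    refine this.congr fun n => ?_
    rw [Function.comp_apply, BoundedContinuousFunction.toReal_lintegral_coe_eq_integral]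
  have hbound : ∀ n, (μ K).toReal ^ 2 ≤
      C * ∫ x, (hK.isClosed.apprSeq n x : ℝ) ∂circleLebesgue := by
    intro n
    let g : C(Circle, ℂ) := ⟨fun x => ((hK.isClosed.apprSeq n x : ℝ) : ℂ), by fun_prop⟩
    have h1 := norm_integral_sq_le_of_coeff hC g
    have h2 : ‖∫ z, g z ∂μ‖ = ∫ x, (hK.isClosed.apprSeq n x : ℝ) ∂μ := by
      change ‖∫ z, ((hK.isClosed.apprSeq n z : ℝ) : ℂ) ∂μ‖ = _
      rw [integral_complex_ofReal, Complex.norm_real, Real.norm_of_nonneg]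
      exact integral_nonneg fun x => NNReal.coe_nonneg _
    have h3 : (μ K).toReal ≤ ∫ x, (hK.isClosed.apprSeq n x : ℝ) ∂μ := by
      rw [← BoundedContinuousFunction.toReal_lintegral_coe_eq_integral]
      exact ENNReal.toReal_mono
        (BoundedContinuousFunction.lintegral_lt_top_of_nnreal μ _).ne
        (HasOuterApproxClosed.measure_le_lintegral hK.isClosed μ n)
    calc (μ K).toReal ^ 2 ≤ ‖∫ z, g z ∂μ‖ ^ 2 := by rw [h2]; gcongr
      _ ≤ C * ∫ z, ‖g z‖ ^ 2 ∂circleLebesgue := h1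
      _ ≤ _ := by
        refine mul_le_mul_of_nonneg_left ?_ hC0
        refine integral_mono ?_ ?_ fun z => ?_
        · exact Continuous.integrable_of_hasCompactSupport (by fun_prop)
            (HasCompactSupport.of_compactSpace _)
        · exact Continuous.integrable_of_hasCompactSupport (by fun_prop)
            (HasCompactSupport.of_compactSpace _)
        · change ‖((hK.isClosed.apprSeq n z : ℝ) : ℂ)‖ ^ 2 ≤ _
          rw [Complex.norm_real, Real.norm_of_nonneg (NNReal.coe_nonneg _)]
          have h4 : (hK.isClosed.apprSeq n z : ℝ) ≤ 1 := by
            exact_mod_cast HasOuterApproxClosed.apprSeq_apply_le_one hK.isClosed n z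
          have h5 : (0 : ℝ) ≤ hK.isClosed.apprSeq n z := NNReal.coe_nonneg _
          nlinarith
  have h0 : (μ K).toReal ^ 2 ≤ 0 := ge_of_tendsto' hreal hbound
  have h1 : (μ K).toReal = 0 := by
    have := sq_nonneg (μ K).toReal
    exact pow_eq_zero_iff two_ne_zero |>.1 (le_antisymm h0 this)
  exact (ENNReal.toReal_eq_zero_iff _).1 h1 |>.resolve_right (measure_ne_top μ K)

/-! ### Criteria for mutual singularity. -/

/-- Two finite measures are mutually singular if they are concentrated, up to small errors, on
complementary sets. -/
lemma mutuallySingular_of_forall_exists {α : Type*} [MeasurableSpace α] {μ ν : Measure α}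
    [IsFiniteMeasure μ] [IsFiniteMeasure ν]
    (h : ∀ ε : ENNReal, 0 < ε → ∃ s, μ s ≤ ε ∧ ν sᶜ ≤ ε) : μ.MutuallySingular ν := by
  rw [Measure.mutuallySingular_iff_disjoint, disjoint_iff_inf_le]
  set κ := μ ⊓ ν with hκ
  have h1 : κ ≤ μ := inf_le_left
  have h2 : κ ≤ ν := inf_le_right
  have h3 : κ univ = 0 := by
    refine le_antisymm (ENNReal.le_of_forall_pos_le_add fun ε hε _ => ?_) zero_le
    obtain ⟨s, hs1, hs2⟩ := h (ε / 2) (by simpa using hε.ne')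
    calc κ univ ≤ κ s + κ sᶜ := by
          rw [← union_compl_self s]; exact measure_union_le _ _
      _ ≤ ε / 2 + ε / 2 := add_le_add ((h1 s).trans hs1) ((h2 sᶜ).trans hs2)
      _ = 0 + ε := by rw [ENNReal.add_halves, zero_add]
  rw [Measure.measure_univ_eq_zero.1 h3]
  exact bot_le

/-- Two probability measures are mutually singular if there are functions whose means are far
apart in comparison with their standard deviations. -/
lemma mutuallySingular_of_variance {α : Type*} [MeasurableSpace α] {μ ν : Measure α}
    [IsProbabilityMeasure μ] [IsProbabilityMeasure ν] (S : ℕ → α → ℝ) (M : ℕ → ℝ) (C : ℝ)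
    (hM : Filter.Tendsto M Filter.atTop Filter.atTop)
    (hSμ : ∀ N, MemLp (S N) 2 μ) (hSν : ∀ N, MemLp (S N) 2 ν)
    (hμ : ∀ N, ∫ x, S N x ∂μ = M N) (hν : ∀ N, ∫ x, S N x ∂ν = 0)
    (hvμ : ∀ N, ProbabilityTheory.variance (S N) μ ≤ C * M N)
    (hvν : ∀ N, ProbabilityTheory.variance (S N) ν ≤ C * M N) : μ.MutuallySingular ν := by
  refine mutuallySingular_of_forall_exists fun ε hε => ?_
  have hlim : Filter.Tendsto (fun N => ENNReal.ofReal (4 * C / M N)) Filter.atTop (nhds 0) := by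
    rw [← ENNReal.ofReal_zero]
    exact ENNReal.tendsto_ofReal (hM.const_div_atTop _)
  obtain ⟨N, hN1, hN2⟩ := ((hlim.eventually_lt_const hε).and (hM.eventually_gt_atTop 0)).exists
  have hkey : ∀ V, V ≤ C * M N → ENNReal.ofReal (V / (M N / 2) ^ 2) ≤ ε := by
    intro V hV
    refine le_trans (ENNReal.ofReal_le_ofReal ?_) hN1.le
    rw [div_le_div_iff₀ (by positivity) hN2]
    nlinarith [mul_le_mul_of_nonneg_right hV hN2.le]
  -- Chebyshev on both sides of the threshold: under `μ` the values lie near `M N`, under `ν` near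
  -- `0`, and each exceptional set has measure at most `C * M / (M / 2) ^ 2 = 4 * C / M`.
  refine ⟨{x | M N / 2 ≤ |S N x - M N|}, ?_, ?_⟩
  · have := ProbabilityTheory.meas_ge_le_variance_div_sq (hSμ N) (half_pos hN2)
    rw [hμ] at this
    exact this.trans (hkey _ (hvμ N))
  · have := ProbabilityTheory.meas_ge_le_variance_div_sq (hSν N) (half_pos hN2)
    rw [hν] at this
    refine (measure_mono fun x hx => ?_).trans (this.trans (hkey _ (hvν N)))
    simp only [mem_compl_iff, mem_ofPred_eq, not_le, sub_zero] at hx ⊢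
    have := abs_lt.1 hx
    exact le_trans (by linarith) (le_abs_self _)

/-! ### Correlations of rank-one constructions with geometrically growing offsets -/

/-- The difference `3 ^ i - 3 ^ i'`. -/
def powDiff (p : ℕ × ℕ) : ℤ := 3 ^ p.1 - 3 ^ p.2

lemma powDiff_swap (p : ℕ × ℕ) : powDiff p.swap = -powDiff p := by simp [powDiff]

lemma even_powDiff (p : ℕ × ℕ) : Even (powDiff p) :=
  (Odd.pow (by decide)).sub_odd (Odd.pow (by decide))

lemma powDiff_ne_zero {p : ℕ × ℕ} (hp : p.1 ≠ p.2) : powDiff p ≠ 0 := by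
  intro h
  have h1 : (3 : ℤ) ^ p.1 = 3 ^ p.2 := by unfold powDiff at h; linarith
  exact hp (pow_right_injective₀ (by norm_num : (0 : ℤ) < 3) (by norm_num) h1)

lemma powDiff_self (i : ℕ) : powDiff (i, i) = 0 := by simp [powDiff]

/-- The leading power dominates: with `q.1 = m + 1`, the left side is below `3 ^ m` and the right
side is at least `2 * 3 ^ m`. So a positive difference determines its larger exponent. -/
lemma powDiff_lt_of_fst_lt {p q : ℕ × ℕ} (hq : q.2 < q.1) (h : p.1 < q.1) :
    powDiff p < powDiff q := by
  unfold powDiff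
  obtain ⟨m, hm⟩ : ∃ m, q.1 = m + 1 := ⟨q.1 - 1, by omega⟩
  rw [hm] at h hq ⊢
  have h1 : (3 : ℤ) ^ p.1 ≤ 3 ^ m := pow_le_pow_right₀ (by norm_num) (by omega)
  have h2 : (3 : ℤ) ^ q.2 ≤ 3 ^ m := pow_le_pow_right₀ (by norm_num) (by omega)
  have h3 : (0 : ℤ) < 3 ^ p.2 := by positivity
  have h4 : (0 : ℤ) < 3 ^ m := by positivity
  rw [pow_succ]
  linarith

lemma lt_of_powDiff_pos {p : ℕ × ℕ} (h : 0 < powDiff p) : p.2 < p.1 := by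
  by_contra hle
  have := pow_le_pow_right₀ (by norm_num : (1 : ℤ) ≤ 3) (not_lt.1 hle)
  unfold powDiff at h; linarith

lemma powDiff_injective_of_pos {p q : ℕ × ℕ} (hp : 0 < powDiff p) (h : powDiff p = powDiff q) :
    p = q := by
  have hp' := lt_of_powDiff_pos hp
  have hq' := lt_of_powDiff_pos (h ▸ hp)
  have h1 : p.1 = q.1 := by
    rcases lt_trichotomy p.1 q.1 with h1 | h1 | h1
    · exact absurd h (powDiff_lt_of_fst_lt hq' h1).ne
    · exact h1
    · exact absurd h (powDiff_lt_of_fst_lt hp' h1).ne'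
  refine Prod.ext h1 (pow_right_injective₀ (by norm_num : (0 : ℤ) < 3) (by norm_num) ?_)
  unfold powDiff at h
  rw [h1] at h
  simp only
  linarith

/-- The powers of `3` form a Sidon set. Off-diagonality of one of the pairs is enough, since it
makes the common value nonzero. -/
lemma powDiff_injective {p q : ℕ × ℕ} (hp : p.1 ≠ p.2) (h : powDiff p = powDiff q) : p = q := by
  rcases lt_or_gt_of_ne (powDiff_ne_zero hp) with h1 | h1
  · have : p.swap = q.swap := by
      refine powDiff_injective_of_pos ?_ ?_ <;> rw [powDiff_swap]
      · linarith
      · rw [powDiff_swap, h]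
    exact Prod.swap_injective this
  · exact powDiff_injective_of_pos h1 h

lemma abs_powDiff_le {r : ℕ} {p : ℕ × ℕ} (h1 : p.1 < r) (h2 : p.2 < r) :
    3 * (|powDiff p| + 1) ≤ 3 ^ r := by
  obtain ⟨m, rfl⟩ : ∃ m, r = m + 1 := ⟨r - 1, by omega⟩
  have h3 : (3 : ℤ) ^ p.1 ≤ 3 ^ m := pow_le_pow_right₀ (by norm_num) (by omega)
  have h4 : (3 : ℤ) ^ p.2 ≤ 3 ^ m := pow_le_pow_right₀ (by norm_num) (by omega)
  have h5 : (1 : ℤ) ≤ 3 ^ p.1 := one_le_pow₀ (by norm_num)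
  have h6 : (1 : ℤ) ≤ 3 ^ p.2 := one_le_pow₀ (by norm_num)
  have : |powDiff p| ≤ 3 ^ m - 1 := by
    unfold powDiff; rw [abs_le]; constructor <;> linarith
  rw [pow_succ]; linarith

/-- Heights `h` and cutting numbers `r` with `h (j + 1) = h j * (3 ^ r j - 1)`. -/
structure IsTernaryGrowth (h r : ℕ → ℕ) : Prop where
  pos : 0 < h 0
  two_le : ∀ j, 2 ≤ r j
  succ : ∀ j, h (j + 1) = h j * (3 ^ r j - 1)

namespace IsTernaryGrowth

variable {h r : ℕ → ℕ} (H : IsTernaryGrowth h r)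
include H

lemma cast_succ (j : ℕ) : (h (j + 1) : ℤ) = h j * (3 ^ r j - 1) := by
  rw [H.succ]
  push_cast [Nat.one_le_pow' (r j) 2]
  rfl

lemma nine_le (j : ℕ) : (9 : ℤ) ≤ 3 ^ r j := by
  calc (9 : ℤ) = 3 ^ 2 := by norm_num
    _ ≤ 3 ^ r j := pow_le_pow_right₀ (by norm_num) (H.two_le j)

lemma height_pos (j : ℕ) : (0 : ℤ) < h j := by
  induction j with
  | zero => exact_mod_cast H.pos
  | succ j ih =>
    rw [H.cast_succ]
    exact mul_pos ih (by linarith [H.nine_le j])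

lemma two_mul_le_succ (j : ℕ) : (2 * h j : ℤ) ≤ h (j + 1) := by
  rw [H.cast_succ]
  nlinarith [H.height_pos j, H.nine_le j]

lemma monotone : Monotone h :=
  monotone_nat_of_le_succ fun j => by
    have := H.two_mul_le_succ j
    have := H.height_pos j
    omega

lemma lt_height (j : ℕ) : (j : ℤ) < h j := by
  induction j with
  | zero => exact H.height_pos 0
  | succ j ih =>
    have := H.two_mul_le_succ j
    push_cast; linarith

lemma tendsto_exists (k : ℤ) : ∃ N, |k| < h N :=
  ⟨k.natAbs, by have := H.lt_height k.natAbs; rw [Int.abs_eq_natAbs]; exact this⟩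

/-- The factor `2` leaves room for sums of two differences of one stage, and the term `3 * h j` for
the windows about them, all inside the range `|k| < h (j + 1)` where coefficients are known. -/
lemma abs_mul_powDiff_le (j : ℕ) {p : ℕ × ℕ} (h1 : p.1 < r j) (h2 : p.2 < r j) :
    2 * |(h j : ℤ) * powDiff p| + 3 * h j ≤ h (j + 1) := by
  rw [H.cast_succ, abs_mul, abs_of_pos (H.height_pos j)]
  have h3 := abs_powDiff_le h1 h2
  have h4 := H.height_pos j
  have h5 := H.nine_le j
  nlinarith [mul_le_mul_of_nonneg_left h3 h4.le]

lemma shift (J : ℕ) : IsTernaryGrowth (fun j => h (J + j)) (fun j => r (J + j)) where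
  pos := by have := H.height_pos J; simpa using this
  two_le j := H.two_le _
  succ j := H.succ _

end IsTernaryGrowth

/-- Two close even multiples of `h` coincide. -/
lemma eq_of_abs_sub_mul_lt {h : ℕ} {k D D' : ℤ} (hD : Even D) (hD' : Even D')
    (h1 : |k - h * D| < h) (h2 : |k - h * D'| < h) : D = D' := by
  by_contra hne
  have h3 : (2 : ℤ) ≤ |D - D'| := by
    obtain ⟨a, ha⟩ := hD.sub hD'
    have : a ≠ 0 := by rintro rfl; exact hne (by linarith)
    rw [ha, abs_eq_max_neg]; omega
  have h4 : |(h : ℤ) * (D - D')| < 2 * h := by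
    calc |(h : ℤ) * (D - D')| = |(k - h * D') - (k - h * D)| := by ring_nf
      _ ≤ |k - h * D'| + |k - h * D| := abs_sub _ _
      _ < 2 * h := by linarith
  rw [abs_mul, Nat.abs_cast] at h4
  have : (0 : ℤ) ≤ h := by positivity
  nlinarith

/-! ### The recursion for correlations. -/

/-- The averaging operator that expresses the correlations of one stage through those of the
next one. -/
noncomputable def corrStep (h r : ℕ) (g : ℤ → ℝ) (k : ℤ) : ℝ :=
  (r : ℝ)⁻¹ * ∑ p ∈ Finset.range r ×ˢ Finset.range r, g (k - h * powDiff p)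

/-- The correlations of the initial tower computed at stage `N`. -/
noncomputable def corr (h r : ℕ → ℕ) : ℕ → ℤ → ℝ
  | 0 => fun k => if k = 0 then 1 else 0
  | N + 1 => corrStep (h N) (r N) (corr h r N)

lemma corr_nonneg (h r : ℕ → ℕ) (N : ℕ) (k : ℤ) : 0 ≤ corr h r N k := by
  induction N generalizing k with
  | zero => unfold corr; split_ifs <;> norm_num
  | succ N ih =>
    exact mul_nonneg (by positivity) (Finset.sum_nonneg fun p _ => ih _)

/-- The steps are convolutions. Commutation is needed because the dynamics gives stage `j` in terms
of stage `j + 1`, whereas `corr` is built upwards from stage `0`. -/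
lemma corrStep_comm (h r h' r' : ℕ) (g : ℤ → ℝ) :
    corrStep h r (corrStep h' r' g) = corrStep h' r' (corrStep h r g) := by
  funext k
  simp only [corrStep, ← Finset.mul_sum]
  rw [Finset.sum_comm, mul_left_comm]
  simp only [sub_right_comm]

/-- The composition of the first `N` averaging operators. -/
noncomputable def corrIter (h r : ℕ → ℕ) : ℕ → (ℤ → ℝ) → ℤ → ℝ
  | 0, g => g
  | N + 1, g => corrIter h r N (corrStep (h N) (r N) g)

lemma corrIter_corrStep (h r : ℕ → ℕ) (h' r' N : ℕ) (g : ℤ → ℝ) :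
    corrIter h r N (corrStep h' r' g) = corrStep h' r' (corrIter h r N g) := by
  induction N generalizing g with
  | zero => rfl
  | succ N ih => rw [corrIter, corrStep_comm, ih]; rfl

lemma corrIter_single (h r : ℕ → ℕ) (N : ℕ) :
    corrIter h r N (fun k => if k = 0 then 1 else 0) = corr h r N := by
  induction N with
  | zero => rfl
  | succ N ih => rw [corrIter, corrIter_corrStep, ih]; rfl

lemma corrIter_eq {h r : ℕ → ℕ} {γ : ℕ → ℤ → ℝ}
    (hγ : ∀ j, γ j = corrStep (h j) (r j) (γ (j + 1))) (N : ℕ) :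
    corrIter h r N (γ N) = γ 0 := by
  induction N with
  | zero => rfl
  | succ N ih => rw [corrIter, ← hγ, ih]

namespace IsTernaryGrowth

variable {h r : ℕ → ℕ} (H : IsTernaryGrowth h r)
include H

/-- Finite propagation: step `N` moves the argument by at most `h (N + 1) - h N`, so the radii `A +
h N` absorb all the displacements. -/
lemma corrIter_congr (N : ℕ) {g g' : ℤ → ℝ} {A : ℤ}
    (hg : ∀ m, |m| < A + h N → g m = g' m) {k : ℤ} (hk : |k| < A + h 0) :
    corrIter h r N g k = corrIter h r N g' k := by
  induction N generalizing g g' with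
  | zero => exact hg k hk
  | succ N ih =>
    refine ih fun m hm => ?_
    unfold corrStep
    congr 1
    refine Finset.sum_congr rfl fun p hp => hg _ ?_
    simp only [Finset.mem_product, Finset.mem_range] at hp
    have h1 := H.abs_mul_powDiff_le N hp.1 hp.2
    have h2 := abs_sub m (h N * powDiff p)
    have h3 := H.height_pos N
    have h4 := abs_nonneg ((h N : ℤ) * powDiff p)
    linarith

/-- Unrolling `N` steps leaves data of stage `N`, known only for `|m| < 2 * h N`; propagation with
`A = h N` uses exactly that window. -/
lemma eq_corr {γ : ℕ → ℤ → ℝ} (hγ : ∀ j, γ j = corrStep (h j) (r j) (γ (j + 1)))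
    (hγ0 : ∀ j (m : ℤ), |m| < 2 * h j → γ j m = if m = 0 then 1 else 0) (N : ℕ) {k : ℤ}
    (hk : |k| < h N) : γ 0 k = corr h r N k := by
  rw [← corrIter_single, ← corrIter_eq hγ N]
  refine H.corrIter_congr N (A := h N) (fun m hm => hγ0 N m (by linarith)) ?_
  have := H.height_pos 0
  linarith

lemma corr_support (N : ℕ) {k : ℤ} (hk : corr h r N k ≠ 0) : |k| < h N := by
  induction N generalizing k with
  | zero =>
    have : k = 0 := by by_contra hne; exact hk (by simp [corr, hne])
    simpa [this] using H.pos
  | succ N ih =>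
    rw [corr, corrStep] at hk
    obtain ⟨p, hp, hp'⟩ := Finset.exists_ne_zero_of_sum_ne_zero (right_ne_zero_of_mul hk)
    simp only [Finset.mem_product, Finset.mem_range] at hp
    have h1 := H.abs_mul_powDiff_le N hp.1 hp.2
    have h2 := abs_add_le (k - h N * powDiff p) (h N * powDiff p)
    rw [sub_add_cancel] at h2
    have h3 := ih hp'
    have h4 := H.height_pos N
    have h5 := abs_nonneg ((h N : ℤ) * powDiff p)
    linarith

lemma corr_succ (N : ℕ) (k : ℤ) : corr h r (N + 1) k =
    corr h r N k + (r N : ℝ)⁻¹ * ∑ p ∈ (Finset.range (r N)).offDiag,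
      corr h r N (k - h N * powDiff p) := by
  have hr : (r N : ℝ) ≠ 0 := by have := H.two_le N; positivity
  rw [corr, corrStep, ← Finset.diag_union_offDiag,
    Finset.sum_union (Finset.disjoint_diag_offDiag _), Finset.sum_diag, mul_add]
  simp [powDiff_self, hr]

/-- The new copies have radius `h N` and sit at nonzero even multiples of `h N`, so they miss the
central window: coefficients, once computed, never change. -/
lemma corr_succ_of_lt (N : ℕ) {k : ℤ} (hk : |k| < h N) : corr h r (N + 1) k = corr h r N k := by
  rw [H.corr_succ, Finset.sum_eq_zero, mul_zero, add_zero]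
  intro p hp
  by_contra hne
  rw [Finset.mem_offDiag] at hp
  exact powDiff_ne_zero hp.2.2 (eq_of_abs_sub_mul_lt (even_powDiff p) Even.zero
    (H.corr_support N hne) (by simpa using hk))

lemma corr_eq_of_le {N M : ℕ} (hNM : N ≤ M) {k : ℤ} (hk : |k| < h N) :
    corr h r M k = corr h r N k := by
  induction M, hNM using Nat.le_induction with
  | base => rfl
  | succ M hM ih =>
    rw [H.corr_succ_of_lt M (hk.trans_le (by exact_mod_cast H.monotone hM)), ih]

lemma corr_zero (N : ℕ) : corr h r N 0 = 1 := by
  rw [H.corr_eq_of_le (Nat.zero_le N) (by simpa using H.pos)]; simp [corr]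

/-- The correlation at an even nonzero multiple of `h N` plus a small remainder. -/
lemma corr_succ_of_ne (N : ℕ) {D e : ℤ} (hD : Even D) (hD0 : D ≠ 0) (he : |e| < h N) :
    corr h r (N + 1) (h N * D + e) = (r N : ℝ)⁻¹ *
      if D ∈ (Finset.range (r N)).offDiag.image powDiff then corr h r N e else 0 := by
  have hzero : corr h r N (h N * D + e) = 0 := by
    by_contra hne
    exact hD0 (eq_of_abs_sub_mul_lt (h := h N) (k := h N * D + e) hD Even.zero (by simpa using he)
      (by simpa using H.corr_support N hne))
  have huniq : ∀ p, corr h r N (h N * D + e - h N * powDiff p) ≠ 0 → D = powDiff p := fun p hp =>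
    eq_of_abs_sub_mul_lt hD (even_powDiff p) (by simpa using he) (H.corr_support N hp)
  rw [H.corr_succ, hzero, zero_add]
  congr 1
  split_ifs with hmem
  · obtain ⟨p, hp, rfl⟩ := Finset.mem_image.1 hmem
    rw [Finset.sum_eq_single p]
    · congr 1; ring
    · intro q hq hqp
      by_contra hne
      exact hqp (powDiff_injective (Finset.mem_offDiag.1 hp).2.2 (huniq q hne)).symm
    · exact fun hp' => absurd hp hp'
  · refine Finset.sum_eq_zero fun p hp => ?_
    by_contra hne
    exact hmem (Finset.mem_image.2 ⟨p, hp, (huniq p hne).symm⟩)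

lemma corr_succ_powDiff (N : ℕ) {p : ℕ × ℕ} (hp : p ∈ (Finset.range (r N)).offDiag) {e : ℤ}
    (he : |e| < h N) :
    corr h r (N + 1) (h N * powDiff p + e) = (r N : ℝ)⁻¹ * corr h r N e := by
  rw [H.corr_succ_of_ne N (even_powDiff p) (powDiff_ne_zero (Finset.mem_offDiag.1 hp).2.2) he,
    if_pos (Finset.mem_image_of_mem _ hp)]

lemma corr_succ_le (N : ℕ) {D : ℤ} (hD : Even D) (hD0 : D ≠ 0) :
    corr h r (N + 1) (h N * D) ≤ (r N : ℝ)⁻¹ := by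
  have := H.corr_succ_of_ne N hD hD0 (e := 0) (by simpa using H.height_pos N)
  rw [add_zero] at this
  rw [this, H.corr_zero]
  have h0 : (0 : ℝ) ≤ (r N : ℝ)⁻¹ := by positivity
  split_ifs <;> simp

/-- At most one of the copies, the central one included, is nonzero at `k`, so taking a power
commutes with the sum. -/
lemma corr_pow_succ (N : ℕ) (k : ℤ) {q : ℕ} (hq : q ≠ 0) : corr h r (N + 1) k ^ q =
    corr h r N k ^ q + (r N : ℝ)⁻¹ ^ q * ∑ p ∈ (Finset.range (r N)).offDiag,
      corr h r N (k - h N * powDiff p) ^ q := by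
  rw [H.corr_succ]
  by_cases hex : ∃ p ∈ (Finset.range (r N)).offDiag, corr h r N (k - h N * powDiff p) ≠ 0
  · obtain ⟨p, hp, hp0⟩ := hex
    have hpne := (Finset.mem_offDiag.1 hp).2.2
    have hk : corr h r N k = 0 := by
      by_contra hne
      exact powDiff_ne_zero hpne (eq_of_abs_sub_mul_lt (even_powDiff p) Even.zero
        (H.corr_support N hp0) (by simpa using H.corr_support N hne))
    have hz : ∀ q' ∈ (Finset.range (r N)).offDiag, q' ≠ p →
        corr h r N (k - h N * powDiff q') = 0 := by
      intro q' hq' hne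
      by_contra h0
      exact hne (powDiff_injective (Finset.mem_offDiag.1 hq').2.2
        (eq_of_abs_sub_mul_lt (even_powDiff q') (even_powDiff p) (H.corr_support N h0)
          (H.corr_support N hp0)))
    rw [hk, Finset.sum_eq_single_of_mem p hp hz, Finset.sum_eq_single_of_mem p hp, zero_pow hq,
      zero_add, zero_add, mul_pow]
    intro q' hq' hne
    rw [hz q' hq' hne, zero_pow hq]
  · push Not at hex
    rw [Finset.sum_eq_zero hex, Finset.sum_eq_zero, mul_zero, mul_zero, add_zero, add_zero]
    intro p hp
    rw [hex p hp, zero_pow hq]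

/-- Fewer than `r ^ 2` new copies appear, each weighted by `r ^ (-(2n + 2))`, so a stage multiplies
the sum by at most `1 + r ^ (-2n)`. The exponent `2n + 2` is that of the squared coefficients of the
power `n + 1`. -/
lemma sum_corr_pow_le (N : ℕ) (F : Finset ℤ) (n : ℕ) :
    ∑ k ∈ F, corr h r N k ^ (2 * n + 2) ≤ ∏ j ∈ Finset.range N, (1 + (r j : ℝ)⁻¹ ^ (2 * n)) := by
  induction N generalizing F with
  | zero =>
    simp only [corr, Finset.range_zero, Finset.prod_empty]
    have : ∀ k : ℤ, (if k = 0 then (1 : ℝ) else 0) ^ (2 * n + 2) = if k = 0 then 1 else 0 := by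
      intro k; split_ifs <;> simp
    simp_rw [this]
    rw [Finset.sum_ite_eq']
    split_ifs <;> norm_num
  | succ N ih =>
    have hr : (r N : ℝ) ≠ 0 := by have := H.two_le N; positivity
    simp_rw [H.corr_pow_succ N _ (Nat.succ_ne_zero _)]
    rw [Finset.sum_add_distrib, ← Finset.mul_sum, Finset.sum_comm, Finset.prod_range_succ]
    set B := ∏ j ∈ Finset.range N, (1 + (r j : ℝ)⁻¹ ^ (2 * n)) with hB
    have hB0 : 0 ≤ B := by rw [hB]; positivity
    have h1 : ∑ p ∈ (Finset.range (r N)).offDiag, ∑ k ∈ F,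
        corr h r N (k - h N * powDiff p) ^ (2 * n + 2) ≤ (r N : ℝ) ^ 2 * B := by
      calc _ ≤ ∑ p ∈ (Finset.range (r N)).offDiag, B := by
            refine Finset.sum_le_sum fun p _ => ?_
            rw [← Finset.sum_image (f := fun m => corr h r N m ^ (2 * n + 2))
              (g := fun k => k - h N * powDiff p) (fun a _ b _ hab => sub_left_injective hab)]
            exact ih _
        _ = ((r N) * (r N) - (r N) : ℕ) * B := by
            rw [Finset.sum_const, nsmul_eq_mul, Finset.offDiag_card, Finset.card_range]
        _ ≤ (r N : ℝ) ^ 2 * B := by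
            refine mul_le_mul_of_nonneg_right ?_ hB0
            rw [sq]
            exact_mod_cast Nat.sub_le _ _
    have h2 : (r N : ℝ)⁻¹ ^ (2 * n + 2) * ((r N : ℝ) ^ 2 * B) = B * (r N : ℝ)⁻¹ ^ (2 * n) := by
      rw [pow_add]; field_simp
    have h3 : (0 : ℝ) ≤ (r N : ℝ)⁻¹ ^ (2 * n + 2) := by positivity
    calc _ ≤ B + (r N : ℝ)⁻¹ ^ (2 * n + 2) * ((r N : ℝ) ^ 2 * B) :=
          add_le_add (ih F) (mul_le_mul_of_nonneg_left h1 h3)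
      _ = B * (1 + (r N : ℝ)⁻¹ ^ (2 * n)) := by rw [h2]; ring

end IsTernaryGrowth

/-! ### Singularity and absolute continuity of generalized Riesz products -/

/-- The real trigonometric polynomial with the frequencies `h * (3 ^ i - 3 ^ i')`,
`i ≠ i'`, `i, i' < r`. -/
noncomputable def diffPoly (h r : ℕ) (z : Circle) : ℝ :=
  ∑ p ∈ (Finset.range r).offDiag, (circlePow (h * powDiff p) z).re

lemma continuous_diffPoly (h r : ℕ) : Continuous (diffPoly h r) := by
  unfold diffPoly
  exact continuous_finsetSum _ fun p _ => Complex.continuous_re.comp (circlePow _).continuous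

lemma memLp_of_continuous_circle {f : Circle → ℝ} (hf : Continuous f) (μ : Measure Circle)
    [IsFiniteMeasure μ] : MemLp f 2 μ := by
  obtain ⟨C, hC⟩ := isCompact_univ.exists_bound_of_continuousOn hf.continuousOn
  exact MemLp.of_bound hf.aestronglyMeasurable C (Filter.Eventually.of_forall fun x => hC x trivial)

lemma re_circlePow_mul (k l : ℤ) (z : Circle) : (circlePow k z).re * (circlePow l z).re =
    ((circlePow (k + l) z).re + (circlePow (k + -l) z).re) / 2 := by
  rw [circlePow_add, circlePow_add, ContinuousMap.mul_apply, ContinuousMap.mul_apply,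
    ← star_circlePow_apply]
  simp

lemma integrable_re_circlePow (μ : Measure Circle) [IsFiniteMeasure μ] (k : ℤ) :
    Integrable (fun z => (circlePow k z).re) μ :=
  (integrable_continuousMap μ (circlePow k)).re

lemma swap_mem_offDiag {r : ℕ} {p : ℕ × ℕ} (hp : p ∈ (Finset.range r).offDiag) :
    p.swap ∈ (Finset.range r).offDiag := by
  simp only [Finset.mem_offDiag, Prod.fst_swap, Prod.snd_swap] at hp ⊢
  exact ⟨hp.2.1, hp.1, hp.2.2.symm⟩

/-- The Fourier coefficients `φ` of a measure are multiplicative over the stages of the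
construction, take the value `ε j` on the differences of stage `j`, and are small on sums of two
differences of one stage. -/
structure IsRieszCoeff (h r : ℕ → ℕ) (μ : Measure Circle) (φ : ℤ → ℝ) (ε : ℕ → ℝ) : Prop where
  integral_re : ∀ k, ∫ z, (circlePow k z).re ∂μ = φ k
  apply_powDiff : ∀ j, ∀ p ∈ (Finset.range (r j)).offDiag, φ (h j * powDiff p) = ε j
  apply_add : ∀ l j, l < j → ∀ p ∈ (Finset.range (r j)).offDiag,
    ∀ q ∈ (Finset.range (r l)).offDiag, φ (h j * powDiff p + h l * powDiff q) = ε j * ε l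
  le_one : ∀ k, φ k ≤ 1
  apply_le : ∀ j, ∀ p ∈ (Finset.range (r j)).offDiag, ∀ q ∈ (Finset.range (r j)).offDiag,
    powDiff p + powDiff q ≠ 0 →
    φ (h j * (powDiff p + powDiff q)) ≤ (r j : ℝ)⁻¹ ^ 2

namespace IsRieszCoeff

variable {h r : ℕ → ℕ} {μ : Measure Circle} {φ : ℤ → ℝ} {ε : ℕ → ℝ}
  (H : IsRieszCoeff h r μ φ ε)
include H

lemma integral_diffPoly [IsFiniteMeasure μ] (j : ℕ) :
    ∫ z, diffPoly (h j) (r j) z ∂μ = (Finset.range (r j)).offDiag.card * ε j := by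
  unfold diffPoly
  rw [integral_finsetSum _ fun p _ => integrable_re_circlePow μ _]
  simp_rw [H.integral_re]
  rw [Finset.sum_congr rfl (H.apply_powDiff j), Finset.sum_const, nsmul_eq_mul]

lemma integral_diffPoly_mul [IsFiniteMeasure μ] (j l : ℕ) :
    ∫ z, diffPoly (h j) (r j) z * diffPoly (h l) (r l) z ∂μ =
      ∑ p ∈ (Finset.range (r j)).offDiag, ∑ q ∈ (Finset.range (r l)).offDiag,
        (φ (h j * powDiff p + h l * powDiff q) + φ (h j * powDiff p + h l * powDiff q.swap)) / 2 := by
  unfold diffPoly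
  simp_rw [Finset.sum_mul_sum, re_circlePow_mul]
  have hint : ∀ k l : ℤ, Integrable
      (fun z => ((circlePow k z).re + (circlePow l z).re) / 2) μ := fun k l =>
    ((integrable_re_circlePow μ k).add (integrable_re_circlePow μ l)).div_const 2
  rw [integral_finsetSum _ fun p _ => integrable_finsetSum _ fun q _ => hint _ _]
  refine Finset.sum_congr rfl fun p _ => ?_
  rw [integral_finsetSum _ fun q _ => hint _ _]
  refine Finset.sum_congr rfl fun q _ => ?_
  rw [integral_div, integral_add (integrable_re_circlePow μ _) (integrable_re_circlePow μ _),
    H.integral_re, H.integral_re, powDiff_swap, mul_neg]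

/-- By multiplicativity every mixed moment of two stages is the product `ε j * ε l` of the means. -/
lemma covariance_eq_zero_of_lt [IsProbabilityMeasure μ] {l j : ℕ} (hlj : l < j) :
    ProbabilityTheory.covariance (diffPoly (h j) (r j)) (diffPoly (h l) (r l)) μ = 0 := by
  rw [ProbabilityTheory.covariance_eq_sub (memLp_of_continuous_circle (continuous_diffPoly _ _) μ)
    (memLp_of_continuous_circle (continuous_diffPoly _ _) μ)]
  simp only [Pi.mul_apply]
  rw [H.integral_diffPoly_mul, H.integral_diffPoly, H.integral_diffPoly]
  have : ∀ p ∈ (Finset.range (r j)).offDiag, ∀ q ∈ (Finset.range (r l)).offDiag,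
      (φ (h j * powDiff p + h l * powDiff q) + φ (h j * powDiff p + h l * powDiff q.swap)) / 2 =
        ε j * ε l := by
    intro p hp q hq
    rw [H.apply_add l j hlj p hp q hq, H.apply_add l j hlj p hp _ (swap_mem_offDiag hq)]
    ring
  rw [Finset.sum_congr rfl fun p hp => Finset.sum_congr rfl (this p hp)]
  simp only [Finset.sum_const, nsmul_eq_mul]
  ring

lemma covariance_eq_zero [IsProbabilityMeasure μ] {l j : ℕ} (hlj : l ≠ j) :
    ProbabilityTheory.covariance (diffPoly (h j) (r j)) (diffPoly (h l) (r l)) μ = 0 := by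
  rcases lt_or_gt_of_ne hlj with h1 | h1
  · exact H.covariance_eq_zero_of_lt h1
  · rw [ProbabilityTheory.covariance_comm]; exact H.covariance_eq_zero_of_lt h1

/-- Only `q = p.swap` gives frequency zero and contributes up to `1`; each of the fewer than `r ^ 2`
others contributes at most `r ^ (-2)`. -/
lemma sum_apply_add_le (j : ℕ) (hr : r j ≠ 0) {p : ℕ × ℕ}
    (hp : p ∈ (Finset.range (r j)).offDiag) :
    ∑ q ∈ (Finset.range (r j)).offDiag, φ (h j * powDiff p + h j * powDiff q) ≤ 2 := by
  have hr' : (r j : ℝ) ≠ 0 := by exact_mod_cast hr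
  rw [← Finset.add_sum_erase _ _ (swap_mem_offDiag hp)]
  have h1 : ∑ q ∈ (Finset.range (r j)).offDiag.erase p.swap,
      φ (h j * powDiff p + h j * powDiff q) ≤ 1 := by
    calc _ ≤ ∑ q ∈ (Finset.range (r j)).offDiag.erase p.swap, (r j : ℝ)⁻¹ ^ 2 := by
          refine Finset.sum_le_sum fun q hq => ?_
          rw [← mul_add]
          have hq' := Finset.mem_erase.1 hq
          refine H.apply_le j p hp q hq'.2 fun h0 => ?_
          refine hq'.1 (powDiff_injective (Finset.mem_offDiag.1 hq'.2).2.2 ?_)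
          rw [powDiff_swap]; linarith
      _ ≤ ∑ q ∈ (Finset.range (r j) ×ˢ Finset.range (r j)), (r j : ℝ)⁻¹ ^ 2 := by
          refine Finset.sum_le_sum_of_subset_of_nonneg (fun q hq => ?_) fun _ _ _ => by positivity
          have := Finset.mem_offDiag.1 (Finset.mem_erase.1 hq).2
          exact Finset.mem_product.2 ⟨this.1, this.2.1⟩
      _ = 1 := by
          rw [Finset.sum_const, Finset.card_product, Finset.card_range, nsmul_eq_mul]
          push_cast
          field_simp
  linarith [H.le_one (h j * powDiff p + h j * powDiff p.swap)]

lemma variance_diffPoly_le [IsProbabilityMeasure μ] (j : ℕ) (hr : r j ≠ 0) :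
    ProbabilityTheory.variance (diffPoly (h j) (r j)) μ ≤
      2 * (Finset.range (r j)).offDiag.card := by
  have hm := memLp_of_continuous_circle (continuous_diffPoly (h j) (r j)) μ
  refine (ProbabilityTheory.variance_le_expectation_sq hm.1).trans ?_
  simp only [Pi.pow_apply, sq]
  rw [H.integral_diffPoly_mul, mul_comm (2 : ℝ), ← nsmul_eq_mul, ← Finset.sum_const]
  refine Finset.sum_le_sum fun p hp => ?_
  rw [← Finset.sum_div, Finset.sum_add_distrib]
  have h1 := H.sum_apply_add_le j hr hp
  have h2 : ∑ q ∈ (Finset.range (r j)).offDiag, φ (h j * powDiff p + h j * powDiff q.swap) =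
      ∑ q ∈ (Finset.range (r j)).offDiag, φ (h j * powDiff p + h j * powDiff q) :=
    Finset.sum_bij' (fun q _ => q.swap) (fun q _ => q.swap) (fun q hq => swap_mem_offDiag hq)
      (fun q hq => swap_mem_offDiag hq) (by simp) (by simp) (by simp)
  rw [h2]
  linarith

lemma variance_sum_le [IsProbabilityMeasure μ] (hr : ∀ j, r j ≠ 0) (w : ℕ → ℝ) (N : ℕ) :
    ProbabilityTheory.variance
      (fun z => ∑ j ∈ Finset.range N, w j * diffPoly (h j) (r j) z) μ ≤
      ∑ j ∈ Finset.range N, w j ^ 2 * (2 * (Finset.range (r j)).offDiag.card) := by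
  have hm : ∀ j, MemLp (fun z => w j * diffPoly (h j) (r j) z) 2 μ := fun j =>
    memLp_of_continuous_circle (continuous_const.mul (continuous_diffPoly _ _)) μ
  rw [ProbabilityTheory.variance_fun_sum' fun j _ => hm j]
  refine Finset.sum_le_sum fun j hj => ?_
  rw [Finset.sum_eq_single_of_mem j hj]
  · rw [ProbabilityTheory.covariance_self (hm j).1.aemeasurable,
      ProbabilityTheory.variance_const_mul]
    exact mul_le_mul_of_nonneg_left (H.variance_diffPoly_le j (hr j)) (sq_nonneg _)
  · intro l _ hlj
    rw [ProbabilityTheory.covariance_const_mul_left, ProbabilityTheory.covariance_const_mul_right,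
      H.covariance_eq_zero hlj]
    simp

lemma integral_sum [IsFiniteMeasure μ] (w : ℕ → ℝ) (N : ℕ) :
    ∫ z, ∑ j ∈ Finset.range N, w j * diffPoly (h j) (r j) z ∂μ =
      ∑ j ∈ Finset.range N, w j * ((Finset.range (r j)).offDiag.card * ε j) := by
  rw [integral_finsetSum]
  · simp_rw [integral_const_mul, H.integral_diffPoly]
  · intro j _
    exact ((memLp_of_continuous_circle (continuous_diffPoly _ _) μ).integrable
      (by norm_num)).const_mul _

end IsRieszCoeff

/-- Measures with multiplicative Fourier coefficients are singular if the values at the differences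
are not square summable. -/
theorem IsRieszCoeff.mutuallySingular {h r : ℕ → ℕ} (hr : ∀ j, 2 ≤ r j)
    {μ ν : Measure Circle} [IsProbabilityMeasure μ] [IsProbabilityMeasure ν] {φ ψ : ℤ → ℝ}
    {ε : ℕ → ℝ} (H : IsRieszCoeff h r μ φ ε) (H' : IsRieszCoeff h r ν ψ 0)
    (hε : ¬ Summable fun j => (r j : ℝ) ^ 2 * ε j ^ 2) : μ.MutuallySingular ν := by
  have hr0 : ∀ j, r j ≠ 0 := fun j => by have := hr j; omega
  have hcard : ∀ j, (r j : ℝ) ^ 2 ≤ 2 * (Finset.range (r j)).offDiag.card := by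
    intro j
    rw [Finset.offDiag_card, Finset.card_range, Nat.cast_sub (Nat.le_mul_self _)]
    have : (2 : ℝ) ≤ r j := by exact_mod_cast hr j
    push_cast
    nlinarith
  -- Weighting stage `j` by `ε j` makes the mean equal to `M N` and the variance at most `2 * M N`,
  -- under both measures.
  let M : ℕ → ℝ := fun N =>
    ∑ j ∈ Finset.range N, ((Finset.range (r j)).offDiag.card : ℝ) * ε j ^ 2
  have hM : Filter.Tendsto M Filter.atTop Filter.atTop := by
    refine (not_summable_iff_tendsto_nat_atTop_of_nonneg fun j => by positivity).1 fun hs => hε ?_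
    refine Summable.of_nonneg_of_le (fun j => by positivity) (fun j => ?_) (hs.mul_left 2)
    nlinarith [mul_le_mul_of_nonneg_right (hcard j) (sq_nonneg (ε j))]
  have hcont : ∀ N, Continuous fun z => ∑ j ∈ Finset.range N, ε j * diffPoly (h j) (r j) z :=
    fun N => continuous_finsetSum _ fun j _ => continuous_const.mul (continuous_diffPoly _ _)
  have hV : ∀ N, ∑ j ∈ Finset.range N, ε j ^ 2 * (2 * ((Finset.range (r j)).offDiag.card : ℝ)) =
      2 * M N := by
    intro N
    rw [Finset.mul_sum]
    exact Finset.sum_congr rfl fun j _ => by ring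
  refine mutuallySingular_of_variance
    (fun N z => ∑ j ∈ Finset.range N, ε j * diffPoly (h j) (r j) z) M 2 hM
    (fun N => memLp_of_continuous_circle (hcont N) μ)
    (fun N => memLp_of_continuous_circle (hcont N) ν) (fun N => ?_) (fun N => ?_)
    (fun N => (H.variance_sum_le hr0 ε N).trans (hV N).le)
    (fun N => (H'.variance_sum_le hr0 ε N).trans (hV N).le)
  · rw [H.integral_sum]
    exact Finset.sum_congr rfl fun j _ => by ring
  · rw [H'.integral_sum]
    simp

namespace IsTernaryGrowth

variable {h r : ℕ → ℕ} (H : IsTernaryGrowth h r)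
include H

lemma abs_mul_powDiff_lt {l j : ℕ} (hlj : l < j) {q : ℕ × ℕ}
    (hq : q ∈ (Finset.range (r l)).offDiag) : |(h l : ℤ) * powDiff q| < h j := by
  simp only [Finset.mem_offDiag, Finset.mem_range] at hq
  have h1 := H.abs_mul_powDiff_le l hq.1 hq.2.1
  have h2 : (h (l + 1) : ℤ) ≤ h j := by exact_mod_cast H.monotone hlj
  have h3 := H.height_pos l
  have h4 := abs_nonneg ((h l : ℤ) * powDiff q)
  linarith

lemma isRieszCoeff_circleLebesgue :
    IsRieszCoeff h r circleLebesgue (fun k => if k = 0 then 1 else 0) 0 where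
  integral_re k := by
    have h1 := circleCoeff_circleLebesgue k
    have h2 := integral_re (integrable_continuousMap circleLebesgue (circlePow k))
    simp only [RCLike.re_eq_complex_re] at h2
    rw [h2]
    unfold circleCoeff at h1
    rw [h1]
    split_ifs <;> simp
  apply_powDiff j p hp := by
    have := (H.height_pos j).ne'
    have := powDiff_ne_zero (Finset.mem_offDiag.1 hp).2.2
    simp_all
  apply_add l j hlj p hp q hq := by
    have h1 := H.abs_mul_powDiff_lt hlj hq
    have h2 := powDiff_ne_zero (Finset.mem_offDiag.1 hp).2.2
    rw [if_neg]
    · simp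
    · intro h0
      have h3 : |(h l : ℤ) * powDiff q| = |(h j : ℤ) * powDiff p| := by
        rw [← abs_neg]; congr 1; linarith
      rw [h3, abs_mul, Nat.abs_cast] at h1
      have := Int.one_le_abs h2
      nlinarith [H.height_pos j]
  le_one k := by split_ifs <;> norm_num
  apply_le j p hp q hq hpq := by
    rw [if_neg]
    · positivity
    · exact mul_ne_zero (H.height_pos j).ne' hpq

variable {ν : Measure Circle}
  (hν : ∀ N (k : ℤ), |k| < h N → circleCoeff ν k = corr h r N k)
include hν

lemma exists_circleCoeff_eq_corr (F : Finset ℤ) :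
    ∃ N, ∀ k ∈ F, circleCoeff ν k = corr h r N k := by
  choose f hf using H.tendsto_exists
  refine ⟨F.sup f, fun k hk => hν _ k ((hf k).trans_le ?_)⟩
  exact_mod_cast H.monotone (Finset.le_sup hk)

lemma convPower_absolutelyContinuous [IsProbabilityMeasure ν] (n : ℕ) (hs : Summable fun j => (r j : ℝ)⁻¹ ^ (2 * n)) :
    (convPower ν (n + 1)).AbsolutelyContinuous circleLebesgue := by
  refine absolutelyContinuous_of_coeff (C := Real.exp (∑' j, (r j : ℝ)⁻¹ ^ (2 * n))) fun F => ?_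
  obtain ⟨N, hN⟩ := H.exists_circleCoeff_eq_corr hν F
  calc ∑ k ∈ F, ‖circleCoeff (convPower ν (n + 1)) k‖ ^ 2
      = ∑ k ∈ F, corr h r N k ^ (2 * n + 2) := by
        refine Finset.sum_congr rfl fun k hk => ?_
        rw [circleCoeff_convPower, hN k hk, norm_pow, Complex.norm_real,
          Real.norm_of_nonneg (corr_nonneg h r N k)]
        ring
    _ ≤ ∏ j ∈ Finset.range N, (1 + (r j : ℝ)⁻¹ ^ (2 * n)) := H.sum_corr_pow_le N F n
    _ ≤ ∏ j ∈ Finset.range N, Real.exp ((r j : ℝ)⁻¹ ^ (2 * n)) := by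
        refine Finset.prod_le_prod (fun j _ => by positivity) fun j _ => ?_
        rw [add_comm]; exact Real.add_one_le_exp _
    _ = Real.exp (∑ j ∈ Finset.range N, (r j : ℝ)⁻¹ ^ (2 * n)) := (Real.exp_sum _ _).symm
    _ ≤ _ := Real.exp_le_exp.2 (hs.sum_le_tsum _ fun j _ => by positivity)

/-- A difference of a lower stage is a remainder smaller than `h j`, so `corr_succ_powDiff`
factorizes the coefficient of the sum. The hypothesis `2 ≤ n` serves `apply_le`: a coefficient at
most `1 / r` has `n`-th power at most `(1 / r) ^ 2`. -/
lemma isRieszCoeff_convPower [IsProbabilityMeasure ν] {n : ℕ} (hn : 2 ≤ n) :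
    IsRieszCoeff h r (convPower ν n) (fun k => (circleCoeff (convPower ν n) k).re)
      (fun j => (r j : ℝ)⁻¹ ^ n) where
  integral_re k := integral_re (integrable_continuousMap (convPower ν n) (circlePow k))
  apply_powDiff j p hp := by
    have h1 := H.abs_mul_powDiff_lt (Nat.lt_succ_self j) hp
    have h2 := H.corr_succ_powDiff j hp (e := 0) (by simpa using H.height_pos j)
    rw [circleCoeff_convPower, hν _ _ h1]
    rw [add_zero, H.corr_zero, mul_one] at h2
    rw [h2]
    norm_cast
  apply_add l j hlj p hp q hq := by
    have h1 := H.abs_mul_powDiff_lt hlj hq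
    have h2 := H.corr_succ_powDiff j hp h1
    have h3 := H.corr_succ_powDiff l hq (e := 0) (by simpa using H.height_pos l)
    have h4 : corr h r j (h l * powDiff q) = (r l : ℝ)⁻¹ := by
      rw [H.corr_eq_of_le hlj (H.abs_mul_powDiff_lt (Nat.lt_succ_self l) hq)]
      simpa [H.corr_zero] using h3
    have h5 : |(h j : ℤ) * powDiff p + h l * powDiff q| < h (j + 1) := by
      simp only [Finset.mem_offDiag, Finset.mem_range] at hp
      have h6 := H.abs_mul_powDiff_le j hp.1 hp.2.1
      have h7 := abs_add_le ((h j : ℤ) * powDiff p) (h l * powDiff q)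
      have h8 := abs_nonneg ((h j : ℤ) * powDiff p)
      have := H.height_pos j
      linarith
    rw [circleCoeff_convPower, hν _ _ h5, h2, h4, ← mul_pow]
    norm_cast
  le_one k := by
    refine (Complex.re_le_norm _).trans ?_
    unfold circleCoeff
    have h1 := norm_integral_le_of_norm_le_const (μ := convPower ν n) (C := 1)
      (Filter.Eventually.of_forall fun z => (norm_circlePow_apply k z).le)
    simpa using h1
  apply_le j p hp q hq hpq := by
    have h1 : |(h j : ℤ) * (powDiff p + powDiff q)| < h (j + 1) := by
      simp only [Finset.mem_offDiag, Finset.mem_range] at hp hq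
      have h2 := H.abs_mul_powDiff_le j hp.1 hp.2.1
      have h3 := H.abs_mul_powDiff_le j hq.1 hq.2.1
      have h4 := abs_add_le ((h j : ℤ) * powDiff p) (h j * powDiff q)
      have := H.height_pos j
      rw [mul_add]
      linarith
    have h2 := H.corr_succ_le j ((even_powDiff p).add (even_powDiff q)) hpq
    have h3 := corr_nonneg h r (j + 1) (h j * (powDiff p + powDiff q))
    have h4 : (r j : ℝ)⁻¹ ≤ 1 := inv_le_one_of_one_le₀ (by
      have := H.two_le j
      exact_mod_cast (by omega : 1 ≤ r j))
    rw [circleCoeff_convPower, hν _ _ h1, ← Complex.ofReal_pow, Complex.ofReal_re]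
    exact (pow_le_pow_left₀ h3 h2 n).trans (pow_le_pow_of_le_one (by positivity) h4 hn)

theorem convPower_mutuallySingular [IsProbabilityMeasure ν] {n : ℕ} (hn : 2 ≤ n)
    (hs : ¬ Summable fun j => (r j : ℝ) ^ 2 * (r j : ℝ)⁻¹ ^ (2 * n)) :
    (convPower ν n).MutuallySingular circleLebesgue := by
  refine (H.isRieszCoeff_convPower hν hn).mutuallySingular H.two_le
    H.isRieszCoeff_circleLebesgue ?_
  simpa only [← pow_mul, mul_comm n 2] using hs

end IsTernaryGrowth

/-! ### Spectral measures of vectors -/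

section VectorMeasure

open scoped CompactlySupported

variable {H : Type*} [NormedAddCommGroup H] [InnerProductSpace ℂ H]

lemma zpow_apply_zpow_apply (U : H ≃ₗᵢ[ℂ] H) (k l : ℤ) (x : H) :
    (U ^ k) ((U ^ l) x) = (U ^ (k + l)) x := by
  rw [zpow_add]; rfl

lemma inner_zpow_neg (U : H ≃ₗᵢ[ℂ] H) (k : ℤ) (x y : H) :
    inner ℂ x ((U ^ (-k)) y) = inner ℂ ((U ^ k) x) y := by
  rw [← (U ^ k).inner_map_map x, zpow_apply_zpow_apply]
  simp

lemma inner_zpow_zpow (U : H ≃ₗᵢ[ℂ] H) (k l : ℤ) (x y : H) :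
    inner ℂ ((U ^ k) x) ((U ^ l) y) = inner ℂ x ((U ^ (l - k)) y) := by
  rw [← inner_zpow_neg, zpow_apply_zpow_apply, neg_add_eq_sub]

/-- `μ` is the spectral measure of the vector `x`: its Fourier coefficients are the correlations
of `x`. -/
structure IsVectorMeasure (U : H ≃ₗᵢ[ℂ] H) (x : H) (μ : Measure Circle) : Prop where
  isFiniteMeasure : IsFiniteMeasure μ
  coeff : ∀ k : ℤ, circleCoeff μ k = inner ℂ x ((U ^ k) x)

lemma circleCoeff_neg (μ : Measure Circle) (k : ℤ) :
    circleCoeff μ (-k) = (starRingEnd ℂ) (circleCoeff μ k) := by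
  unfold circleCoeff
  rw [← integral_conj]
  simp_rw [star_circlePow_apply]

lemma IsVectorMeasure.of_nat {U : H ≃ₗᵢ[ℂ] H} {x : H} {μ : Measure Circle} [IsFiniteMeasure μ]
    (h : ∀ k : ℕ, circleCoeff μ k = inner ℂ x ((U ^ k) x)) : IsVectorMeasure U x μ where
  isFiniteMeasure := inferInstance
  coeff k := by
    obtain ⟨m, rfl | rfl⟩ := k.eq_nat_or_neg
    · simpa using h m
    · rw [circleCoeff_neg, h, inner_zpow_neg, inner_conj_symm, zpow_natCast]

lemma IsVectorMeasure.eq {U : H ≃ₗᵢ[ℂ] H} {x : H} {μ ν : Measure Circle}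
    (hμ : IsVectorMeasure U x μ) (hν : IsVectorMeasure U x ν) : μ = ν := by
  have := hμ.isFiniteMeasure
  have := hν.isFiniteMeasure
  exact circleMeasure_ext fun k => (hμ.coeff k).trans (hν.coeff k).symm

lemma IsVectorMeasure.zpow {U : H ≃ₗᵢ[ℂ] H} {x : H} {μ : Measure Circle}
    (hμ : IsVectorMeasure U x μ) (m : ℤ) : IsVectorMeasure U ((U ^ m) x) μ where
  isFiniteMeasure := hμ.isFiniteMeasure
  coeff k := by
    rw [hμ.coeff, zpow_apply_zpow_apply, inner_zpow_zpow, add_sub_cancel_right]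

variable [CompleteSpace H]

/-- The functional calculus of a unitary operator with continuous functions on the circle. -/
lemma exists_circle_functionalCalculus (U : H ≃ₗᵢ[ℂ] H) :
    ∃ Φ : C(Circle, ℂ) →⋆ₐ[ℂ] (H →L[ℂ] H), Φ (circlePow 1) = (U : H →L[ℂ] H) := by
  let u : unitary (H →L[ℂ] H) := Unitary.linearIsometryEquiv.symm U
  have hu : (u : H →L[ℂ] H) = (U : H →L[ℂ] H) := rfl
  have hn : IsStarNormal (u : H →L[ℂ] H) := inferInstance
  have hsp : ∀ x : spectrum ℂ (u : H →L[ℂ] H), (x : ℂ) ∈ Submonoid.unitSphere ℂ := fun x =>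
    Unitary.spectrum_subset_circle u x.2
  -- The spectrum lies on the circle, so functions on the circle are restricted to it before the
  -- continuous functional calculus is applied.
  let ι : C(spectrum ℂ (u : H →L[ℂ] H), Circle) :=
    ⟨fun x => (⟨x, hsp x⟩ : Submonoid.unitSphere ℂ), by
      exact Continuous.subtype_mk continuous_subtype_val hsp⟩
  refine ⟨(cfcHom hn).comp (ContinuousMap.compStarAlgHom' ℂ ℂ ι), ?_⟩
  refine Eq.trans ?_ ((cfcHom_id (R := ℂ) hn).trans hu)
  rw [StarAlgHom.comp_apply]
  congr 1
  ext x
  change circlePow 1 (ι x) = _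
  rw [circlePow_apply, zpow_one]
  rfl

/-- Every vector has a spectral measure. -/
theorem exists_isVectorMeasure (U : H ≃ₗᵢ[ℂ] H) (x : H) : ∃ μ, IsVectorMeasure U x μ := by
  obtain ⟨Φ, hΦ⟩ := exists_circle_functionalCalculus U
  let emb : C_c(Circle, ℝ) → C(Circle, ℂ) := fun f => ⟨fun z => (f z : ℂ), by fun_prop⟩
  have emb_add : ∀ f g, emb (f + g) = emb f + emb g := fun f g => by ext z; simp [emb]
  have emb_smul : ∀ (c : ℝ) f, emb (c • f) = (c : ℂ) • emb f := fun c f => by ext z; simp [emb]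
  have hpos : ∀ f : C_c(Circle, ℝ), 0 ≤ f → 0 ≤ (inner ℂ x (Φ (emb f) x)).re := by
    intro f hf
    -- With `g = √f` the quadratic form of `f` is `‖Φ g x‖ ^ 2`, which gives the positivity required
    -- by Riesz–Markov.
    let g : C(Circle, ℂ) := ⟨fun z => (Real.sqrt (f z) : ℂ), by fun_prop⟩
    have hg : emb f = star g * g := by
      ext z
      have h1 : 0 ≤ f z := hf z
      simp only [emb, g, ContinuousMap.coe_mk, ContinuousMap.mul_apply, ContinuousMap.star_apply]
      rw [RCLike.star_def, Complex.conj_ofReal, ← Complex.ofReal_mul, Real.mul_self_sqrt h1]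
    rw [hg, map_mul, map_star, ContinuousLinearMap.star_eq_adjoint, mul_apply_eq_comp,
      ContinuousLinearMap.adjoint_inner_right]
    exact inner_self_nonneg (𝕜 := ℂ)
  have hreal : ∀ f : C_c(Circle, ℝ), (inner ℂ x (Φ (emb f) x)).im = 0 := by
    intro f
    have hs : star (emb f) = emb f := by
      ext z
      simp only [emb, ContinuousMap.coe_mk, ContinuousMap.star_apply]
      rw [RCLike.star_def, Complex.conj_ofReal]
    rw [← Complex.conj_eq_iff_im, inner_conj_symm]
    conv_rhs => rw [← hs, map_star, ContinuousLinearMap.star_eq_adjoint,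
      ContinuousLinearMap.adjoint_inner_right]
  let Λ : C_c(Circle, ℝ) →ₗ[ℝ] ℝ :=
    { toFun := fun f => (inner ℂ x (Φ (emb f) x)).re
      map_add' := fun f g => by simp [emb_add]
      map_smul' := fun c f => by
        rw [emb_smul, map_smul, smul_apply, inner_smul_right]
        simp }
  let Λ' : C_c(Circle, ℝ) →ₚ[ℝ] ℝ := PositiveLinearMap.mk₀ Λ hpos
  have hint : ∀ f : C_c(Circle, ℝ), ∫ z, f z ∂(RealRMK.rieszMeasure Λ') =
      (inner ℂ x (Φ (emb f) x)).re := fun f => RealRMK.integral_rieszMeasure Λ' f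
  have hfin : IsFiniteMeasure (RealRMK.rieszMeasure Λ') := by
    unfold RealRMK.rieszMeasure
    infer_instance
  refine ⟨RealRMK.rieszMeasure Λ', IsVectorMeasure.of_nat fun k => ?_⟩
  let re : C_c(Circle, ℝ) := CompactlySupportedContinuousMap.continuousMapEquiv
    ⟨fun z => (circlePow k z).re, Complex.continuous_re.comp (circlePow k).continuous⟩
  let im : C_c(Circle, ℝ) := CompactlySupportedContinuousMap.continuousMapEquiv
    ⟨fun z => (circlePow k z).im, Complex.continuous_im.comp (circlePow k).continuous⟩
  have hsum : circlePow k = emb re + Complex.I • emb im := by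
    ext z
    have := (Complex.re_add_im (circlePow k z)).symm
    rw [mul_comm] at this
    exact this
  have hval : inner ℂ x (Φ (circlePow k) x) = circleCoeff (RealRMK.rieszMeasure Λ') k := by
    rw [hsum, map_add, map_smul, add_apply, smul_apply,
      inner_add_right, inner_smul_right]
    unfold circleCoeff
    have hi := integrable_continuousMap (RealRMK.rieszMeasure Λ') (circlePow k)
    rw [← integral_re_add_im hi]
    have h1 := hint re
    have h2 := hint im
    rw [← Complex.re_add_im (inner ℂ x (Φ (emb re) x)), hreal re,
      ← Complex.re_add_im (inner ℂ x (Φ (emb im) x)), hreal im, ← h1, ← h2]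
    simp only [Complex.ofReal_zero, zero_mul, add_zero]
    rw [mul_comm]
    rfl
  have hpow : circlePow k = circlePow 1 ^ k := by ext z; simp [circlePow_apply]
  have happly : ∀ y, Φ (circlePow k) y = (U ^ k) y := by
    rw [hpow, map_pow, hΦ]
    clear hval hsum hpow
    induction k with
    | zero => intro y; rfl
    | succ k ih =>
      intro y
      rw [pow_succ, pow_succ, mul_apply_eq_comp, ih]
      rfl
  rw [← hval, happly]

end VectorMeasure

/-! ### Unitary equivalence from Gram matrices. -/

lemma denseRange_linearCombination {ι E : Type*} [NormedAddCommGroup E] [InnerProductSpace ℂ E]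
    {v : ι → E} (hv : (Submodule.span ℂ (range v)).topologicalClosure = ⊤) :
    DenseRange (Finsupp.linearCombination ℂ v) := by
  rw [DenseRange, ← LinearMap.coe_range, Finsupp.range_linearCombination]
  exact (Submodule.dense_iff_topologicalClosure_eq_top).2 hv

/-- Two total families with the same Gram matrix are unitarily equivalent. -/
theorem exists_isometryEquiv_of_gram {ι H K : Type*} [NormedAddCommGroup H]
    [InnerProductSpace ℂ H] [CompleteSpace H] [NormedAddCommGroup K] [InnerProductSpace ℂ K]
    [CompleteSpace K] {x : ι → H} {y : ι → K}
    (hx : (Submodule.span ℂ (range x)).topologicalClosure = ⊤)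
    (hy : (Submodule.span ℂ (range y)).topologicalClosure = ⊤)
    (hxy : ∀ i j, inner ℂ (x i) (x j) = inner ℂ (y i) (y j)) :
    ∃ W : H ≃ₗᵢ[ℂ] K, ∀ i, W (x i) = y i := by
  have hinner : ∀ f g : ι →₀ ℂ,
      inner ℂ (Finsupp.linearCombination ℂ x f) (Finsupp.linearCombination ℂ x g) =
      inner ℂ (Finsupp.linearCombination ℂ y f) (Finsupp.linearCombination ℂ y g) := by
    intro f g
    simp only [Finsupp.linearCombination_apply, Finsupp.sum_inner, Finsupp.inner_sum,
      inner_smul_left, inner_smul_right, hxy]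
  have hnorm : ∀ f : ι →₀ ℂ, ‖Finsupp.linearCombination ℂ y (LinearEquiv.refl ℂ _ f)‖ =
      ‖Finsupp.linearCombination ℂ x f‖ := by
    intro f
    have := hinner f f
    rw [inner_self_eq_norm_sq_to_K, inner_self_eq_norm_sq_to_K] at this
    norm_cast at this
    exact ((sq_eq_sq₀ (norm_nonneg _) (norm_nonneg _)).1 this).symm
  refine ⟨(LinearEquiv.refl ℂ (ι →₀ ℂ)).extendOfIsometry _ _ (denseRange_linearCombination hx)
    (denseRange_linearCombination hy) hnorm, fun i => ?_⟩
  have := LinearEquiv.extendOfIsometry_eq (LinearEquiv.refl ℂ (ι →₀ ℂ)) _ _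
    (denseRange_linearCombination hx) (denseRange_linearCombination hy) hnorm (Finsupp.single i 1)
  simpa using this

/-! ### Multiplication operators -/

section MulLp

variable {α : Type*} [MeasurableSpace α]

lemma memLp_mul_of_norm_le_one (μ : Measure α) {m : α → ℂ} (hm : Measurable m)
    (hm1 : ∀ a, ‖m a‖ ≤ 1) (f : Lp ℂ 2 μ) : MemLp (fun a => m a * f a) 2 μ := by
  refine (Lp.memLp f).mono (hm.aestronglyMeasurable.mul (Lp.aestronglyMeasurable f))
    (Filter.Eventually.of_forall fun a => ?_)
  rw [norm_mul]
  exact mul_le_of_le_one_left (norm_nonneg _) (hm1 a)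

/-- Multiplication by a measurable function bounded by `1`. -/
noncomputable def mulLp (μ : Measure α) {m : α → ℂ} (hm : Measurable m) (hm1 : ∀ a, ‖m a‖ ≤ 1) :
    Lp ℂ 2 μ →L[ℂ] Lp ℂ 2 μ :=
  LinearMap.mkContinuous
    { toFun := fun f => (memLp_mul_of_norm_le_one μ hm hm1 f).toLp _
      map_add' := fun f g => by
        rw [← MemLp.toLp_add]
        refine MemLp.toLp_congr _ _ ?_
        filter_upwards [Lp.coeFn_add f g] with a ha
        rw [ha, Pi.add_apply, Pi.add_apply, mul_add]
      map_smul' := fun c f => by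
        rw [RingHom.id_apply, ← MemLp.toLp_const_smul]
        refine MemLp.toLp_congr _ _ ?_
        filter_upwards [Lp.coeFn_smul c f] with a ha
        simp [ha, mul_left_comm] } 1 fun f => by
      rw [one_mul]
      refine Lp.norm_le_norm_of_ae_le ?_
      filter_upwards [(memLp_mul_of_norm_le_one μ hm hm1 f).coeFn_toLp] with a ha
      change ‖((memLp_mul_of_norm_le_one μ hm hm1 f).toLp _ : α → ℂ) a‖ ≤ _
      rw [ha, norm_mul]
      exact mul_le_of_le_one_left (norm_nonneg _) (hm1 a)

lemma coeFn_mulLp (μ : Measure α) {m : α → ℂ} (hm : Measurable m) (hm1 : ∀ a, ‖m a‖ ≤ 1)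
    (f : Lp ℂ 2 μ) : mulLp μ hm hm1 f =ᵐ[μ] fun a => m a * f a :=
  (memLp_mul_of_norm_le_one μ hm hm1 f).coeFn_toLp

end MulLp

/-! ### The model operator -/

lemma span_toLp_circlePow_closure_eq_top (μ : Measure Circle) [IsFiniteMeasure μ] :
    (Submodule.span ℂ (range fun k => ContinuousMap.toLp (E := ℂ) 2 μ ℂ
      (circlePow k))).topologicalClosure = ⊤ := by
  convert! (ContinuousMap.toLp_denseRange ℂ μ ℂ
    (by norm_num : (2 : ENNReal) ≠ ⊤)).topologicalClosure_map_submodule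
      span_circlePow_closure_eq_top
  rw [Submodule.map_span, range_comp']
  rfl

/-- The measure on `𝕋 × ℕ` whose restriction to `𝕋 × {k}` is `μ k`. -/
noncomputable def stackMeasure (μ : ℕ → Measure Circle) : Measure (Circle × ℕ) :=
  Measure.sum fun k => (μ k).map fun z => (z, k)

lemma stackMeasure_restrict (μ : ℕ → Measure Circle) (k : ℕ) :
    (stackMeasure μ).restrict (Prod.snd ⁻¹' {k}) = (μ k).map fun z => (z, k) := by
  have hk : MeasurableSet (Prod.snd ⁻¹' {k} : Set (Circle × ℕ)) :=
    measurable_snd (measurableSet_singleton k)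
  ext s hs
  rw [Measure.restrict_apply hs, stackMeasure, Measure.sum_apply _ (hs.inter hk),
    tsum_eq_single k]
  · rw [Measure.map_apply (by fun_prop) (hs.inter hk), Measure.map_apply (by fun_prop) hs]
    congr 1
    ext z
    simp
  · intro l hl
    rw [Measure.map_apply (by fun_prop) (hs.inter hk)]
    convert measure_empty (μ := μ l)
    ext z
    simp [hl]

lemma integral_stackMeasure (μ : ℕ → Measure Circle) (k : ℕ) (f : Circle × ℕ → ℂ)
    (hf : AEStronglyMeasurable f (stackMeasure μ)) :
    ∫ p, (Prod.snd ⁻¹' {k}).indicator f p ∂(stackMeasure μ) = ∫ z, f (z, k) ∂(μ k) := by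
  have hk : MeasurableSet (Prod.snd ⁻¹' {k} : Set (Circle × ℕ)) :=
    measurable_snd (measurableSet_singleton k)
  rw [integral_indicator hk, stackMeasure_restrict, integral_map (by fun_prop)]
  rw [← stackMeasure_restrict]
  exact hf.restrict

/-- The function `(z, l) ↦ z ^ m` on `𝕋 × {k}`, extended by zero. -/
noncomputable def stackPow (p : ℤ × ℕ) : Circle × ℕ → ℂ :=
  (Prod.snd ⁻¹' {p.2}).indicator fun q => circlePow p.1 q.1

lemma measurable_stackPow (p : ℤ × ℕ) : Measurable (stackPow p) :=
  ((circlePow p.1).continuous.measurable.comp measurable_fst).indicator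
    (measurable_snd (measurableSet_singleton _))

lemma norm_stackPow_le_one (p : ℤ × ℕ) (q : Circle × ℕ) : ‖stackPow p q‖ ≤ 1 :=
  (norm_indicator_le_norm_self _ _).trans (norm_circlePow_apply _ _).le

lemma memLp_stackPow (σ : Measure (Circle × ℕ)) [IsFiniteMeasure σ] (p : ℤ × ℕ) :
    MemLp (stackPow p) 2 σ :=
  MemLp.of_bound (measurable_stackPow p).aestronglyMeasurable 1
    (Filter.Eventually.of_forall (norm_stackPow_le_one p))

lemma inner_toLp_stackPow (μ : ℕ → Measure Circle) [IsFiniteMeasure (stackMeasure μ)]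
    (p : ℤ × ℕ) (g : Lp ℂ 2 (stackMeasure μ)) :
    inner ℂ ((memLp_stackPow (stackMeasure μ) p).toLp _) g =
      ∫ z, circlePow (-p.1) z * g (z, p.2) ∂(μ p.2) := by
  rw [L2.inner_def]
  rw [← integral_stackMeasure μ p.2 (fun q => circlePow (-p.1) q.1 * g q)]
  · refine integral_congr_ae ?_
    filter_upwards [(memLp_stackPow (stackMeasure μ) p).coeFn_toLp] with q hq
    rw [hq, RCLike.inner_apply, stackPow]
    by_cases h : q ∈ (Prod.snd ⁻¹' {p.2} : Set (Circle × ℕ))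
    · rw [indicator_of_mem h, indicator_of_mem h, star_circlePow_apply, mul_comm]
    · rw [indicator_of_notMem h, indicator_of_notMem h, map_zero, mul_zero]
  · exact (((circlePow (-p.1)).continuous.measurable.comp
      measurable_fst).aestronglyMeasurable).mul (Lp.aestronglyMeasurable g)

lemma inner_stackPow_stackPow (μ : ℕ → Measure Circle) [IsFiniteMeasure (stackMeasure μ)]
    (p q : ℤ × ℕ) :
    inner ℂ ((memLp_stackPow (stackMeasure μ) p).toLp _)
      ((memLp_stackPow (stackMeasure μ) q).toLp _) =
      if p.2 = q.2 then circleCoeff (μ p.2) (q.1 - p.1) else 0 := by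
  rw [inner_toLp_stackPow]
  have h := (memLp_stackPow (stackMeasure μ) q).coeFn_toLp
  have h2 : ∀ᵐ z ∂(μ p.2), ((memLp_stackPow (stackMeasure μ) q).toLp _ : Circle × ℕ → ℂ)
      (z, p.2) = stackPow q (z, p.2) := by
    have h3 := ae_restrict_of_ae (s := Prod.snd ⁻¹' {p.2}) h
    rw [stackMeasure_restrict] at h3
    exact ae_of_ae_map (by fun_prop) h3
  rw [integral_congr_ae (g := fun z => circlePow (-p.1) z * stackPow q (z, p.2))]
  · unfold stackPow circleCoeff
    split_ifs with hpq
    · refine integral_congr_ae (Filter.Eventually.of_forall fun z => ?_)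
      simp only
      rw [indicator_of_mem (by simpa using hpq), ← ContinuousMap.mul_apply, ← circlePow_add,
        neg_add_eq_sub]
    · have : ∀ z : Circle, (z, p.2) ∉ (Prod.snd ⁻¹' {q.2} : Set (Circle × ℕ)) := by simpa using hpq
      simp [indicator_of_notMem (this _)]
  · filter_upwards [h2] with z hz
    rw [hz]

/-- A vector orthogonal to all these functions restricts on each layer to a function orthogonal to
every character, hence to zero. -/
lemma span_stackPow_closure_eq_top (μ : ℕ → Measure Circle) [∀ k, IsFiniteMeasure (μ k)]
    [IsFiniteMeasure (stackMeasure μ)] :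
    (Submodule.span ℂ (range fun p =>
      (memLp_stackPow (stackMeasure μ) p).toLp (stackPow p))).topologicalClosure = ⊤ := by
  rw [Submodule.topologicalClosure_eq_top_iff, Submodule.eq_bot_iff]
  intro g hg
  have hg' : ∀ p, inner ℂ ((memLp_stackPow (stackMeasure μ) p).toLp _) g = 0 := fun p =>
    (Submodule.mem_orthogonal _ _).1 hg _ (Submodule.subset_span ⟨p, rfl⟩)
  have hz : ∀ k, ∀ᵐ z ∂(μ k), g (z, k) = 0 := by
    intro k
    have hmem : MemLp (fun z => g (z, k)) 2 (μ k) := by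
      have h1 := (Lp.memLp g).restrict (Prod.snd ⁻¹' {k})
      rw [stackMeasure_restrict] at h1
      exact h1.comp_measurePreserving (f := fun z => (z, k)) ⟨by fun_prop, rfl⟩
    have hzero : hmem.toLp _ = 0 := by
      have h1 : hmem.toLp _ ∈ (Submodule.span ℂ (range fun m => ContinuousMap.toLp (E := ℂ) 2
          (μ k) ℂ (circlePow m)))ᗮ := by
        rw [Submodule.mem_orthogonal]
        intro f hf
        induction hf using Submodule.span_induction with
        | mem f hf =>
          obtain ⟨m, rfl⟩ := hf
          have h2 := hg' (m, k)
          rw [inner_toLp_stackPow] at h2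
          rw [← h2, L2.inner_def]
          refine integral_congr_ae ?_
          filter_upwards [hmem.coeFn_toLp, ContinuousMap.coeFn_toLp (𝕜 := ℂ) (p := 2) (μ k)
            (circlePow m)] with z h3 h4
          rw [h3, h4, RCLike.inner_apply, star_circlePow_apply, mul_comm]
        | zero => exact inner_zero_left _
        | add f f' _ _ h h' => rw [inner_add_left, h, h', add_zero]
        | smul c f _ h => rw [inner_smul_left, h, mul_zero]
      rw [(Submodule.topologicalClosure_eq_top_iff).1
        (span_toLp_circlePow_closure_eq_top (μ k))] at h1
      exact (Submodule.mem_bot ℂ).1 h1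
    have h2 := hmem.coeFn_toLp
    rw [hzero] at h2
    filter_upwards [h2, Lp.coeFn_zero ℂ 2 (μ k)] with z h3 h4
    rw [← h3, h4]; rfl
  rw [Lp.eq_zero_iff_ae_eq_zero]
  have hset : MeasurableSet {p | g p = 0} :=
    (Lp.stronglyMeasurable g).measurable (measurableSet_singleton 0)
  refine (Measure.ae_sum_iff).2 fun k => ?_
  exact (ae_map_iff (by fun_prop) hset).2 (hz k)

/-! ### The spectral theorem -/

section CyclicDecomposition

variable {H : Type*} [NormedAddCommGroup H] [InnerProductSpace ℂ H]

/-- The closed invariant subspace generated by a family of vectors. -/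
def cyclicSpan {ι : Type*} (U : H ≃ₗᵢ[ℂ] H) (x : ι → H) : Submodule ℂ H :=
  (Submodule.span ℂ (range fun p : ℤ × ι => (U ^ p.1) (x p.2))).topologicalClosure

lemma zpow_mem_cyclicSpan {ι : Type*} (U : H ≃ₗᵢ[ℂ] H) (x : ι → H) (k : ℤ) (i : ι) :
    (U ^ k) (x i) ∈ cyclicSpan U x :=
  Submodule.le_topologicalClosure _ (Submodule.subset_span ⟨(k, i), rfl⟩)

lemma mem_cyclicSpan {ι : Type*} (U : H ≃ₗᵢ[ℂ] H) (x : ι → H) (i : ι) : x i ∈ cyclicSpan U x := by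
  simpa using zpow_mem_cyclicSpan U x 0 i

lemma cyclicSpan_le {ι : Type*} {U : H ≃ₗᵢ[ℂ] H} {x : ι → H} {K : Submodule ℂ H}
    (hK : IsClosed (K : Set H)) (h : ∀ (k : ℤ) i, (U ^ k) (x i) ∈ K) : cyclicSpan U x ≤ K := by
  refine Submodule.topologicalClosure_minimal _ (Submodule.span_le.2 ?_) hK
  rintro _ ⟨⟨k, i⟩, rfl⟩
  exact h k i

lemma isClosed_cyclicSpan {ι : Type*} (U : H ≃ₗᵢ[ℂ] H) (x : ι → H) :
    IsClosed (cyclicSpan U x : Set H) :=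
  Submodule.isClosed_topologicalClosure _

lemma cyclicSpan_invariant {ι : Type*} (U : H ≃ₗᵢ[ℂ] H) (x : ι → H) (k : ℤ) {y : H}
    (hy : y ∈ cyclicSpan U x) : (U ^ k) y ∈ cyclicSpan U x := by
  have h : cyclicSpan U x ≤ (cyclicSpan U x).comap ((U ^ k).toLinearEquiv : H →ₗ[ℂ] H) := by
    refine cyclicSpan_le ((isClosed_cyclicSpan U x).preimage (U ^ k).continuous) fun l i => ?_
    rw [Submodule.mem_comap]
    change (U ^ k) ((U ^ l) (x i)) ∈ _
    rw [zpow_apply_zpow_apply]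
    exact zpow_mem_cyclicSpan U x _ i
  exact h hy

lemma cyclicSpan_le_cyclicSpan {ι κ : Type*} {U : H ≃ₗᵢ[ℂ] H} {x : ι → H} {y : κ → H}
    (h : ∀ i, x i ∈ cyclicSpan U y) : cyclicSpan U x ≤ cyclicSpan U y :=
  cyclicSpan_le (isClosed_cyclicSpan U y) fun k i => cyclicSpan_invariant U y k (h i)

variable [CompleteSpace H]

/-- Orthogonalization of a sequence with respect to the action of a unitary operator. -/
lemma exists_orthogonal_cyclic (U : H ≃ₗᵢ[ℂ] H) (x : ℕ → H) (hx : cyclicSpan U x = ⊤) :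
    ∃ v : ℕ → H, (∀ i j, i ≠ j → ∀ k : ℤ, inner ℂ (v i) ((U ^ k) (v j)) = 0) ∧
      cyclicSpan U v = ⊤ := by
  -- Gram–Schmidt with closed invariant subspaces: `v n` is the component of `x n` orthogonal to the
  -- space generated by the orbits of the earlier vectors.
  let K : ℕ → Submodule ℂ H := fun n => cyclicSpan U (fun i : Fin n => x i)
  have hKmono : Monotone K := by
    intro m n hmn
    refine cyclicSpan_le_cyclicSpan fun i => ?_
    exact mem_cyclicSpan U (fun i : Fin n => x i) (Fin.castLE hmn i)
  have hproj : ∀ n, ∃ y ∈ K n, ∃ z ∈ (K n)ᗮ, x n = y + z := by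
    intro n
    have : CompleteSpace (K n) := (isClosed_cyclicSpan U _).completeSpace_coe
    exact Submodule.exists_add_mem_mem_orthogonal (x n)
  choose y hy v hv hxyv using hproj
  have hvK : ∀ n, v n ∈ K (n + 1) := by
    intro n
    have h1 : x n ∈ K (n + 1) := mem_cyclicSpan U (fun i : Fin (n + 1) => x i) (Fin.last n)
    have h2 : v n = x n - y n := by rw [hxyv n]; abel
    rw [h2]
    exact Submodule.sub_mem _ h1 (hKmono (Nat.le_succ n) (hy n))
  have horth : ∀ i j, i < j → ∀ k : ℤ, inner ℂ ((U ^ k) (v i)) (v j) = 0 := fun i j hij k =>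
    (Submodule.mem_orthogonal _ _).1 (hv j) _
      (cyclicSpan_invariant U _ k (hKmono hij (hvK i)))
  refine ⟨v, fun i j hij k => ?_, ?_⟩
  · rcases lt_or_gt_of_ne hij with h | h
    · have := horth i j h (-k)
      rwa [← inner_zpow_neg, neg_neg] at this
    · rw [← inner_conj_symm, horth j i h k, map_zero]
  · have hKv : ∀ n, K n ≤ cyclicSpan U v := by
      intro n
      induction n with
      | zero => exact cyclicSpan_le_cyclicSpan fun i => i.elim0
      | succ n ih =>
        refine cyclicSpan_le_cyclicSpan fun i => ?_
        refine Fin.lastCases ?_ (fun i => ?_) i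
        · have h1 : x n ∈ cyclicSpan U v := by
            rw [hxyv n]
            exact Submodule.add_mem _ (ih (hy n)) (mem_cyclicSpan U v n)
          simpa using h1
        · exact ih (mem_cyclicSpan U (fun i : Fin n => x i) i)
    rw [eq_top_iff, ← hx]
    refine cyclicSpan_le_cyclicSpan fun n => hKv (n + 1) ?_
    exact mem_cyclicSpan U (fun i : Fin (n + 1) => x i) (Fin.last n)

lemma exists_orthogonal_cyclic_normalized [Nontrivial H] (U : H ≃ₗᵢ[ℂ] H) (x : ℕ → H)
    (hx : cyclicSpan U x = ⊤) :
    ∃ w : ℕ → H, (∀ i j, i ≠ j → ∀ k : ℤ, inner ℂ (w i) ((U ^ k) (w j)) = 0) ∧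
      cyclicSpan U w = ⊤ ∧ HasSum (fun n => ‖w n‖ ^ 2) 1 := by
  obtain ⟨v, hv, hvt⟩ := exists_orthogonal_cyclic U x hx
  -- The scaling makes the squared norms summable and stays positive where `v n = 0`; dividing by
  -- the root of the total then makes the model measure a probability.
  let c : ℕ → ℝ := fun n => (1 / 2) ^ n / (1 + ‖v n‖)
  have hc : ∀ n, 0 < c n := fun n => by positivity
  have hbound : ∀ n, (c n * ‖v n‖) ^ 2 ≤ (1 / 4) ^ n := by
    intro n
    have h1 : c n * ‖v n‖ ≤ (1 / 2) ^ n := by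
      have h2 : ‖v n‖ / (1 + ‖v n‖) ≤ 1 := by
        rw [div_le_one (by positivity)]; linarith
      calc c n * ‖v n‖ = (1 / 2) ^ n * (‖v n‖ / (1 + ‖v n‖)) := by simp only [c]; ring
        _ ≤ (1 / 2) ^ n * 1 := by gcongr
        _ = _ := mul_one _
    calc (c n * ‖v n‖) ^ 2 ≤ ((1 / 2) ^ n) ^ 2 := by
          have := hc n
          gcongr
      _ = (1 / 4) ^ n := by rw [← pow_mul, mul_comm, pow_mul]; norm_num
  have hsum : Summable fun n => (c n * ‖v n‖) ^ 2 :=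
    Summable.of_nonneg_of_le (fun n => sq_nonneg _) hbound
      (summable_geometric_of_lt_one (by norm_num) (by norm_num))
  set s := ∑' n, (c n * ‖v n‖) ^ 2 with hs
  have hspos : 0 < s := by
    obtain ⟨n, hn⟩ : ∃ n, v n ≠ 0 := by
      by_contra hall
      push Not at hall
      have : cyclicSpan U v ≤ ⊥ := cyclicSpan_le (by simp) fun k i => by simp [hall]
      rw [hvt, top_le_iff] at this
      exact top_ne_bot this.symm
    refine hsum.tsum_pos (fun n => sq_nonneg _) n ?_
    have := hc n
    positivity
  let d : ℕ → ℂ := fun n => ((c n / Real.sqrt s : ℝ) : ℂ)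
  have hd : ∀ n, d n ≠ 0 := fun n => by
    have : c n / Real.sqrt s ≠ 0 := by have := hc n; positivity
    exact Complex.ofReal_ne_zero.2 this
  refine ⟨fun n => d n • v n, fun i j hij k => ?_, ?_, ?_⟩
  · rw [map_smul, inner_smul_left, inner_smul_right, hv i j hij k, mul_zero, mul_zero]
  · rw [eq_top_iff, ← hvt]
    refine cyclicSpan_le_cyclicSpan fun n => ?_
    have := Submodule.smul_mem _ (d n)⁻¹ (mem_cyclicSpan U (fun n => d n • v n) n)
    rwa [smul_smul, inv_mul_cancel₀ (hd n), one_smul] at this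
  · have h1 : ∀ n, ‖d n • v n‖ ^ 2 = (c n * ‖v n‖) ^ 2 / s := by
      intro n
      have := hc n
      rw [norm_smul, Complex.norm_real, Real.norm_of_nonneg (by positivity), mul_pow, div_pow,
        Real.sq_sqrt hspos.le]
      ring
    simp_rw [h1]
    have := hsum.hasSum.div_const s
    rwa [← hs, div_self hspos.ne'] at this

end CyclicDecomposition

lemma norm_circle_fst_le_one (p : Circle × ℕ) : ‖(p.1 : ℂ)‖ ≤ 1 := (Circle.norm_coe _).le

lemma measurable_circle_fst : Measurable fun p : Circle × ℕ => (p.1 : ℂ) := by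
  have h : Continuous fun z : Circle => (z : ℂ) := by fun_prop
  exact h.measurable.comp measurable_fst

/-- A unitary operator on a separable Hilbert space has a spectral measure. -/
theorem UnitaryOperator.exists_isSpectralMeasure (U : UnitaryOperator) [Nontrivial U.space]
    (x : ℕ → U.space) (hx : (Submodule.span ℂ (range x)).topologicalClosure = ⊤) :
    ∃ ρ, U.IsSpectralMeasure ρ := by
  have hxc : cyclicSpan U.op x = ⊤ := by
    rw [eq_top_iff, ← hx]
    refine Submodule.topologicalClosure_minimal _ (Submodule.span_le.2 ?_)
      (isClosed_cyclicSpan U.op x)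
    rintro _ ⟨n, rfl⟩
    exact mem_cyclicSpan U.op x n
  obtain ⟨w, hw, hwt, hws⟩ := exists_orthogonal_cyclic_normalized U.op x hxc
  choose μ hμ using fun n => exists_isVectorMeasure U.op (w n)
  have hfin : ∀ n, IsFiniteMeasure (μ n) := fun n => (hμ n).isFiniteMeasure
  have hmass : ∀ n, μ n univ = ENNReal.ofReal (‖w n‖ ^ 2) := by
    intro n
    have h1 := (hμ n).coeff 0
    rw [zpow_zero, LinearIsometryEquiv.coe_one, id, inner_self_eq_norm_sq_to_K] at h1
    simp only [circleCoeff, circlePow_zero, ContinuousMap.one_apply, integral_const,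
      Complex.real_smul, mul_one] at h1
    have h2 : (μ n).real univ = ‖w n‖ ^ 2 := Complex.ofReal_injective (by simpa using h1)
    rw [← h2, ofReal_measureReal]
  have hprob : IsProbabilityMeasure (stackMeasure μ) := by
    constructor
    rw [stackMeasure, Measure.sum_apply _ MeasurableSet.univ]
    have h1 : ∀ n, (μ n).map (fun z => (z, n)) univ = ENNReal.ofReal (‖w n‖ ^ 2) := by
      intro n
      rw [Measure.map_apply (by fun_prop) MeasurableSet.univ, preimage_univ, hmass]
    simp_rw [h1]
    rw [← ENNReal.ofReal_tsum_of_nonneg (fun n => sq_nonneg _) hws.summable, hws.tsum_eq,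
      ENNReal.ofReal_one]
  -- The orbits of the `w k` and the characters on the layers have the same Gram matrix: the layer
  -- measures are the spectral measures, and different layers are orthogonal.
  obtain ⟨W, hW⟩ := exists_isometryEquiv_of_gram
    (x := fun p : ℤ × ℕ => (U.op ^ p.1) (w p.2))
    (y := fun p => (memLp_stackPow (stackMeasure μ) p).toLp (stackPow p)) hwt
    (span_stackPow_closure_eq_top μ) (by
      intro p q
      rw [inner_stackPow_stackPow, inner_zpow_zpow]
      split_ifs with h
      · rw [(hμ p.2).coeff, h]
      · exact hw _ _ h _)
  refine ⟨_, stackMeasure μ, hprob, ⟨W, fun x => ?_⟩, rfl⟩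
  have hmul := coeFn_mulLp (stackMeasure μ) measurable_circle_fst norm_circle_fst_le_one (W x)
  suffices h : W (U.op x) =
      mulLp (stackMeasure μ) measurable_circle_fst norm_circle_fst_le_one (W x) by
    rw [h]; exact hmul
  let A : U.space →L[ℂ] Lp ℂ 2 (stackMeasure μ) :=
    (W : U.space →L[ℂ] _).comp (U.op : U.space →L[ℂ] U.space)
  let B : U.space →L[ℂ] Lp ℂ 2 (stackMeasure μ) :=
    (mulLp (stackMeasure μ) measurable_circle_fst norm_circle_fst_le_one).comp
      (W : U.space →L[ℂ] _)
  have hAB : cyclicSpan U.op w ≤ LinearMap.eqLocus A.toLinearMap B.toLinearMap := by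
    refine cyclicSpan_le (isClosed_eq A.continuous B.continuous) fun k i => ?_
    change W (U.op ((U.op ^ k) (w i))) =
      mulLp (stackMeasure μ) measurable_circle_fst norm_circle_fst_le_one (W ((U.op ^ k) (w i)))
    have h1 : U.op ((U.op ^ k) (w i)) = (U.op ^ (1 + k)) (w i) := by
      rw [← zpow_apply_zpow_apply, zpow_one]
    rw [h1, hW (1 + k, i), hW (k, i)]
    refine Lp.ext ?_
    filter_upwards [coeFn_mulLp (stackMeasure μ) measurable_circle_fst norm_circle_fst_le_one
      ((memLp_stackPow (stackMeasure μ) (k, i)).toLp (stackPow (k, i))),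
      (memLp_stackPow (stackMeasure μ) (k, i)).coeFn_toLp,
      (memLp_stackPow (stackMeasure μ) (1 + k, i)).coeFn_toLp] with p h2 h3 h4
    rw [h2, h3, h4]
    unfold stackPow
    by_cases h : p ∈ (Prod.snd ⁻¹' {i} : Set (Circle × ℕ))
    · rw [indicator_of_mem h, indicator_of_mem h, circlePow_add, ContinuousMap.mul_apply,
        circlePow_apply 1, zpow_one]
    · rw [indicator_of_notMem h, indicator_of_notMem h, mul_zero]
  rw [hwt] at hAB
  exact hAB (Submodule.mem_top (x := x))

/-! ### Spectral measures of vectors and of operators -/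

section Model

variable {U : UnitaryOperator} {σ : Measure (Circle × ℕ)}
  {W : U.space ≃ₗᵢ[ℂ] Lp ℂ 2 σ}
  (hW : ∀ x, (W (U.op x) : Circle × ℕ → ℂ) =ᵐ[σ] fun p => (p.1 : ℂ) * (W x : Circle × ℕ → ℂ) p)
include hW

lemma model_pow (k : ℕ) (x : U.space) : (W ((U.op ^ k) x) : Circle × ℕ → ℂ) =ᵐ[σ]
    fun p => circlePow k p.1 * (W x : Circle × ℕ → ℂ) p := by
  induction k with
  | zero =>
    refine Filter.Eventually.of_forall fun p => ?_
    simp [circlePow_zero]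
  | succ k ih =>
    have h1 : (U.op ^ (k + 1)) x = U.op ((U.op ^ k) x) := by rw [pow_succ']; rfl
    rw [h1]
    filter_upwards [ih, hW ((U.op ^ k) x)] with p h2 h3
    rw [h3, h2, Nat.cast_succ, circlePow_add, ContinuousMap.mul_apply, circlePow_apply 1, zpow_one]
    ring

/-- In the model the correlation of `x` at time `k` is the integral of `z ^ k * |W x| ^ 2`. -/
lemma isVectorMeasure_model (x : U.space) : IsVectorMeasure U.op x
    ((σ.withDensity fun p => ENNReal.ofReal (‖W x p‖ ^ 2)).map Prod.fst) := by
  have hint : Integrable (fun p => ‖W x p‖ ^ 2) σ := (Lp.memLp (W x)).norm.integrable_sq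
  have hmeas : Measurable fun p => ENNReal.ofReal (‖W x p‖ ^ 2) :=
    (((Lp.stronglyMeasurable (W x)).measurable.norm).pow_const 2).ennreal_ofReal
  have : IsFiniteMeasure (σ.withDensity fun p => ENNReal.ofReal (‖W x p‖ ^ 2)) :=
    isFiniteMeasure_withDensity_ofReal hint.2
  refine IsVectorMeasure.of_nat fun k => ?_
  unfold circleCoeff
  rw [integral_map measurable_fst.aemeasurable (circlePow k).continuous.aestronglyMeasurable,
    integral_withDensity_eq_integral_toReal_smul hmeas
      (Filter.Eventually.of_forall fun p => ENNReal.ofReal_lt_top),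
    ← W.inner_map_map, L2.inner_def]
  refine integral_congr_ae ?_
  filter_upwards [model_pow hW k x] with p hp
  rw [hp, ENNReal.toReal_ofReal (sq_nonneg _), RCLike.inner_apply, mul_assoc, Complex.mul_conj']
  rw [Complex.real_smul, mul_comm]
  push_cast
  rfl

lemma measure_eq_zero_iff_model {x : U.space} {μ : Measure Circle} (hμ : IsVectorMeasure U.op x μ)
    {N : Set Circle} (hN : MeasurableSet N) :
    μ N = 0 ↔ ∀ᵐ p ∂σ, p.1 ∈ N → W x p = 0 := by
  have hmeas : Measurable fun p => ENNReal.ofReal (‖W x p‖ ^ 2) :=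
    (((Lp.stronglyMeasurable (W x)).measurable.norm).pow_const 2).ennreal_ofReal
  rw [hμ.eq (isVectorMeasure_model hW x), Measure.map_apply measurable_fst hN,
    withDensity_apply _ (measurable_fst hN), setLIntegral_eq_zero_iff (measurable_fst hN) hmeas]
  refine Filter.eventually_congr (Filter.Eventually.of_forall fun p => ?_)
  simp only [mem_preimage, ENNReal.ofReal_eq_zero]
  refine imp_congr_right fun _ => ⟨fun h => ?_, fun h => by simp [h]⟩
  have h1 : ‖W x p‖ ^ 2 = 0 := le_antisymm h (sq_nonneg _)
  simpa using h1

/-- Vectors of a model that vanish over a set of the circle form a closed subspace. -/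
lemma exists_model_kernel {N : Set Circle} (hN : MeasurableSet N) :
    ∃ K : Submodule ℂ U.space, IsClosed (K : Set U.space) ∧
      ∀ x μ, IsVectorMeasure U.op x μ → (μ N = 0 ↔ x ∈ K) := by
  let m : Circle × ℕ → ℂ := (Prod.fst ⁻¹' N).indicator 1
  have hm : Measurable m := measurable_one.indicator (measurable_fst hN)
  have hm1 : ∀ p, ‖m p‖ ≤ 1 := fun p => (norm_indicator_le_norm_self _ _).trans (by simp)
  let A : U.space →L[ℂ] Lp ℂ 2 σ := (mulLp σ hm hm1).comp (W : U.space →L[ℂ] Lp ℂ 2 σ)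
  refine ⟨LinearMap.ker A.toLinearMap, A.isClosed_ker, fun x μ hμ => ?_⟩
  rw [measure_eq_zero_iff_model hW hμ hN]
  change _ ↔ mulLp σ hm hm1 (W x) = 0
  rw [Lp.eq_zero_iff_ae_eq_zero]
  refine Filter.eventually_congr ?_
  filter_upwards [coeFn_mulLp σ hm hm1 (W x)] with p hp
  rw [hp]
  by_cases h : p ∈ (Prod.fst ⁻¹' N : Set (Circle × ℕ))
  · have h' : p.1 ∈ N := h
    simp [m, h']
  · have h' : p.1 ∉ N := h
    simp [m, h']

end Model

/-- A null set of the spectral measures of some vectors is null for the spectral measures of all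
vectors in the invariant subspace they generate. -/
lemma UnitaryOperator.IsSpectralMeasure.vectorMeasure_eq_zero {U : UnitaryOperator}
    {ρ : Measure Circle} (hρ : U.IsSpectralMeasure ρ) {ι : Type*} {x : ι → U.space}
    {μ : ι → Measure Circle} (hμ : ∀ i, IsVectorMeasure U.op (x i) (μ i))
    {N : Set Circle} (hN : MeasurableSet N) (hμN : ∀ i, μ i N = 0) {y : U.space}
    (hy : y ∈ cyclicSpan U.op x) {ν : Measure Circle} (hν : IsVectorMeasure U.op y ν) :
    ν N = 0 := by
  obtain ⟨σ, hσ, ⟨W, hW⟩, rfl⟩ := hρ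
  obtain ⟨K, hKc, hK⟩ := exists_model_kernel hW hN
  rw [hK y ν hν]
  refine cyclicSpan_le hKc (fun k i => ?_) hy
  exact (hK _ _ ((hμ i).zpow k)).1 (hμN i)

/-- The spectral measure of an operator is dominated by every measure that dominates the spectral
measures of a generating family of vectors. -/
theorem UnitaryOperator.IsSpectralMeasure.absolutelyContinuous {U : UnitaryOperator}
    {ρ : Measure Circle} (hρ : U.IsSpectralMeasure ρ) {ι : Type*} {x : ι → U.space}
    (hx : cyclicSpan U.op x = ⊤) {μ : ι → Measure Circle}
    (hμ : ∀ i, IsVectorMeasure U.op (x i) (μ i)) {κ : Measure Circle}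
    (hκ : ∀ i, (μ i).AbsolutelyContinuous κ) : ρ.AbsolutelyContinuous κ := by
  refine Measure.AbsolutelyContinuous.mk fun N hN hN0 => ?_
  have hall : ∀ y ν, IsVectorMeasure U.op y ν → ν N = 0 := fun y ν hν =>
    hρ.vectorMeasure_eq_zero hμ hN (fun i => hκ i hN0) (by rw [hx]; trivial) hν
  obtain ⟨σ, hσ, ⟨W, hW⟩, rfl⟩ := hρ
  rw [Measure.map_apply measurable_fst hN]
  -- The constant function `1` vanishes nowhere, so a set null for its vector measure is null for
  -- `ρ`.
  let g : Lp ℂ 2 σ := (memLp_const (1 : ℂ)).toLp _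
  have h1 := (measure_eq_zero_iff_model hW (isVectorMeasure_model hW (W.symm g)) hN).1
    (hall _ _ (isVectorMeasure_model hW (W.symm g)))
  rw [W.apply_symm_apply] at h1
  have h2 : ∀ᵐ p ∂σ, p ∉ (Prod.fst ⁻¹' N : Set (Circle × ℕ)) := by
    filter_upwards [h1, (memLp_const (1 : ℂ)).coeFn_toLp (μ := σ) (p := 2)] with p h3 h4 h5
    have h6 := h3 h5
    rw [h4] at h6
    exact one_ne_zero h6
  simpa using measure_eq_zero_iff_ae_notMem.2 h2

/-! ### Convolutions -/

lemma mconv_absolutelyContinuous_mconv {μ μ' ν ν' : Measure Circle} [SFinite μ] [SFinite μ']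
    [SFinite ν] [SFinite ν'] (h : μ ≪ μ') (h' : ν ≪ ν') : μ.mconv ν ≪ μ'.mconv ν' :=
  (h.prod h').map (by fun_prop)

lemma absolutelyContinuous_of_le {ν : ℕ → Measure Circle} (hν : ∀ J, ν J ≪ ν (J + 1)) {J K : ℕ}
    (hJK : J ≤ K) : ν J ≪ ν K := by
  induction K, hJK using Nat.le_induction with
  | base => exact Measure.AbsolutelyContinuous.rfl
  | succ K _ ih => exact ih.trans (hν K)

lemma convPower_absolutelyContinuous_convPower {μ ν : Measure Circle} [IsFiniteMeasure μ]
    [IsFiniteMeasure ν] (h : μ ≪ ν) (n : ℕ) : convPower μ n ≪ convPower ν n := by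
  induction n with
  | zero => exact Measure.AbsolutelyContinuous.rfl
  | succ n ih => exact mconv_absolutelyContinuous_mconv ih h

/-- Expanding the convolution gives mixed terms with indices `J` and `K`; monotonicity of `ν`
dominates each by the pure power with index `max J K`. -/
lemma mconv_absolutelyContinuous_sum {ν : ℕ → Measure Circle} [∀ J, IsFiniteMeasure (ν J)]
    (hν : ∀ J, ν J ≪ ν (J + 1)) (n : ℕ) {κ ρ : Measure Circle} [SFinite κ] [SFinite ρ]
    (hκ : κ ≪ Measure.sum fun J => convPower (ν J) n) (hρ : ρ ≪ Measure.sum ν) :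
    κ.mconv ρ ≪ Measure.sum fun J => convPower (ν J) (n + 1) := by
  refine (mconv_absolutelyContinuous_mconv hκ hρ).trans ?_
  rw [Measure.mconv, Measure.prod_sum, Measure.map_sum (by fun_prop)]
  refine Measure.absolutelyContinuous_sum_left fun p => ?_
  refine Measure.absolutelyContinuous_sum_right (max p.1 p.2) ?_
  exact mconv_absolutelyContinuous_mconv
    (convPower_absolutelyContinuous_convPower (absolutelyContinuous_of_le hν (le_max_left _ _)) n)
    (absolutelyContinuous_of_le hν (le_max_right _ _))

lemma convPower_absolutelyContinuous_sum {ν : ℕ → Measure Circle} [∀ J, IsFiniteMeasure (ν J)]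
    (hν : ∀ J, ν J ≪ ν (J + 1)) {ρ : Measure Circle} [IsFiniteMeasure ρ]
    (hρ : ρ ≪ Measure.sum ν) (n : ℕ) :
    convPower ρ n ≪ Measure.sum fun J => convPower (ν J) n := by
  induction n with
  | zero => exact Measure.absolutelyContinuous_sum_right 0 Measure.AbsolutelyContinuous.rfl
  | succ n ih => exact mconv_absolutelyContinuous_sum hν n ih hρ

/-! ### Tensor powers -/

namespace UnitaryOperator

/-- The algebraic tensor product inside the Hilbert space tensor product. -/
noncomputable def ofTensor {A B : UnitaryOperator} (t : A.space ⊗[ℂ] B.space) :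
    (A.tensor B).space :=
  (t : UniformSpace.Completion (A.space ⊗[ℂ] B.space))

/-- The elementary tensor of two vectors in the Hilbert space tensor product. -/
noncomputable def tmul {A B : UnitaryOperator} (a : A.space) (b : B.space) : (A.tensor B).space :=
  ofTensor (a ⊗ₜ[ℂ] b)

variable {A B : UnitaryOperator}

lemma inner_tmul (a a' : A.space) (b b' : B.space) :
    Inner.inner ℂ (tmul a b) (tmul a' b') = Inner.inner ℂ a a' * Inner.inner ℂ b b' :=
  (UniformSpace.Completion.inner_coe _ _).trans (TensorProduct.inner_tmul ..)

lemma op_tmul (a : A.space) (b : B.space) :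
    (A.tensor B).op (tmul a b) = tmul (A.op a) (B.op b) := by
  change ((TensorProduct.congrIsometry A.op B.op).toContinuousLinearEquiv :
    A.space ⊗[ℂ] B.space →L[ℂ] A.space ⊗[ℂ] B.space).completion _ = _
  exact ContinuousLinearMap.completion_apply_coe _ _

lemma op_pow_tmul (k : ℕ) (a : A.space) (b : B.space) :
    ((A.tensor B).op ^ k) (tmul a b) = tmul ((A.op ^ k) a) ((B.op ^ k) b) := by
  induction k with
  | zero => rfl
  | succ k ih =>
    rw [pow_succ', pow_succ', pow_succ']
    change (A.tensor B).op (((A.tensor B).op ^ k) (tmul a b)) = _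
    rw [ih, op_tmul]
    rfl

/-- Correlations of elementary tensors are products, and convolution multiplies Fourier
coefficients. -/
lemma isVectorMeasure_tmul {a : A.space} {b : B.space} {μ ν : Measure Circle}
    (hμ : IsVectorMeasure A.op a μ) (hν : IsVectorMeasure B.op b ν) :
    IsVectorMeasure (A.tensor B).op (tmul a b) (μ.mconv ν) := by
  have := hμ.isFiniteMeasure
  have := hν.isFiniteMeasure
  refine IsVectorMeasure.of_nat fun k => ?_
  rw [op_pow_tmul, inner_tmul, circleCoeff_mconv, hμ.coeff, hν.coeff, zpow_natCast, zpow_natCast]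

/-- The elementary tensors with a fixed second factor. -/
noncomputable def tmulLeft (b : B.space) : A.space →L[ℂ] (A.tensor B).space :=
  (UniformSpace.Completion.toComplL (𝕜 := ℂ) (E := A.space ⊗[ℂ] B.space)).comp
    ((TensorProduct.mkL ℂ A.space B.space).flip b)

/-- The elementary tensors with a fixed first factor. -/
noncomputable def tmulRight (a : A.space) : B.space →L[ℂ] (A.tensor B).space :=
  (UniformSpace.Completion.toComplL (𝕜 := ℂ) (E := A.space ⊗[ℂ] B.space)).comp
    (TensorProduct.mkL ℂ A.space B.space a)

lemma span_tmul_closure_eq_top {ι κ : Type*} {x : ι → A.space} {y : κ → B.space}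
    (hx : (Submodule.span ℂ (range x)).topologicalClosure = ⊤)
    (hy : (Submodule.span ℂ (range y)).topologicalClosure = ⊤) :
    (Submodule.span ℂ (range fun p : ι × κ => tmul (x p.1) (y p.2))).topologicalClosure = ⊤ := by
  set K := (Submodule.span ℂ (range fun p : ι × κ =>
    tmul (x p.1) (y p.2))).topologicalClosure with hK
  have hKc : IsClosed (K : Set (A.tensor B).space) := Submodule.isClosed_topologicalClosure _
  have h0 : ∀ i j, tmul (x i) (y j) ∈ K := fun i j =>
    Submodule.le_topologicalClosure _ (Submodule.subset_span ⟨(i, j), rfl⟩)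
  have h1 : ∀ a j, tmul a (y j) ∈ K := by
    intro a j
    have h : (Submodule.span ℂ (range x)).topologicalClosure ≤
        K.comap (tmulLeft (A := A) (y j)).toLinearMap := by
      refine Submodule.topologicalClosure_minimal _ (Submodule.span_le.2 ?_)
        (hKc.preimage (tmulLeft (A := A) (y j)).continuous)
      rintro _ ⟨i, rfl⟩
      exact h0 i j
    rw [hx] at h
    exact h (Submodule.mem_top (x := a))
  have h2 : ∀ a b, tmul a b ∈ K := by
    intro a b
    have h : (Submodule.span ℂ (range y)).topologicalClosure ≤
        K.comap (tmulRight (B := B) a).toLinearMap := by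
      refine Submodule.topologicalClosure_minimal _ (Submodule.span_le.2 ?_)
        (hKc.preimage (tmulRight (B := B) a).continuous)
      rintro _ ⟨j, rfl⟩
      exact h1 a j
    rw [hy] at h
    exact h (Submodule.mem_top (x := b))
  have h3 : ∀ t : A.space ⊗[ℂ] B.space, ofTensor t ∈ K := by
    intro t
    induction t using TensorProduct.induction_on with
    | zero => exact K.zero_mem
    | tmul a b => exact h2 a b
    | add s t hs ht =>
      have h : ofTensor (s + t) = ofTensor s + ofTensor t := UniformSpace.Completion.coe_add s t
      rw [h]
      exact K.add_mem hs ht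
  rw [eq_top_iff]
  intro z _
  have hd : DenseRange (ofTensor (A := A) (B := B)) := UniformSpace.Completion.denseRange_coe
  exact hd.induction_on (p := fun z => z ∈ K) z hKc h3

instance [Nontrivial A.space] [Nontrivial B.space] : Nontrivial (A.tensor B).space := by
  obtain ⟨a, ha⟩ := exists_ne (0 : A.space)
  obtain ⟨b, hb⟩ := exists_ne (0 : B.space)
  refine ⟨tmul a b, 0, fun h => ?_⟩
  have h1 := inner_tmul a a b b
  rw [h, inner_zero_left, eq_comm, mul_eq_zero, inner_self_eq_zero, inner_self_eq_zero] at h1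
  exact h1.elim ha hb

instance (U : UnitaryOperator) [Nontrivial U.space] (n : ℕ) :
    Nontrivial (U.tensorPower n).space := by
  induction n with
  | zero => exact inferInstanceAs (Nontrivial ℂ)
  | succ n ih => exact inferInstanceAs (Nontrivial ((U.tensorPower n).tensor U).space)

/-- The tensor powers are generated by vectors whose spectral measures are dominated by the
convolution powers. -/
lemma exists_tensorPower_family (U : UnitaryOperator) {x : ℕ → U.space} {ν : ℕ → Measure Circle}
    [∀ J, IsFiniteMeasure (ν J)] (hν : ∀ J, ν J ≪ ν (J + 1))
    (hx : (Submodule.span ℂ (range x)).topologicalClosure = ⊤)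
    {μ : ℕ → Measure Circle} (hμ : ∀ i, IsVectorMeasure U.op (x i) (μ i))
    (hμν : ∀ i, μ i ≪ Measure.sum ν) (n : ℕ) :
    ∃ (y : ℕ → (U.tensorPower n).space) (κ : ℕ → Measure Circle),
      (Submodule.span ℂ (range y)).topologicalClosure = ⊤ ∧
      ∀ i, IsVectorMeasure (U.tensorPower n).op (y i) (κ i) ∧
        κ i ≪ Measure.sum fun J => convPower (ν J) n := by
  induction n with
  | zero =>
    refine ⟨fun _ => (1 : ℂ), fun _ => Measure.dirac 1, ?_, fun i => ⟨?_, ?_⟩⟩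
    · rw [eq_top_iff]
      intro z _
      refine Submodule.le_topologicalClosure _ ?_
      have h1 : ∀ w : ℂ, w ∈ Submodule.span ℂ (range fun _ : ℕ => (1 : ℂ)) := by
        intro w
        have h2 : (1 : ℂ) ∈ Submodule.span ℂ (range fun _ : ℕ => (1 : ℂ)) :=
          Submodule.subset_span ⟨0, rfl⟩
        have h3 := Submodule.smul_mem _ w h2
        rwa [smul_eq_mul, mul_one] at h3
      exact h1 z
    · refine IsVectorMeasure.of_nat fun k => ?_
      have h1 : ((U.tensorPower 0).op ^ k) = 1 := one_pow k
      rw [h1]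
      simp only [circleCoeff, integral_dirac, circlePow_apply, one_zpow, Circle.coe_one]
      change (1 : ℂ) = Inner.inner ℂ (1 : ℂ) (1 : ℂ)
      simp
    · exact Measure.absolutelyContinuous_sum_right 0 Measure.AbsolutelyContinuous.rfl
  | succ n ih =>
    obtain ⟨y, κ, hy, hκ⟩ := ih
    refine ⟨fun i => tmul (y i.unpair.1) (x i.unpair.2),
      fun i => (κ i.unpair.1).mconv (μ i.unpair.2), ?_, fun i => ⟨?_, ?_⟩⟩
    · have h1 := span_tmul_closure_eq_top hy hx
      rw [← Nat.pairEquiv.symm.surjective.range_comp] at h1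
      exact h1
    · exact isVectorMeasure_tmul (hκ _).1 (hμ _)
    · have := (hκ i.unpair.1).1.isFiniteMeasure
      have := (hμ i.unpair.2).isFiniteMeasure
      exact mconv_absolutelyContinuous_sum hν n (hκ _).2 (hμν _)

end UnitaryOperator

/-! ### The spectrum of operators with a rank-one structure -/

lemma corrIter_zero (h r : ℕ → ℕ) (N : ℕ) : corrIter h r N (fun _ => 0) = fun _ => 0 := by
  induction N with
  | zero => rfl
  | succ N ih =>
    rw [corrIter]
    convert ih using 2
    funext k
    simp [corrStep]

/-- Needed for the imaginary parts of the correlations, which obey the same real recursion with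
vanishing data. -/
lemma IsTernaryGrowth.eq_zero {h r : ℕ → ℕ} (H : IsTernaryGrowth h r) {γ : ℕ → ℤ → ℝ}
    (hγ : ∀ j, γ j = corrStep (h j) (r j) (γ (j + 1)))
    (hγ0 : ∀ j (m : ℤ), |m| < 2 * h j → γ j m = 0) (k : ℤ) : γ 0 k = 0 := by
  obtain ⟨N, hN⟩ := H.tendsto_exists k
  rw [← corrIter_eq hγ N]
  have h1 := H.corrIter_congr N (A := h N) (g := γ N) (g' := fun _ => 0)
    (fun m hm => hγ0 N m (by linarith)) (k := k) (by have := H.height_pos 0; linarith)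
  rw [h1, corrIter_zero]

/-- A sequence of unit vectors that behave under a unitary operator as the normalized indicators of
the bases of the towers of a rank-one construction with offsets `h j * (3 ^ i - 1)`. -/
structure IsRankOneSequence (U : UnitaryOperator) (h r : ℕ → ℕ) (e : ℕ → U.space) : Prop where
  norm_eq : ∀ j, ‖e j‖ = 1
  decomp : ∀ j, e j = ((Real.sqrt (r j) : ℝ) : ℂ)⁻¹ • ∑ i ∈ Finset.range (r j),
    (U.op ^ (-((h j : ℤ) * (3 ^ i - 1)))) (e (j + 1))
  orth : ∀ j (m : ℕ), 0 < m → m < 2 * h j → inner ℂ (e j) ((U.op ^ m) (e j)) = 0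
  total : cyclicSpan U.op e = ⊤

namespace IsRankOneSequence

variable {U : UnitaryOperator} {h r : ℕ → ℕ} {e : ℕ → U.space} (he : IsRankOneSequence U h r e)
include he

/-- Both copies of `e j` are expanded; the `-1` in the offsets cancels, leaving only differences of
powers of `3`. -/
lemma inner_decomp (j : ℕ) (k : ℤ) : inner ℂ (e j) ((U.op ^ k) (e j)) =
    (r j : ℂ)⁻¹ * ∑ p ∈ Finset.range (r j) ×ˢ Finset.range (r j),
      inner ℂ (e (j + 1)) ((U.op ^ (k - h j * powDiff p)) (e (j + 1))) := by
  have hsq : ((Real.sqrt (r j) : ℝ) : ℂ)⁻¹ * ((Real.sqrt (r j) : ℝ) : ℂ)⁻¹ = (r j : ℂ)⁻¹ := by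
    rw [← mul_inv, ← Complex.ofReal_mul, Real.mul_self_sqrt (Nat.cast_nonneg _)]
    simp
  conv_lhs => rw [he.decomp j]
  rw [map_smul, inner_smul_left, inner_smul_right, map_inv₀, Complex.conj_ofReal, ← mul_assoc, hsq,
    map_sum, sum_inner, Finset.sum_product_right]
  congr 1
  refine Finset.sum_congr rfl fun i _ => ?_
  rw [inner_sum]
  refine Finset.sum_congr rfl fun i' _ => ?_
  rw [zpow_apply_zpow_apply, inner_zpow_zpow]
  congr 3
  simp only [powDiff]
  ring

lemma inner_eq (j : ℕ) (m : ℤ) (hm : |m| < 2 * h j) :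
    inner ℂ (e j) ((U.op ^ m) (e j)) = if m = 0 then 1 else 0 := by
  split_ifs with h0
  · simp [h0, he.norm_eq]
  · obtain ⟨l, rfl | rfl⟩ := m.eq_nat_or_neg
    · rw [zpow_natCast]
      refine he.orth j l (by omega) ?_
      rw [Nat.abs_cast] at hm
      exact_mod_cast hm
    · rw [inner_zpow_neg, ← inner_conj_symm, zpow_natCast, he.orth j l (by omega), map_zero]
      rw [abs_neg, Nat.abs_cast] at hm
      exact_mod_cast hm

lemma inner_eq_corr (H : IsTernaryGrowth h r) (J N : ℕ) {k : ℤ} (hk : |k| < h (J + N)) :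
    inner ℂ (e J) ((U.op ^ k) (e J)) =
      corr (fun j => h (J + j)) (fun j => r (J + j)) N k := by
  let γ : ℕ → ℤ → ℂ := fun j k => inner ℂ (e (J + j)) ((U.op ^ k) (e (J + j)))
  have hre := (H.shift J).eq_corr (γ := fun j k => (γ j k).re) (fun j => by
      funext k
      simp only [γ]
      rw [he.inner_decomp, corrStep, ← Complex.ofReal_natCast, ← Complex.ofReal_inv,
        Complex.re_ofReal_mul, Complex.re_sum]
      rfl) (fun j m hm => by
      simp only [γ]
      rw [he.inner_eq _ _ hm]
      split_ifs <;> simp) N hk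
  have him := (H.shift J).eq_zero (γ := fun j k => (γ j k).im) (fun j => by
      funext k
      simp only [γ]
      rw [he.inner_decomp, corrStep, ← Complex.ofReal_natCast, ← Complex.ofReal_inv,
        Complex.im_ofReal_mul, Complex.im_sum]
      rfl) (fun j m hm => by
      simp only [γ]
      rw [he.inner_eq _ _ hm]
      split_ifs <;> simp) k
  have hγ : γ 0 k = corr (fun j => h (J + j)) (fun j => r (J + j)) N k :=
    Complex.ext (by simpa using hre) (by simpa using him)
  exact hγ

/-- This inclusion makes the spectral measures `ν J` increasing for `≪`, which controls the mixed
terms in convolution powers. -/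
lemma mem_cyclicSpan_succ (j : ℕ) : e j ∈ cyclicSpan U.op (fun _ : Unit => e (j + 1)) := by
  rw [he.decomp j]
  exact Submodule.smul_mem _ _ (Submodule.sum_mem _ fun i _ =>
    zpow_mem_cyclicSpan U.op (fun _ : Unit => e (j + 1)) _ ())

/-- The spectral type of the tensor and convolution powers of an operator with a rank-one
structure. -/
theorem spectrum (H : IsTernaryGrowth h r) {n : ℕ} (hn : 2 ≤ n)
    (hs : ∀ J, ¬ Summable fun j => (r (J + j) : ℝ) ^ 2 * (r (J + j) : ℝ)⁻¹ ^ (2 * n))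
    (hs' : ∀ J, Summable fun j => (r (J + j) : ℝ)⁻¹ ^ (2 * n)) :
    (U.tensorPower n).HasSingularSpectrum ∧
    (U.tensorPower (n + 1)).HasAbsolutelyContinuousSpectrum ∧
    (∃ ρ, U.IsSpectralMeasure ρ) ∧
    ∀ ρ, U.IsSpectralMeasure ρ →
      (convPower ρ n).MutuallySingular circleLebesgue ∧
      (convPower ρ (n + 1)).AbsolutelyContinuous circleLebesgue := by
  have hnt : Nontrivial U.space := ⟨e 0, 0, fun h0 => by
    have := he.norm_eq 0
    rw [h0, norm_zero] at this
    exact zero_ne_one this⟩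
  choose ν hν using fun J => exists_isVectorMeasure U.op (e J)
  have hfin : ∀ J, IsFiniteMeasure (ν J) := fun J => (hν J).isFiniteMeasure
  have hprob : ∀ J, IsProbabilityMeasure (ν J) := by
    intro J
    have h1 := (hν J).coeff 0
    rw [he.inner_eq J 0 (by simpa using H.height_pos J), if_pos rfl] at h1
    simp only [circleCoeff, circlePow_zero, ContinuousMap.one_apply, integral_const,
      Complex.real_smul, mul_one] at h1
    have h2 : (ν J).real univ = 1 := Complex.ofReal_injective (by simpa using h1)
    exact ⟨by rw [← ofReal_measureReal (μ := ν J), h2, ENNReal.ofReal_one]⟩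
  have hcoeff : ∀ J N (k : ℤ), |k| < h (J + N) →
      circleCoeff (ν J) k = corr (fun j => h (J + j)) (fun j => r (J + j)) N k :=
    fun J N k hk => ((hν J).coeff k).trans (he.inner_eq_corr H J N hk)
  have hsing : (Measure.sum fun J => convPower (ν J) n).MutuallySingular circleLebesgue :=
    Measure.MutuallySingular.sum_left.2 fun J =>
      (H.shift J).convPower_mutuallySingular (hcoeff J) hn (hs J)
  have hac : (Measure.sum fun J => convPower (ν J) (n + 1)) ≪ circleLebesgue :=
    Measure.absolutelyContinuous_sum_left fun J =>
      (H.shift J).convPower_absolutelyContinuous (hcoeff J) n (hs' J)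
  let p : ℕ → ℤ × ℕ := (Denumerable.eqv (ℤ × ℕ)).symm
  let x : ℕ → U.space := fun i => (U.op ^ (p i).1) (e (p i).2)
  have hx : (Submodule.span ℂ (range x)).topologicalClosure = ⊤ := by
    have h1 := he.total
    rw [cyclicSpan, ← (Denumerable.eqv (ℤ × ℕ)).symm.surjective.range_comp] at h1
    exact h1
  have hxν : ∀ i, IsVectorMeasure U.op (x i) (ν (p i).2) := fun i => (hν _).zpow _
  have hxsum : ∀ i, ν (p i).2 ≪ Measure.sum ν := fun i =>
    Measure.absolutelyContinuous_sum_right _ Measure.AbsolutelyContinuous.rfl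
  obtain ⟨ρ₀, hρ₀⟩ := U.exists_isSpectralMeasure x hx
  have hmono : ∀ J, ν J ≪ ν (J + 1) := fun J =>
    Measure.AbsolutelyContinuous.mk fun N hN hN0 =>
      hρ₀.vectorMeasure_eq_zero (x := fun _ : Unit => e (J + 1)) (μ := fun _ => ν (J + 1))
        (fun _ => hν (J + 1)) hN (fun _ => hN0) (he.mem_cyclicSpan_succ J) (hν J)
  -- It suffices to dominate one spectral measure of each tensor power, through the generating
  -- elementary tensors.
  have htensor : ∀ m, ∃ ρ, (U.tensorPower m).IsSpectralMeasure ρ ∧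
      ρ ≪ Measure.sum fun J => convPower (ν J) m := by
    intro m
    obtain ⟨y, κ, hy, hκ⟩ := U.exists_tensorPower_family hmono hx hxν hxsum m
    obtain ⟨ρ, hρ⟩ := (U.tensorPower m).exists_isSpectralMeasure y hy
    refine ⟨ρ, hρ, hρ.absolutelyContinuous (x := y) ?_ (fun i => (hκ i).1) fun i => (hκ i).2⟩
    rw [eq_top_iff, ← hy]
    refine Submodule.topologicalClosure_minimal _ (Submodule.span_le.2 ?_) (isClosed_cyclicSpan _ y)
    rintro _ ⟨i, rfl⟩
    exact mem_cyclicSpan _ y i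
  refine ⟨?_, ?_, ⟨ρ₀, hρ₀⟩, fun ρ hρ => ?_⟩
  · obtain ⟨ρ, hρ, hρ'⟩ := htensor n
    exact ⟨ρ, hρ, hsing.mono_ac hρ' Measure.AbsolutelyContinuous.rfl⟩
  · obtain ⟨ρ, hρ, hρ'⟩ := htensor (n + 1)
    exact ⟨ρ, hρ, hρ'.trans hac⟩
  · have hρν : ρ ≪ Measure.sum ν := hρ.absolutelyContinuous he.total hν fun J =>
      Measure.absolutelyContinuous_sum_right J Measure.AbsolutelyContinuous.rfl
    have hρfin : IsFiniteMeasure ρ := by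
      obtain ⟨σ, hσ, -, rfl⟩ := hρ
      infer_instance
    exact ⟨hsing.mono_ac (convPower_absolutelyContinuous_sum hmono hρν n)
        Measure.AbsolutelyContinuous.rfl,
      (convPower_absolutelyContinuous_sum hmono hρν (n + 1)).trans hac⟩

end IsRankOneSequence

/-! ### The choice of the cutting numbers. -/

/-- For every `n > 1` there are cutting numbers `r j` such that `r j ^ (-2 n)` is summable but
`r j ^ (2 - 2 n)` is not. -/
lemma exists_cutting_numbers {n : ℕ} (hn : 2 ≤ n) : ∃ r : ℕ → ℕ, (∀ j, 2 ≤ r j) ∧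
    (∀ J, ¬ Summable fun j => (r (J + j) : ℝ) ^ 2 * (r (J + j) : ℝ)⁻¹ ^ (2 * n)) ∧
    ∀ J, Summable fun j => (r (J + j) : ℝ)⁻¹ ^ (2 * n) := by
  obtain ⟨k, rfl⟩ : ∃ k, n = k + 1 := ⟨n - 1, by omega⟩
  have hk : 0 < k := by omega
  -- With `k = n - 1` and `t j = (j + 1) ^ (1 / (2k))`, the divergent series compares with `∑ 1 / j`
  -- and the convergent one with `∑ j ^ (-(k + 1) / k)`. Rounding up and adding `1` ensures `2 ≤ r
  -- j` and keeps `r j ≤ 3 * t j`.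
  let t : ℕ → ℝ := fun j => ((j : ℝ) + 1) ^ ((2 * k : ℕ) : ℝ)⁻¹
  have ht1 : ∀ j, 1 ≤ t j := fun j =>
    Real.one_le_rpow (by linarith [Nat.cast_nonneg (α := ℝ) j]) (by positivity)
  have htpow : ∀ j, t j ^ (2 * k) = j + 1 := fun j =>
    Real.rpow_inv_natCast_pow (by positivity) (by omega)
  let r : ℕ → ℕ := fun j => ⌈t j⌉₊ + 1
  have htr : ∀ j, t j ≤ r j := fun j => by
    have := Nat.le_ceil (t j)
    simp only [r]; push_cast; linarith
  have hrt : ∀ j, (r j : ℝ) ≤ 3 * t j := fun j => by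
    have := Nat.ceil_lt_add_one (zero_le_one.trans (ht1 j))
    have := ht1 j
    simp only [r]; push_cast; linarith
  have hr0 : ∀ j, (0 : ℝ) < r j := fun j => by positivity
  refine ⟨r, fun j => ?_, fun J hs => ?_, fun J => ?_⟩
  · have : 0 < ⌈t j⌉₊ := Nat.ceil_pos.2 (zero_lt_one.trans_le (ht1 j))
    simp only [r]; omega
  · simp_rw [add_comm J] at hs
    rw [summable_nat_add_iff (f := fun j => (r j : ℝ) ^ 2 * (r j : ℝ)⁻¹ ^ (2 * (k + 1)))] at hs
    have h1 : Summable fun j : ℕ => (1 : ℝ) / ((j + 1 : ℕ) : ℝ) := by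
      refine Summable.of_nonneg_of_le (fun j => by positivity) (fun j => ?_)
        (hs.mul_left (3 ^ (2 * k)))
      have h2 : (r j : ℝ) ^ 2 * (r j : ℝ)⁻¹ ^ (2 * (k + 1)) = 1 / (r j : ℝ) ^ (2 * k) := by
        have := (hr0 j).ne'
        rw [mul_add, pow_add, inv_pow, inv_pow]
        field_simp
      have h3 : (r j : ℝ) ^ (2 * k) ≤ 3 ^ (2 * k) * (j + 1) := by
        rw [← htpow, ← mul_pow]
        exact pow_le_pow_left₀ (hr0 j).le (hrt j) _
      rw [h2, mul_one_div, div_le_div_iff₀ (by positivity) (pow_pos (hr0 j) _)]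
      push_cast
      linarith
    rw [summable_nat_add_iff (f := fun j : ℕ => (1 : ℝ) / j)] at h1
    exact Real.not_summable_one_div_natCast h1
  · simp_rw [add_comm J]
    rw [summable_nat_add_iff (f := fun j => (r j : ℝ)⁻¹ ^ (2 * (k + 1)))]
    have hexp : 1 < ((2 * (k + 1) : ℕ) : ℝ) / ((2 * k : ℕ) : ℝ) := by
      rw [one_lt_div (by positivity)]
      exact_mod_cast (by omega : 2 * k < 2 * (k + 1))
    have h1 := (summable_nat_add_iff 1).2 (Real.summable_one_div_nat_rpow.2 hexp)
    refine Summable.of_nonneg_of_le (fun j => by positivity) (fun j => ?_) h1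
    have h2 : ((j + 1 : ℕ) : ℝ) ^ (((2 * (k + 1) : ℕ) : ℝ) / ((2 * k : ℕ) : ℝ)) =
        t j ^ (2 * (k + 1)) := by
      simp only [t]
      rw [← Real.rpow_natCast, ← Real.rpow_mul (by positivity), inv_mul_eq_div]
      push_cast
      rfl
    rw [h2, inv_pow, ← one_div]
    have := ht1 j
    exact one_div_le_one_div_of_le (by positivity)
      (pow_le_pow_left₀ (by positivity) (htr j) _)

/-! ### Cutting and stacking with geometrically growing spacers -/

/-- The heights of the towers. -/
def ternaryHeight (r : ℕ → ℕ) : ℕ → ℕ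
  | 0 => 1
  | j + 1 => ternaryHeight r j * (3 ^ r j - 1)

/-- The rank-one parameters with `h (2 * 3 ^ i - 1)` spacers above the `i`-th column of a tower of
height `h`. -/
def ternaryParams (r : ℕ → ℕ) (hr : ∀ j, 2 ≤ r j) : RankOneParams where
  h₀ := 1
  r := r
  s j i := ternaryHeight r j * (2 * 3 ^ i - 1)
  h₀_pos := one_pos
  two_le_r := hr

/-- Column `i` with its spacers occupies `2 * 3 ^ i * h` floors, and `2 * 3 ^ i = 3 ^ (i + 1) - 3 ^
i` telescopes to the required offsets. -/
lemma ternary_sum (h m : ℕ) :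
    m * h + ∑ i ∈ Finset.range m, h * (2 * 3 ^ i - 1) = h * (3 ^ m - 1) := by
  induction m with
  | zero => simp
  | succ m ih =>
    rw [Finset.sum_range_succ, add_mul, one_mul]
    have h1 : 1 ≤ 3 ^ m := Nat.one_le_pow' m 2
    have h2 : h * (3 ^ (m + 1) - 1) = h * (3 ^ m - 1) + h * (2 * 3 ^ m - 1) + h := by
      have : 3 ^ (m + 1) - 1 = (3 ^ m - 1) + (2 * 3 ^ m - 1) + 1 := by rw [pow_succ]; omega
      rw [this]; ring
    omega

lemma ternaryParams_height (r : ℕ → ℕ) (hr : ∀ j, 2 ≤ r j) (j : ℕ) :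
    (ternaryParams r hr).height j = ternaryHeight r j := by
  induction j with
  | zero => rfl
  | succ j ih =>
    change (ternaryParams r hr).height j * r j + ∑ i ∈ Finset.range (r j),
      ternaryHeight r j * (2 * 3 ^ i - 1) = ternaryHeight r j * (3 ^ r j - 1)
    rw [ih, mul_comm, ternary_sum]

lemma ternaryParams_offset (r : ℕ → ℕ) (hr : ∀ j, 2 ≤ r j) (j i : ℕ) :
    (ternaryParams r hr).offset j i = ternaryHeight r j * (3 ^ i - 1) := by
  change i * (ternaryParams r hr).height j + ∑ l ∈ Finset.range i,
      ternaryHeight r j * (2 * 3 ^ l - 1) = _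
  rw [ternaryParams_height, ternary_sum]

lemma isTernaryGrowth_ternaryHeight {r : ℕ → ℕ} (hr : ∀ j, 2 ≤ r j) :
    IsTernaryGrowth (ternaryHeight r) r where
  pos := one_pos
  two_le := hr
  succ _ := rfl

/-- A floor of a column of the tower of stage `j` is not above the tower of stage `j + 1`, and there
are at least `h j` floors above it. -/
lemma IsTernaryGrowth.offset_add_lt {h r : ℕ → ℕ} (H : IsTernaryGrowth h r) {j i k : ℕ}
    (hi : i < r j) (hk : k < 2 * h j) : h j * (3 ^ i - 1) + k < h (j + 1) := by
  rw [H.succ]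
  have h1 : 3 ^ (i + 1) ≤ 3 ^ r j := Nat.pow_le_pow_right (by norm_num) hi
  have h2 : 1 ≤ 3 ^ i := Nat.one_le_pow' i 2
  have h3 : (3 ^ i - 1) + 2 ≤ 3 ^ r j - 1 := by rw [pow_succ] at h1; omega
  calc h j * (3 ^ i - 1) + k < h j * (3 ^ i - 1) + h j * 2 := by omega
    _ = h j * ((3 ^ i - 1) + 2) := by ring
    _ ≤ h j * (3 ^ r j - 1) := Nat.mul_le_mul_left _ h3

lemma disjoint_Ico_of_ne {c w : ℝ} (hw : 0 < w) {a b : ℤ} (hab : a ≠ b) :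
    Disjoint (Ico (c + a * w) (c + a * w + w)) (Ico (c + b * w) (c + b * w + w)) := by
  rw [Set.disjoint_left]
  rintro x ⟨h1, h2⟩ ⟨h3, h4⟩
  rcases lt_or_gt_of_ne hab with h | h
  · have : (a : ℝ) + 1 ≤ b := by exact_mod_cast h
    nlinarith
  · have : (b : ℝ) + 1 ≤ a := by exact_mod_cast h
    nlinarith

/-! ### The floors as half-intervals of the line, and orbits of points. -/

namespace Ternary

variable (r : ℕ → ℕ)

/-- The length of the floors of stage `j`. -/
noncomputable def width : ℕ → ℝ
  | 0 => 1
  | j + 1 => width j / r j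

/-- A bound for the floors of stage `j`. -/
noncomputable def bound : ℕ → ℝ
  | 0 => 1
  | j + 1 => bound j + ternaryHeight r (j + 1) * width r (j + 1)

/-- The left endpoint of the floor number `p` of stage `j`. The columns of a tower are numbered from
right to left. -/
noncomputable def pos : ℕ → ℕ → ℝ
  | 0, _ => 0
  | j + 1, p =>
    -- Floor `p` belongs to column `i` exactly when `p / h j = 3 ^ i - 1`, so the test is for a
    -- power of `3` and the logarithm recovers `i`.
    if 3 ^ Nat.log 3 (p / ternaryHeight r j + 1) = p / ternaryHeight r j + 1 then
      pos j (p % ternaryHeight r j) +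
        ((r j : ℝ) - 1 - Nat.log 3 (p / ternaryHeight r j + 1)) * width r (j + 1)
    -- Spacers go beyond all earlier floors, at slots numbered by `p` itself; the slots of column
    -- floors stay empty.
    else bound r j + p * width r (j + 1)

/-- The floor number `p` of stage `j`. -/
noncomputable def flr (j p : ℕ) : Set ℝ := Ico (pos r j p) (pos r j p + width r j)

variable {r} (hr : ∀ j, 2 ≤ r j)
include hr

lemma width_pos (j : ℕ) : 0 < width r j := by
  induction j with
  | zero => exact one_pos
  | succ j ih =>
    have : (0 : ℝ) < r j := by have := hr j; positivity
    exact div_pos ih this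

lemma width_eq (j : ℕ) : width r j = r j * width r (j + 1) := by
  have : (0 : ℝ) < r j := by have := hr j; positivity
  rw [width, mul_div_cancel₀ _ this.ne']

lemma width_le (j : ℕ) : width r j ≤ (1 / 2) ^ j := by
  induction j with
  | zero => simp [width]
  | succ j ih =>
    have h1 : (2 : ℝ) ≤ r j := by exact_mod_cast hr j
    have h2 := width_eq hr j
    have h3 := width_pos hr (j + 1)
    rw [pow_succ]
    nlinarith

lemma height_pos (j : ℕ) : 0 < ternaryHeight r j := by
  exact_mod_cast (isTernaryGrowth_ternaryHeight hr).height_pos j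

lemma pos_column (j i : ℕ) {k : ℕ} (hk : k < ternaryHeight r j) :
    pos r (j + 1) (ternaryHeight r j * (3 ^ i - 1) + k) =
      pos r j k + ((r j : ℝ) - 1 - i) * width r (j + 1) := by
  have h1 : (ternaryHeight r j * (3 ^ i - 1) + k) / ternaryHeight r j + 1 = 3 ^ i := by
    rw [Nat.mul_add_div (height_pos hr j), Nat.div_eq_of_lt hk]
    have : 1 ≤ 3 ^ i := Nat.one_le_pow' i 2
    omega
  have h2 : (ternaryHeight r j * (3 ^ i - 1) + k) % ternaryHeight r j = k := by
    rw [Nat.mul_add_mod, Nat.mod_eq_of_lt hk]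
  rw [pos, h1, h2, Nat.log_pow (by norm_num), if_pos rfl]

lemma pos_cases (j : ℕ) {p : ℕ} (hp : p < ternaryHeight r (j + 1)) :
    (∃ i < r j, ∃ k < ternaryHeight r j, p = ternaryHeight r j * (3 ^ i - 1) + k) ∨
      pos r (j + 1) p = bound r j + p * width r (j + 1) := by
  by_cases hc : 3 ^ Nat.log 3 (p / ternaryHeight r j + 1) = p / ternaryHeight r j + 1
  · left
    have h0 := height_pos hr j
    refine ⟨Nat.log 3 (p / ternaryHeight r j + 1), ?_, p % ternaryHeight r j, Nat.mod_lt _ h0, ?_⟩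
    · refine Nat.log_lt_of_lt_pow (Nat.succ_ne_zero _) ?_
      have : p / ternaryHeight r j < 3 ^ r j - 1 := by
        rw [Nat.div_lt_iff_lt_mul h0, mul_comm]; exact hp
      exact Nat.add_lt_of_lt_sub this
    · rw [hc, Nat.add_sub_cancel, Nat.div_add_mod]
  · right
    rw [pos, if_neg hc]

lemma flr_column_subset (j : ℕ) {i k : ℕ} (hi : i < r j) (hk : k < ternaryHeight r j) :
    flr r (j + 1) (ternaryHeight r j * (3 ^ i - 1) + k) ⊆ flr r j k := by
  have h1 : (i : ℝ) + 1 ≤ r j := by exact_mod_cast hi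
  have h2 := width_pos hr (j + 1)
  have h3 := width_eq hr j
  unfold flr
  rw [pos_column hr j i hk]
  have h4 : (0 : ℝ) ≤ i := Nat.cast_nonneg i
  refine Ico_subset_Ico ?_ ?_
  · nlinarith
  · rw [h3]; nlinarith

lemma exists_mem_flr_column (j : ℕ) {k : ℕ} (hk : k < ternaryHeight r j) {x : ℝ}
    (hx : x ∈ flr r j k) :
    ∃ i < r j, x ∈ flr r (j + 1) (ternaryHeight r j * (3 ^ i - 1) + k) := by
  have h2 := width_pos hr (j + 1)
  have h3 := width_eq hr j
  obtain ⟨hx1, hx2⟩ := hx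
  rw [h3] at hx2
  let t := (x - pos r j k) / width r (j + 1)
  have ht0 : 0 ≤ t := div_nonneg (by linarith) h2.le
  have htr : t < r j := by rw [div_lt_iff₀ h2]; linarith
  have hxt : x = pos r j k + t * width r (j + 1) := by
    simp only [t]; field_simp; ring
  have hm1 := Nat.floor_le ht0
  have hm2 := Nat.lt_floor_add_one t
  have hm3 : ⌊t⌋₊ < r j := (Nat.floor_lt ht0).2 htr
  refine ⟨r j - 1 - ⌊t⌋₊, by omega, ?_⟩
  unfold flr
  rw [pos_column hr j _ hk]
  have h4 : ((r j - 1 - ⌊t⌋₊ : ℕ) : ℝ) = r j - 1 - ⌊t⌋₊ := by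
    rw [Nat.cast_sub (by omega), Nat.cast_sub (by omega)]; simp
  rw [h4, hxt]
  constructor <;> nlinarith

lemma flr_subset_bound (j : ℕ) {p : ℕ} (hp : p < ternaryHeight r j) :
    flr r j p ⊆ Ico 0 (bound r j) := by
  induction j generalizing p with
  | zero => simp [flr, pos, width, bound]
  | succ j ih =>
    have hw := width_pos hr (j + 1)
    have hb : 0 ≤ bound r j := by
      have h1 := ih (height_pos hr j)
      have h2 := h1 (left_mem_Ico.2 (by linarith [width_pos hr j]))
      exact h2.1.trans h2.2.le
    have hb' : bound r (j + 1) = bound r j + ternaryHeight r (j + 1) * width r (j + 1) := rfl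
    rcases pos_cases hr j hp with ⟨i, hi, k, hk, rfl⟩ | h
    · refine (flr_column_subset hr j hi hk).trans ((ih hk).trans (Ico_subset_Ico_right ?_))
      rw [hb']
      have : (0 : ℝ) ≤ ternaryHeight r (j + 1) := Nat.cast_nonneg _
      nlinarith
    · unfold flr
      rw [h]
      have h1 : (p : ℝ) + 1 ≤ ternaryHeight r (j + 1) := by exact_mod_cast hp
      have h2 : (0 : ℝ) ≤ p := Nat.cast_nonneg _
      refine Ico_subset_Ico (by positivity) ?_
      rw [hb']; nlinarith

lemma flr_disjoint (j : ℕ) {p q : ℕ} (hp : p < ternaryHeight r j) (hq : q < ternaryHeight r j)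
    (hpq : p ≠ q) : Disjoint (flr r j p) (flr r j q) := by
  induction j generalizing p q with
  | zero =>
    have : ternaryHeight r 0 = 1 := rfl
    omega
  | succ j ih =>
    have hw := width_pos hr (j + 1)
    have key : ∀ {i k q : ℕ}, i < r j → k < ternaryHeight r j →
        pos r (j + 1) q = bound r j + q * width r (j + 1) →
        Disjoint (flr r (j + 1) (ternaryHeight r j * (3 ^ i - 1) + k)) (flr r (j + 1) q) := by
      intro i k q hi hk hq
      rw [Set.disjoint_left]
      intro x hx1 hx2
      have h1 := (flr_subset_bound hr j hk (flr_column_subset hr j hi hk hx1)).2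
      have h2 := hx2.1
      rw [hq] at h2
      have : (0 : ℝ) ≤ q := Nat.cast_nonneg _
      nlinarith
    rcases pos_cases hr j hp with ⟨i, hi, k, hk, rfl⟩ | h
    · rcases pos_cases hr j hq with ⟨i', hi', k', hk', rfl⟩ | h'
      · by_cases hkk : k = k'
        · subst hkk
          have hii : (r j : ℤ) - 1 - i ≠ (r j : ℤ) - 1 - i' := by
            intro h0
            have : i = i' := by omega
            exact hpq (by rw [this])
          have := disjoint_Ico_of_ne (c := pos r j k) hw hii
          unfold flr
          rw [pos_column hr j i hk, pos_column hr j i' hk]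
          push_cast at this
          exact this
        · exact (ih hk hk' hkk).mono (flr_column_subset hr j hi hk)
            (flr_column_subset hr j hi' hk')
      · exact key hi hk h'
    · rcases pos_cases hr j hq with ⟨i', hi', k', hk', rfl⟩ | h'
      · exact (key hi' hk' h).symm
      · have := disjoint_Ico_of_ne (c := bound r j) hw (a := p) (b := q) (by exact_mod_cast hpq)
        unfold flr
        rw [h, h']
        exact_mod_cast this

lemma flr_unique (j : ℕ) {p q : ℕ} (hp : p < ternaryHeight r j) (hq : q < ternaryHeight r j)
    {x : ℝ} (hxp : x ∈ flr r j p) (hxq : x ∈ flr r j q) : p = q := by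
  by_contra hne
  exact Set.disjoint_left.1 (flr_disjoint hr j hp hq hne) hxp hxq

omit hr in
variable (r) in
/-- The union of all floors. -/
def space : Set ℝ := ⋃ j, ⋃ p < ternaryHeight r j, flr r j p

omit hr in
lemma mem_space {x : ℝ} : x ∈ space r ↔ ∃ j, ∃ p < ternaryHeight r j, x ∈ flr r j p := by
  simp [space]

omit hr in
lemma flr_subset_space {j p : ℕ} (hp : p < ternaryHeight r j) : flr r j p ⊆ space r :=
  fun _ hx => mem_space.2 ⟨j, p, hp, hx⟩

omit hr in
lemma measurableSet_space : MeasurableSet (space r) :=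
  MeasurableSet.iUnion fun _ => MeasurableSet.iUnion fun _ => MeasurableSet.iUnion fun _ =>
    measurableSet_Ico

/-- The translation from the floor number `p` of stage `j` to the next one. -/
noncomputable def shift (r : ℕ → ℕ) (j p : ℕ) : ℝ := pos r j (p + 1) - pos r j p

/-- `y` is the next point of the orbit of `x`. -/
def Next (r : ℕ → ℕ) (x y : ℝ) : Prop :=
  ∃ j p, p + 1 < ternaryHeight r j ∧ x ∈ flr r j p ∧ y = x + shift r j p

omit hr in
lemma add_shift_mem {j p : ℕ} {x : ℝ} (hx : x ∈ flr r j p) :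
    x + shift r j p ∈ flr r j (p + 1) := by
  obtain ⟨h1, h2⟩ := hx
  unfold flr shift
  constructor <;> linarith

/-- Refinement shifts two consecutive floors of a column by the same amount, so the translation does
not depend on the stage. Two descriptions of a step can thus be compared at a common stage. -/
lemma next_lift {j p : ℕ} {x : ℝ} (hp : p + 1 < ternaryHeight r j) (hx : x ∈ flr r j p) {J : ℕ}
    (hJ : j ≤ J) :
    ∃ q, q + 1 < ternaryHeight r J ∧ x ∈ flr r J q ∧ shift r J q = shift r j p := by
  induction J, hJ using Nat.le_induction with
  | base => exact ⟨p, hp, hx, rfl⟩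
  | succ J _ ih =>
    obtain ⟨q, hq, hxq, hs⟩ := ih
    obtain ⟨i, hi, hxi⟩ := exists_mem_flr_column hr J (Nat.lt_of_succ_lt hq) hxq
    refine ⟨_, ?_, hxi, ?_⟩
    · have := (isTernaryGrowth_ternaryHeight hr).offset_add_lt hi
        (show q + 1 < 2 * ternaryHeight r J by omega)
      omega
    · rw [← hs]
      unfold shift
      rw [add_assoc, pos_column hr J i hq, pos_column hr J i (Nat.lt_of_succ_lt hq)]
      ring

lemma Next.unique {x y y' : ℝ} (h : Next r x y) (h' : Next r x y') : y = y' := by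
  obtain ⟨j, p, hp, hx, rfl⟩ := h
  obtain ⟨j', p', hp', hx', rfl⟩ := h'
  obtain ⟨q, hq, hxq, hs⟩ := next_lift hr hp hx (le_max_left j j')
  obtain ⟨q', hq', hxq', hs'⟩ := next_lift hr hp' hx' (le_max_right j j')
  have := flr_unique hr _ (Nat.lt_of_succ_lt hq) (Nat.lt_of_succ_lt hq') hxq hxq'
  rw [← hs, ← hs', this]

lemma Next.injective {x x' y : ℝ} (h : Next r x y) (h' : Next r x' y) : x = x' := by
  obtain ⟨j, p, hp, hx, rfl⟩ := h
  obtain ⟨j', p', hp', hx', he⟩ := h'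
  obtain ⟨q, hq, hxq, hs⟩ := next_lift hr hp hx (le_max_left j j')
  obtain ⟨q', hq', hxq', hs'⟩ := next_lift hr hp' hx' (le_max_right j j')
  rw [← hs, ← hs'] at he
  have h1 := add_shift_mem hxq
  have h2 := add_shift_mem hxq'
  rw [← he] at h2
  have := flr_unique hr _ hq hq' h1 h2
  have h3 : q = q' := by omega
  rw [h3] at he
  linarith

/-- Every column, the last one included, is followed by at least `h j` spacers, so even a top floor
has a successor at the next stage. -/
lemma exists_next {x : ℝ} (hx : x ∈ space r) : ∃ y ∈ space r, Next r x y := by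
  obtain ⟨j, p, hp, hxp⟩ := mem_space.1 hx
  obtain ⟨i, hi, hxi⟩ := exists_mem_flr_column hr j hp hxp
  have h1 := (isTernaryGrowth_ternaryHeight hr).offset_add_lt hi
    (show p + 1 < 2 * ternaryHeight r j by omega)
  exact ⟨_, flr_subset_space h1 (add_shift_mem hxi), j + 1, _, h1, hxi, rfl⟩

/-- Column `0` is the rightmost piece of the base, so all bases share the right endpoint `1`. -/
lemma pos_zero_add_width (j : ℕ) : pos r j 0 + width r j = 1 := by
  induction j with
  | zero => simp [pos, width]
  | succ j ih =>
    have h1 := pos_column hr j 0 (height_pos hr j)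
    simp only [pow_zero, Nat.sub_self, mul_zero, add_zero, Nat.cast_zero, sub_zero] at h1
    rw [h1]
    linear_combination ih - width_eq hr j

/-- A point without predecessor would lie in the base of every later stage. These bases shrink to
their common right endpoint, which half-open intervals exclude. -/
lemma exists_prev {y : ℝ} (hy : y ∈ space r) : ∃ x ∈ space r, Next r x y := by
  have key : ∀ j p, p + 1 < ternaryHeight r j → y ∈ flr r j (p + 1) → ∃ x ∈ space r, Next r x y := by
    intro j p hp hyp
    have h1 : y - shift r j p ∈ flr r j p := by
      obtain ⟨h1, h2⟩ := hyp
      unfold flr shift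
      constructor <;> linarith
    exact ⟨_, flr_subset_space (Nat.lt_of_succ_lt hp) h1, j, p, hp, h1, by ring⟩
  by_contra hno
  obtain ⟨j, p, hp, hyp⟩ := mem_space.1 hy
  have hzero : ∀ J, j ≤ J → y ∈ flr r J 0 := by
    intro J hJ
    have hmem : ∃ q < ternaryHeight r J, y ∈ flr r J q := by
      induction J, hJ using Nat.le_induction with
      | base => exact ⟨p, hp, hyp⟩
      | succ J _ ih =>
        obtain ⟨q, hq, hyq⟩ := ih
        obtain ⟨i, hi, hyi⟩ := exists_mem_flr_column hr J hq hyq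
        exact ⟨_, (isTernaryGrowth_ternaryHeight hr).offset_add_lt hi (by omega), hyi⟩
    obtain ⟨q, hq, hyq⟩ := hmem
    rcases q with _ | q
    · exact hyq
    · exact absurd (key J q hq hyq) hno
  have hy1 : y < 1 := by
    have := (hzero j le_rfl).2
    rwa [pos_zero_add_width hr] at this
  obtain ⟨m, hm⟩ := exists_pow_lt_of_lt_one (sub_pos.2 hy1) (by norm_num : (1 / 2 : ℝ) < 1)
  have h1 := (hzero (max j m) (le_max_left _ _)).1
  have h2 := pos_zero_add_width hr (max j m)
  have h3 := width_le hr (max j m)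
  have h4 : ((1 : ℝ) / 2) ^ (max j m) ≤ (1 / 2) ^ m :=
    pow_le_pow_of_le_one (by norm_num) (by norm_num) (le_max_right _ _)
  linarith

end Ternary

lemma lebesgueOn_apply {X : Set ℝ} (hX : MeasurableSet X) (s : Set X) :
    lebesgueOn X s = volume (((↑) : X → ℝ) '' s) :=
  comap_subtype_coe_apply hX volume s

/-- A function that coincides with measurable functions on the sets of a countable measurable cover
is measurable. -/
lemma measurable_of_countable_cover {α β ι : Type*} [MeasurableSpace α] [MeasurableSpace β]
    [Countable ι] {A : ι → Set α} (hA : ∀ i, MeasurableSet (A i)) (hcov : ∀ x, ∃ i, x ∈ A i)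
    {f : α → β} {g : ι → α → β} (hg : ∀ i, Measurable (g i)) (hfg : ∀ i, ∀ x ∈ A i, f x = g i x) :
    Measurable f := by
  intro s hs
  have h : f ⁻¹' s = ⋃ i, A i ∩ g i ⁻¹' s := by
    ext x
    simp only [mem_preimage, mem_iUnion, mem_inter_iff]
    constructor
    · intro hx
      obtain ⟨i, hi⟩ := hcov x
      exact ⟨i, hi, by rwa [← hfg i x hi]⟩
    · rintro ⟨i, hi, hx⟩
      rwa [hfg i x hi]
  rw [h]
  exact MeasurableSet.iUnion fun i => (hA i).inter (hg i hs)

/-! ### The transformation as an automorphism of the measure space. -/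

namespace Ternary

variable {r : ℕ → ℕ} (hr : ∀ j, 2 ≤ r j)

/-- The next point of the orbit. -/
noncomputable def nextPoint (x : space r) : space r :=
  ⟨(exists_next hr x.2).choose, (exists_next hr x.2).choose_spec.1⟩

lemma next_nextPoint (x : space r) : Next r x (nextPoint hr x) :=
  (exists_next hr x.2).choose_spec.2

/-- The previous point of the orbit. -/
noncomputable def prevPoint (y : space r) : space r :=
  ⟨(exists_prev hr y.2).choose, (exists_prev hr y.2).choose_spec.1⟩

lemma next_prevPoint (y : space r) : Next r (prevPoint hr y) y :=
  (exists_prev hr y.2).choose_spec.2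

/-- The rank-one transformation as a permutation of the space. -/
noncomputable def transfEquiv : space r ≃ space r where
  toFun := nextPoint hr
  invFun := prevPoint hr
  left_inv x := Subtype.ext (Next.injective hr (next_prevPoint hr _) (next_nextPoint hr x))
  right_inv y := Subtype.ext (Next.unique hr (next_nextPoint hr _) (next_prevPoint hr y))

lemma transfEquiv_apply {j p : ℕ} (hp : p + 1 < ternaryHeight r j) {x : space r}
    (hx : (x : ℝ) ∈ flr r j p) : (transfEquiv hr x : ℝ) = x + shift r j p :=
  Next.unique hr (next_nextPoint hr x) ⟨j, p, hp, hx, rfl⟩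

lemma transfEquiv_symm_apply {j p : ℕ} (hp : p + 1 < ternaryHeight r j) {y : space r}
    (hy : (y : ℝ) ∈ flr r j (p + 1)) : ((transfEquiv hr).symm y : ℝ) = y - shift r j p := by
  refine Next.injective hr (next_prevPoint hr y) ⟨j, p, hp, ?_, by ring⟩
  obtain ⟨h1, h2⟩ := hy
  unfold flr shift
  constructor <;> linarith

lemma transfEquiv_mem_iff {j p : ℕ} (hp : p + 1 < ternaryHeight r j) (x : space r) :
    (transfEquiv hr x : ℝ) ∈ flr r j (p + 1) ↔ (x : ℝ) ∈ flr r j p := by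
  constructor
  · intro h
    have h1 := transfEquiv_symm_apply hr hp h
    rw [Equiv.symm_apply_apply] at h1
    rw [h1]
    obtain ⟨h2, h3⟩ := h
    unfold flr shift
    constructor <;> linarith
  · intro h
    rw [transfEquiv_apply hr hp h]
    exact add_shift_mem h

/-- Pairs `(j, p)` such that the floor `p` of stage `j` is not the last one. -/
abbrev Inner (r : ℕ → ℕ) : Type := {a : ℕ × ℕ // a.2 + 1 < ternaryHeight r a.1}

include hr

lemma exists_inner_mem (x : space r) :
    ∃ a : Inner r, x ∈ ((↑) : space r → ℝ) ⁻¹' flr r a.1.1 a.1.2 := by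
  obtain ⟨y, -, j, p, hp, hx, -⟩ := exists_next hr x.2
  exact ⟨⟨(j, p), hp⟩, hx⟩

lemma exists_inner_mem_succ (y : space r) :
    ∃ a : Inner r, y ∈ ((↑) : space r → ℝ) ⁻¹' flr r a.1.1 (a.1.2 + 1) := by
  obtain ⟨x, -, j, p, hp, hx, hy⟩ := exists_prev hr y.2
  refine ⟨⟨(j, p), hp⟩, ?_⟩
  rw [mem_preimage, hy]
  exact add_shift_mem hx

omit hr in
lemma measurableSet_flr (j p : ℕ) : MeasurableSet (((↑) : space r → ℝ) ⁻¹' flr r j p) :=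
  measurable_subtype_coe measurableSet_Ico

/-- The rank-one transformation. -/
noncomputable def transf : space r ≃ᵐ space r where
  toEquiv := transfEquiv hr
  measurable_toFun := by
    refine (MeasurableEmbedding.subtype_coe measurableSet_space).measurable_comp_iff.1 ?_
    exact measurable_of_countable_cover (fun a : Inner r => measurableSet_flr a.1.1 a.1.2)
      (exists_inner_mem hr) (g := fun a x => (x : ℝ) + shift r a.1.1 a.1.2)
      (fun a => measurable_subtype_coe.add_const _) fun a x hx => transfEquiv_apply hr a.2 hx
  measurable_invFun := by
    refine (MeasurableEmbedding.subtype_coe measurableSet_space).measurable_comp_iff.1 ?_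
    exact measurable_of_countable_cover (fun a : Inner r => measurableSet_flr a.1.1 (a.1.2 + 1))
      (exists_inner_mem_succ hr) (g := fun a x => (x : ℝ) - shift r a.1.1 a.1.2)
      (fun a => measurable_subtype_coe.sub_const _) fun a x hx => transfEquiv_symm_apply hr a.2 hx

lemma measurePreserving_transf :
    MeasurePreserving (transf hr) (lebesgueOn (space r)) (lebesgueOn (space r)) := by
  refine ⟨(transf hr).measurable, ?_⟩
  -- The images of the non-top floors form a countable cover, and over each of them the map is a
  -- translation.
  rw [Measure.ext_iff_of_iUnion_eq_univ (ι := Inner r)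
    (s := fun a => ((↑) : space r → ℝ) ⁻¹' flr r a.1.1 (a.1.2 + 1))
    (eq_univ_of_forall fun y => mem_iUnion.2 (exists_inner_mem_succ hr y))]
  rintro ⟨⟨j, p⟩, hp⟩
  ext s hs
  simp only
  have hm := hs.inter (measurableSet_flr (r := r) j (p + 1))
  rw [Measure.restrict_apply hs, Measure.restrict_apply hs, Measure.map_apply
    (transf hr).measurable hm, lebesgueOn_apply measurableSet_space,
    lebesgueOn_apply measurableSet_space]
  rw [← measure_preimage_add_right volume (shift r j p)
    (((↑) : space r → ℝ) '' (s ∩ ((↑) : space r → ℝ) ⁻¹' flr r j (p + 1)))]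
  congr 1
  ext t
  simp only [mem_image, mem_preimage, mem_inter_iff]
  constructor
  · rintro ⟨x, ⟨h1, h2⟩, rfl⟩
    exact ⟨transf hr x, ⟨h1, h2⟩, transfEquiv_apply hr hp ((transfEquiv_mem_iff hr hp x).1 h2)⟩
  · rintro ⟨y, ⟨h1, h2⟩, h3⟩
    refine ⟨(transf hr).symm y, ?_, ?_⟩
    · rw [(transf hr).apply_symm_apply]
      exact ⟨h1, h2⟩
    · have := transfEquiv_symm_apply hr hp h2
      change ((transfEquiv hr).symm y : ℝ) = t
      rw [this, h3, add_sub_cancel_right]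

lemma transf_iterate_image {j k : ℕ} (hk : k < ternaryHeight r j) :
    (transf hr)^[k] '' (((↑) : space r → ℝ) ⁻¹' flr r j 0) =
      ((↑) : space r → ℝ) ⁻¹' flr r j k := by
  induction k with
  | zero => simp
  | succ k ih =>
    rw [Function.iterate_succ', image_comp, ih (Nat.lt_of_succ_lt hk)]
    ext y
    constructor
    · rintro ⟨x, hx, rfl⟩
      exact (transfEquiv_mem_iff hr hk x).2 hx
    · intro hy
      refine ⟨(transf hr).symm y, ?_, (transf hr).apply_symm_apply y⟩
      refine (transfEquiv_mem_iff hr hk _).1 ?_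
      rw [show transfEquiv hr ((transf hr).symm y) = y from (transf hr).apply_symm_apply y]
      exact hy

/-- The rank-one construction with spacers growing geometrically. -/
noncomputable def construction : RankOneConstruction (ternaryParams r hr) where
  X := space r
  T := transf hr
  E j := ((↑) : space r → ℝ) ⁻¹' flr r j 0
  width := width r
  width_pos := width_pos hr
  measurePreserving := measurePreserving_transf hr
  floor_eq j k hk := by
    rw [ternaryParams_height] at hk
    refine ⟨pos r j k, ?_⟩
    rw [transf_iterate_image hr hk, Subtype.image_preimage_coe]
    exact inter_eq_right.2 (flr_subset_space hk)
  floor_disjoint j k hk l hl hkl := by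
    rw [ternaryParams_height] at hk hl
    rw [transf_iterate_image hr hk, transf_iterate_image hr hl]
    exact (flr_disjoint hr j hk hl hkl).preimage _
  floor_translation j k hk := by
    rw [ternaryParams_height] at hk
    refine ⟨shift r j k, fun x hx => ?_⟩
    rw [transf_iterate_image hr (Nat.lt_of_succ_lt hk)] at hx
    exact transfEquiv_apply hr hk hx
  base_cut j := by
    have h0 := height_pos hr j
    have h1 : ∀ i < r j, (transf hr)^[(ternaryParams r hr).offset j i] ''
        (((↑) : space r → ℝ) ⁻¹' flr r (j + 1) 0) =
        ((↑) : space r → ℝ) ⁻¹' flr r (j + 1) (ternaryHeight r j * (3 ^ i - 1) + 0) := by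
      intro i hi
      rw [ternaryParams_offset]
      exact transf_iterate_image hr ((isTernaryGrowth_ternaryHeight hr).offset_add_lt (k := 0) hi
        (by omega))
    ext x
    simp only [mem_iUnion]
    constructor
    · intro hx
      obtain ⟨i, hi, hxi⟩ := exists_mem_flr_column hr j h0 hx
      exact ⟨i, hi, by rw [h1 i hi]; exact hxi⟩
    · rintro ⟨i, hi, hx⟩
      rw [h1 i hi] at hx
      exact flr_column_subset hr j hi h0 hx
  exhaust := by
    refine eq_univ_of_forall fun x => ?_
    obtain ⟨j, p, hp, hx⟩ := mem_space.1 x.2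
    refine mem_iUnion.2 ⟨j, mem_iUnion₂.2 ⟨p, by rwa [ternaryParams_height], ?_⟩⟩
    rw [transf_iterate_image hr hp]
    exact hx

end Ternary

/-! ### Return times and the Sidon property. -/

namespace Ternary

section Returns

variable {r : ℕ → ℕ} {hr : ∀ j, 2 ≤ r j} (R : RankOneConstruction (ternaryParams r hr))

lemma floor_cut (j k : ℕ) : R.T^[k] '' R.E j =
    ⋃ i < r j, R.T^[ternaryHeight r j * (3 ^ i - 1) + k] '' R.E (j + 1) := by
  have h : R.E j = ⋃ i < r j, R.T^[ternaryHeight r j * (3 ^ i - 1)] '' R.E (j + 1) := by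
    rw [R.base_cut j]
    simp only [ternaryParams_offset]
    rfl
  rw [h]
  simp only [image_iUnion, ← image_comp, ← Function.iterate_add, add_comm k]

lemma exists_mem_floor_succ {j k : ℕ} {x : R.X} (hx : x ∈ R.T^[k] '' R.E j) :
    ∃ i < r j, x ∈ R.T^[ternaryHeight r j * (3 ^ i - 1) + k] '' R.E (j + 1) := by
  rw [floor_cut R] at hx
  simpa only [mem_iUnion, exists_prop] using hx

lemma floor_index_unique {j p q : ℕ} (hp : p < ternaryHeight r j) (hq : q < ternaryHeight r j)
    {x : R.X} (hx : x ∈ R.T^[p] '' R.E j) (hx' : x ∈ R.T^[q] '' R.E j) : p = q := by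
  by_contra h
  rw [← ternaryParams_height r hr] at hp hq
  exact Set.disjoint_left.1 (R.floor_disjoint j p hp q hq h) hx hx'

lemma mem_tower {j : ℕ} {x : R.X} :
    x ∈ R.tower j ↔ ∃ k < ternaryHeight r j, x ∈ R.T^[k] '' R.E j := by
  rw [RankOneConstruction.tower, ternaryParams_height]
  simp only [mem_iUnion, exists_prop]

lemma iterate_mem_floor {j p m : ℕ} {x : R.X} (hx : x ∈ R.T^[p] '' R.E j) :
    R.T^[m] x ∈ R.T^[p + m] '' R.E j := by
  rw [add_comm, Function.iterate_add, image_comp]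
  exact mem_image_of_mem _ hx

/-- A return to the tower of stage `j` after at most `h (j + 1)` steps is a passage between two
columns in the tower of stage `j + 1`. -/
lemma exists_return {j m k k' : ℕ} {x : R.X} (hm : m ≤ ternaryHeight r (j + 1))
    (hk : k < ternaryHeight r j) (hx : x ∈ R.T^[k] '' R.E j)
    (hk' : k' < ternaryHeight r j) (hx' : R.T^[m] x ∈ R.T^[k'] '' R.E j) :
    ∃ i < r j, ∃ i' < r j,
      R.T^[m] x ∈ R.T^[ternaryHeight r j * (3 ^ i' - 1) + k'] '' R.E (j + 1) ∧
      ternaryHeight r j * (3 ^ i' - 1) + k' = ternaryHeight r j * (3 ^ i - 1) + k + m := by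
  have H := isTernaryGrowth_ternaryHeight hr
  obtain ⟨i, hi, hxi⟩ := exists_mem_floor_succ R hx
  obtain ⟨i', hi', hxi'⟩ := exists_mem_floor_succ R hx'
  refine ⟨i, hi, i', hi', hxi', ?_⟩
  have hp := H.offset_add_lt (k := k) hi (by omega)
  have hp' := H.offset_add_lt (k := k') hi' (by omega)
  generalize ternaryHeight r j * (3 ^ i - 1) + k = p at *
  generalize ternaryHeight r j * (3 ^ i' - 1) + k' = p' at *
  -- The passage may leave the tower of stage `j + 1`, but it stays inside that of stage `j + 2`,
  -- because at least `h (j + 1)` floors follow each column there.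
  obtain ⟨l, hl, hxl⟩ := exists_mem_floor_succ R hxi
  obtain ⟨l', hl', hxl'⟩ := exists_mem_floor_succ R hxi'
  have h1 := iterate_mem_floor R (m := m) hxl
  have h2 : ternaryHeight r (j + 1) * (3 ^ l - 1) + (p + m) < ternaryHeight r (j + 2) :=
    H.offset_add_lt hl (by omega)
  have h3 := floor_index_unique R (by rwa [add_assoc]) (H.offset_add_lt hl' (by omega)) h1 hxl'
  have e1 : 1 ≤ 3 ^ l := Nat.one_le_pow' l 2
  have e2 : 1 ≤ 3 ^ l' := Nat.one_le_pow' l' 2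
  obtain ⟨d, hd⟩ := even_powDiff (l', l)
  have hz : (ternaryHeight r (j + 1) : ℤ) * (d + d) = p + m - p' := by
    rw [← hd, powDiff]
    zify [e1, e2] at h3
    linarith
  -- Here `p + m - p'` lies strictly between `-h (j + 1)` and `2 * h (j + 1)`, and it is an even
  -- multiple of `h (j + 1)`; so it vanishes and both points are in the same column of stage `j +
  -- 1`.
  have hd0 : d = 0 := by
    zify at hp hp' hm
    rcases lt_trichotomy d 0 with h | h | h
    · nlinarith
    · exact h
    · nlinarith
  rw [hd0] at hz
  omega

/-- A return at time `m` from column `i` to column `i'` puts `m` within `h j` of `h j * (3 ^ i' - 3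
^ i)`. These windows are disjoint, so all such returns land in the same column. -/
lemma isSidon : R.IsSidon := by
  have H := isTernaryGrowth_ternaryHeight hr
  intro j m hm hm'
  rw [ternaryParams_height] at hm hm'
  have key : ∀ y ∈ (R.T^[m] '' R.tower j) ∩ R.tower j, ∃ i < r j, ∃ i' < r j,
      y ∈ R.column j i' ∧
        |(m : ℤ) - ternaryHeight r j * powDiff (i', i)| < ternaryHeight r j := by
    rintro _ ⟨⟨x, hx, rfl⟩, hy⟩
    obtain ⟨k, hk, hx⟩ := (mem_tower R).1 hx
    obtain ⟨k', hk', hy⟩ := (mem_tower R).1 hy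
    obtain ⟨i, hi, i', hi', hyi, he⟩ := exists_return R hm' hk hx hk' hy
    refine ⟨i, hi, i', hi', ?_, ?_⟩
    · simp only [RankOneConstruction.column, mem_iUnion, ← image_comp, ← Function.iterate_add,
        ternaryParams_height, ternaryParams_offset]
      exact ⟨k', hk', by rwa [add_comm k']⟩
    · have e1 : 1 ≤ 3 ^ i := Nat.one_le_pow' i 2
      have e2 : 1 ≤ 3 ^ i' := Nat.one_le_pow' i' 2
      have : (m : ℤ) - ternaryHeight r j * powDiff (i', i) = k' - k := by
        rw [powDiff]
        zify [e1, e2] at he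
        linarith
      rw [this, abs_lt]
      omega
  rcases ((R.T^[m] '' R.tower j) ∩ R.tower j).eq_empty_or_nonempty with h0 | ⟨y₀, hy₀⟩
  · exact ⟨0, by have := hr j; exact (show 0 < r j by omega), by simp [h0]⟩
  · obtain ⟨i₀, hi₀, i₀', hi₀', -, h₀⟩ := key y₀ hy₀
    refine ⟨i₀', hi₀', fun y hy => ?_⟩
    obtain ⟨i, hi, i', hi', hc, h⟩ := key y hy
    -- A return within one column would force `m < h j`.
    have hne : i₀' ≠ i₀ := by
      rintro rfl
      rw [powDiff, sub_self, mul_zero, sub_zero, abs_lt] at h₀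
      omega
    have := powDiff_injective (p := (i₀', i₀)) (q := (i', i)) hne
      (eq_of_abs_sub_mul_lt (even_powDiff _) (even_powDiff _) h₀ h)
    rwa [show i₀' = i' from (Prod.ext_iff.1 this).1]

/-- Return times from a base to itself up to `h (j + 1)` are even multiples of `h j`, hence at least
`2 * h j` when positive. -/
lemma not_return {j m : ℕ} (h0 : 0 < m) (hm : m < 2 * ternaryHeight r j) {x : R.X}
    (hx : x ∈ R.E j) : R.T^[m] x ∉ R.E j := by
  have H := isTernaryGrowth_ternaryHeight hr
  intro hx'
  have hm' : m ≤ ternaryHeight r (j + 1) := by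
    have := H.two_mul_le_succ j
    omega
  obtain ⟨i, -, i', -, -, he⟩ := exists_return R (k := 0) (k' := 0) hm' (height_pos hr j)
    (by simpa using hx) (height_pos hr j) (by simpa using hx')
  have e1 : 1 ≤ 3 ^ i := Nat.one_le_pow' i 2
  have e2 : 1 ≤ 3 ^ i' := Nat.one_le_pow' i' 2
  obtain ⟨d, hd⟩ := even_powDiff (i', i)
  have : (ternaryHeight r j : ℤ) * (d + d) = m := by
    rw [← hd, powDiff]
    zify [e1, e2] at he
    linarith
  have hp := height_pos hr j
  zify at hp hm h0
  have h1 : 0 < d := by by_contra h; push Not at h; nlinarith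
  nlinarith

end Returns

/-! ### The measure of the space -/

section Volume

variable {r : ℕ → ℕ} (hr : ∀ j, 2 ≤ r j)
include hr

/-- Since `3 ^ r - 1 ≥ 2 * r`, the measure of the tower at least doubles at every stage; hence the
space has infinite measure. -/
lemma two_pow_le_height_mul_width (j : ℕ) : (2 : ℝ) ^ j ≤ ternaryHeight r j * width r j := by
  induction j with
  | zero => simp [ternaryHeight, width]
  | succ j ih =>
    have h1 : 2 * r j ≤ 3 ^ r j - 1 := by
      have : ∀ m, 2 * m + 1 ≤ 3 ^ m := by
        intro m
        induction m with
        | zero => simp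
        | succ m ih => rw [pow_succ]; omega
      have := this (r j)
      omega
    have h2 : (2 : ℝ) * r j ≤ ((3 ^ r j - 1 : ℕ) : ℝ) := by exact_mod_cast h1
    have h3 := width_eq hr j
    have h4 := (width_pos hr (j + 1)).le
    calc (2 : ℝ) ^ (j + 1) = 2 * 2 ^ j := by ring
      _ ≤ 2 * (ternaryHeight r j * width r j) := by gcongr
      _ = ternaryHeight r j * (2 * r j) * width r (j + 1) := by rw [h3]; ring
      _ ≤ ternaryHeight r j * ((3 ^ r j - 1 : ℕ) : ℝ) * width r (j + 1) := by gcongr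
      _ = _ := by rw [ternaryHeight]; push_cast; ring

lemma volume_space : volume (space r) = ⊤ := by
  refine ENNReal.eq_top_of_forall_nnreal_le fun c => ?_
  obtain ⟨j, hj⟩ := pow_unbounded_of_one_lt (c : ℝ) one_lt_two
  have h1 : volume (⋃ k ∈ Finset.range (ternaryHeight r j), flr r j k) =
      ENNReal.ofReal (ternaryHeight r j * width r j) := by
    rw [measure_biUnion_finset]
    · simp [flr, ENNReal.ofReal_mul]
    · intro k hk l hl hkl
      exact flr_disjoint hr j (Finset.mem_range.1 hk) (Finset.mem_range.1 hl) hkl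
    · exact fun _ _ => measurableSet_Ico
  calc (c : ENNReal) = ENNReal.ofReal c := by simp
    _ ≤ ENNReal.ofReal (ternaryHeight r j * width r j) :=
      ENNReal.ofReal_le_ofReal (hj.le.trans (two_pow_le_height_mul_width hr j))
    _ ≤ volume (space r) := by
      rw [← h1]
      exact measure_mono (iUnion₂_subset fun k hk => flr_subset_space (Finset.mem_range.1 hk))

end Volume

end Ternary

/-! ### Koopman operators and indicators -/

section Koopman

variable {α : Type} [MeasurableSpace α] {μ : Measure α}

lemma indicatorConstLp_biUnion {ι : Type*} (S : Finset ι) {A : ι → Set α}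
    (hA : ∀ i, MeasurableSet (A i)) (hμ : ∀ i, μ (A i) ≠ ⊤)
    (hd : (S : Set ι).PairwiseDisjoint A) {B : Set α} (hB : MeasurableSet B) (hμB : μ B ≠ ⊤)
    (h : B = ⋃ i ∈ S, A i) :
    indicatorConstLp 2 hB hμB (1 : ℂ) = ∑ i ∈ S, indicatorConstLp 2 (hA i) (hμ i) (1 : ℂ) := by
  classical
  induction S using Finset.induction_on generalizing B with
  | empty =>
    have : B = ∅ := by simpa using h
    subst this
    rw [Finset.sum_empty, indicatorConstLp_empty]
  | insert a S ha ih =>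
    have hS : MeasurableSet (⋃ i ∈ S, A i) := S.measurableSet_biUnion fun i _ => hA i
    have hμS : μ (⋃ i ∈ S, A i) ≠ ⊤ := by
      refine ne_top_of_le_ne_top hμB (measure_mono ?_)
      rw [h, Finset.set_biUnion_insert]
      exact subset_union_right
    have hdis : Disjoint (A a) (⋃ i ∈ S, A i) := by
      rw [disjoint_iUnion₂_right]
      intro i hi
      exact hd (by simp) (by simp [hi]) (by rintro rfl; exact ha hi)
    rw [Finset.sum_insert ha, ← ih (hd.subset (by simp)) hS hμS rfl,
      ← indicatorConstLp_disjoint_union (hA a) hS (hμ a) hμS hdis]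
    subst h
    congr 1
    exact Finset.set_biUnion_insert a S A

variable {T : α ≃ᵐ α} (hT : MeasurePreserving T μ μ)

/-- The indicator of a set of finite measure as a vector of the space of the Koopman operator. -/
noncomputable def koopmanIndicator {s : Set α} (hs : MeasurableSet s) (hμ : μ s ≠ ⊤) :
    (koopman T hT).space :=
  (indicatorConstLp 2 hs hμ (1 : ℂ) : Lp ℂ 2 μ)

lemma koopman_pow_indicator (a : ℕ) {s t : Set α} (hs : MeasurableSet s) (hμs : μ s ≠ ⊤)
    (ht : MeasurableSet t) (hμt : μ t ≠ ⊤) (h : s = T^[a] ⁻¹' t) :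
    ((koopman T hT).op ^ a) (koopmanIndicator hT ht hμt) = koopmanIndicator hT hs hμs := by
  induction a generalizing s with
  | zero => subst h; rfl
  | succ a ih =>
    have hm : MeasurableSet (T^[a] ⁻¹' t) := T.measurable.iterate a ht
    have hμ : μ (T^[a] ⁻¹' t) ≠ ⊤ := by
      rwa [(hT.iterate a).measure_preimage ht.nullMeasurableSet]
    have h1 := ih hm hμ rfl
    rw [pow_succ']
    change (koopman T hT).op (((koopman T hT).op ^ a) (koopmanIndicator hT ht hμt)) = _
    rw [h1]
    subst h
    rfl

lemma measurableSet_iterate_image (T : α ≃ᵐ α) (a : ℕ) {s : Set α} (hs : MeasurableSet s) :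
    MeasurableSet (T^[a] '' s) := by
  rw [image_eq_preimage_of_inverse (g := T.symm^[a])
    (Function.LeftInverse.iterate T.symm_apply_apply a)
    (Function.LeftInverse.iterate T.apply_symm_apply a)]
  exact T.symm.measurable.iterate a hs

lemma preimage_iterate_image (T : α ≃ᵐ α) (a : ℕ) (s : Set α) : T^[a] ⁻¹' (T^[a] '' s) = s :=
  preimage_image_eq _ (T.injective.iterate a)

include hT in
lemma measure_iterate_image (a : ℕ) {s : Set α} (hs : MeasurableSet s) :
    μ (T^[a] '' s) = μ s := by
  rw [← (hT.iterate a).measure_preimage (measurableSet_iterate_image T a hs).nullMeasurableSet,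
    preimage_iterate_image]

/-- The operator is `f ↦ f ∘ T` and pulls sets back, so it is the negative powers that move
indicators forward along the tower. -/
lemma koopman_zpow_neg_indicator (a : ℕ) {s t : Set α} (hs : MeasurableSet s) (hμs : μ s ≠ ⊤)
    (ht : MeasurableSet t) (hμt : μ t ≠ ⊤) (h : t = T^[a] '' s) :
    ((koopman T hT).op ^ (-(a : ℤ))) (koopmanIndicator hT hs hμs) = koopmanIndicator hT ht hμt := by
  rw [← koopman_pow_indicator hT a hs hμs ht hμt (by rw [h, preimage_iterate_image]),
    ← zpow_natCast, zpow_apply_zpow_apply]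
  simp

end Koopman

/-! ### The floors determine the measurable structure. -/

namespace Ternary

variable {r : ℕ → ℕ} (hr : ∀ j, 2 ≤ r j)
include hr

lemma exists_flr_subset {j p : ℕ} (hp : p < ternaryHeight r j) {x : ℝ} (hx : x ∈ flr r j p)
    {J : ℕ} (hJ : j ≤ J) : ∃ q < ternaryHeight r J, x ∈ flr r J q ∧ flr r J q ⊆ flr r j p := by
  induction J, hJ using Nat.le_induction with
  | base => exact ⟨p, hp, hx, subset_rfl⟩
  | succ J _ ih =>
    obtain ⟨q, hq, hxq, hs⟩ := ih
    obtain ⟨i, hi, hxi⟩ := exists_mem_flr_column hr J hq hxq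
    exact ⟨_, (isTernaryGrowth_ternaryHeight hr).offset_add_lt hi (by omega), hxi,
      (flr_column_subset hr J hi hq).trans hs⟩

/-- Floors of different stages are nested or disjoint, which makes them a π-system. -/
lemma flr_subset_flr {j J p q : ℕ} (hJ : j ≤ J) (hp : p < ternaryHeight r j)
    (hq : q < ternaryHeight r J) {x : ℝ} (hx : x ∈ flr r j p) (hx' : x ∈ flr r J q) :
    flr r J q ⊆ flr r j p := by
  obtain ⟨q', hq', hxq', hs⟩ := exists_flr_subset hr hp hx hJ
  rwa [flr_unique hr J hq hq' hx' hxq']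

omit hr in
variable (r) in
/-- The floors of all stages. -/
def floors : Set (Set (space r)) :=
  {s | ∃ j, ∃ p < ternaryHeight r j, s = ((↑) : space r → ℝ) ⁻¹' flr r j p}

lemma isPiSystem_floors : IsPiSystem (floors r) := by
  rintro _ ⟨j, p, hp, rfl⟩ _ ⟨J, q, hq, rfl⟩ ⟨x, hx, hx'⟩
  rcases le_total j J with h | h
  · rw [inter_eq_right.2 (preimage_mono (flr_subset_flr hr h hp hq hx hx'))]
    exact ⟨J, q, hq, rfl⟩
  · rw [inter_eq_left.2 (preimage_mono (flr_subset_flr hr h hq hp hx' hx))]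
    exact ⟨j, p, hp, rfl⟩

/-- Widths tend to zero, so an open set is the countable union of the floors it contains. -/
lemma measurableSpace_eq_generateFrom_floors :
    (inferInstance : MeasurableSpace (space r)) = MeasurableSpace.generateFrom (floors r) := by
  refine le_antisymm ?_ (MeasurableSpace.generateFrom_le ?_)
  · rw [BorelSpace.measurable_eq (α := space r)]
    refine MeasurableSpace.generateFrom_le fun U (hU : IsOpen U) => ?_
    have : U = ⋃ a : {a : ℕ × ℕ // a.2 < ternaryHeight r a.1 ∧
        ((↑) : space r → ℝ) ⁻¹' flr r a.1 a.2 ⊆ U}, ((↑) : space r → ℝ) ⁻¹' flr r a.1.1 a.1.2 := by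
      refine subset_antisymm (fun x hx => ?_) (iUnion_subset fun a => a.2.2)
      obtain ⟨ε, hε, hb⟩ := Metric.isOpen_iff.1 hU x hx
      obtain ⟨j, p, hp, hxp⟩ := mem_space.1 x.2
      obtain ⟨m, hm⟩ := exists_pow_lt_of_lt_one hε (by norm_num : (1 / 2 : ℝ) < 1)
      obtain ⟨q, hq, hxq, -⟩ := exists_flr_subset hr hp hxp (le_max_left j m)
      have hw : width r (max j m) < ε := (width_le hr _).trans_lt
        ((pow_le_pow_of_le_one (by norm_num) (by norm_num) (le_max_right j m)).trans_lt hm)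
      refine mem_iUnion.2 ⟨⟨(max j m, q), hq, fun y hy => hb ?_⟩, hxq⟩
      rw [Metric.mem_ball, Subtype.dist_eq, Real.dist_eq, abs_lt]
      obtain ⟨h1, h2⟩ := hxq
      obtain ⟨h3, h4⟩ := hy
      constructor <;> linarith
    rw [this]
    exact MeasurableSet.iUnion fun a => MeasurableSpace.measurableSet_generateFrom
      ⟨a.1.1, a.1.2, a.2.1, rfl⟩
  · rintro _ ⟨j, p, -, rfl⟩
    exact measurableSet_flr j p

omit hr in
lemma lebesgueOn_flr {j p : ℕ} (hp : p < ternaryHeight r j) :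
    lebesgueOn (space r) (((↑) : space r → ℝ) ⁻¹' flr r j p) = ENNReal.ofReal (width r j) := by
  rw [lebesgueOn_apply measurableSet_space, Subtype.image_preimage_coe,
    inter_eq_right.2 (flr_subset_space hp), flr, Real.volume_Ico, add_sub_cancel_left]

/-- A π-λ argument inside one floor at a time: there the function is integrable, and intersections
with other floors are empty or floors. -/
lemma ae_eq_zero_of_setIntegral_flr {g : space r → ℂ}
    (hi : ∀ j, ∀ p < ternaryHeight r j,
      IntegrableOn g (((↑) : space r → ℝ) ⁻¹' flr r j p) (lebesgueOn (space r)))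
    (h0 : ∀ j, ∀ p < ternaryHeight r j,
      ∫ x in ((↑) : space r → ℝ) ⁻¹' flr r j p, g x ∂lebesgueOn (space r) = 0) :
    g =ᵐ[lebesgueOn (space r)] 0 := by
  have key : ∀ a : {a : ℕ × ℕ // a.2 < ternaryHeight r a.1},
      g =ᵐ[(lebesgueOn (space r)).restrict (((↑) : space r → ℝ) ⁻¹' flr r a.1.1 a.1.2)] 0 := by
    rintro ⟨⟨j, p⟩, hp⟩
    have hg := hi j p hp
    refine Integrable.ae_eq_zero_of_forall_setIntegral_eq_zero hg fun s hs _ => ?_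
    induction s, hs using MeasurableSpace.induction_on_inter
      (measurableSpace_eq_generateFrom_floors hr) (isPiSystem_floors hr) with
    | empty => simp
    | basic t ht =>
      obtain ⟨J, q, hq, rfl⟩ := ht
      rw [Measure.restrict_restrict (measurableSet_flr J q)]
      rcases (((↑) : space r → ℝ) ⁻¹' flr r J q ∩
        ((↑) : space r → ℝ) ⁻¹' flr r j p).eq_empty_or_nonempty with h | h
      · rw [h]; simp
      · obtain ⟨J', q', hq', h'⟩ := isPiSystem_floors hr _ ⟨J, q, hq, rfl⟩ _ ⟨j, p, hp, rfl⟩ h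
        rw [h']
        exact h0 J' q' hq'
    | compl t ht ih =>
      have := integral_add_compl ht hg
      rw [ih, zero_add] at this
      · rw [this]; exact h0 j p hp
      · exact measure_lt_top_of_subset (subset_univ _) (by
          rw [Measure.restrict_apply_univ, lebesgueOn_flr hp]; exact ENNReal.ofReal_ne_top)
    | iUnion f hd hf ih =>
      rw [integral_iUnion hf hd hg.integrableOn]
      refine (tsum_congr fun n => ih n ?_).trans tsum_zero
      exact measure_lt_top_of_subset (subset_univ _) (by
          rw [Measure.restrict_apply_univ, lebesgueOn_flr hp]; exact ENNReal.ofReal_ne_top)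
  have := (ae_restrict_iUnion_iff
    (fun a : {a : ℕ × ℕ // a.2 < ternaryHeight r a.1} =>
      ((↑) : space r → ℝ) ⁻¹' flr r a.1.1 a.1.2) (fun x => g x = 0)
      (μ := lebesgueOn (space r))).2 key
  rwa [eq_univ_of_forall (s := ⋃ a : {a : ℕ × ℕ // a.2 < ternaryHeight r a.1},
      ((↑) : space r → ℝ) ⁻¹' flr r a.1.1 a.1.2), Measure.restrict_univ] at this
  intro x
  obtain ⟨j, p, hp, hx⟩ := mem_space.1 x.2
  exact mem_iUnion.2 ⟨⟨(j, p), hp⟩, hx⟩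

end Ternary

/-! ### The normalized base indicators as a rank-one sequence. -/

namespace Ternary

variable {r : ℕ → ℕ} (hr : ∀ j, 2 ≤ r j)

lemma measure_iterate_base (j a : ℕ) : lebesgueOn (space r)
    ((transf hr)^[a] '' (((↑) : space r → ℝ) ⁻¹' flr r j 0)) = ENNReal.ofReal (width r j) := by
  rw [measure_iterate_image (measurePreserving_transf hr) a (measurableSet_flr j 0),
    lebesgueOn_flr (height_pos hr j)]

lemma measurableSet_iterate_base (j a : ℕ) :
    MeasurableSet ((transf hr)^[a] '' (((↑) : space r → ℝ) ⁻¹' flr r j 0)) :=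
  measurableSet_iterate_image (transf hr) a (measurableSet_flr j 0)

lemma measure_iterate_base_ne_top (j a : ℕ) : lebesgueOn (space r)
    ((transf hr)^[a] '' (((↑) : space r → ℝ) ⁻¹' flr r j 0)) ≠ ⊤ := by
  rw [measure_iterate_base]
  exact ENNReal.ofReal_ne_top

/-- The indicator of the `a`-th image of the base of stage `j`. -/
noncomputable def floorIndicator (j a : ℕ) : (construction hr).operator.space :=
  koopmanIndicator (measurePreserving_transf hr) (measurableSet_iterate_base hr j a)
    (measure_iterate_base_ne_top hr j a)

/-- The normalized indicator of the base of stage `j`. -/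
noncomputable def baseVector (j : ℕ) : (construction hr).operator.space :=
  ((Real.sqrt (width r j) : ℝ) : ℂ)⁻¹ • floorIndicator hr j 0

lemma zpow_neg_floorIndicator (j a : ℕ) :
    ((construction hr).operator.op ^ (-(a : ℤ))) (floorIndicator hr j 0) = floorIndicator hr j a :=
  koopman_zpow_neg_indicator (measurePreserving_transf hr) a _ _ _ _ (by simp)

lemma inner_floorIndicator (j a b : ℕ) :
    inner ℂ (floorIndicator hr j a) (floorIndicator hr j b) =
      (((lebesgueOn (space r)).real (((transf hr)^[a] '' (((↑) : space r → ℝ) ⁻¹' flr r j 0)) ∩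
        ((transf hr)^[b] '' (((↑) : space r → ℝ) ⁻¹' flr r j 0))) : ℝ) : ℂ) :=
  L2.inner_indicatorConstLp_one_indicatorConstLp_one (𝕜 := ℂ)
    (measurableSet_iterate_base hr j a) (measurableSet_iterate_base hr j b)
    (measure_iterate_base_ne_top hr j a) (measure_iterate_base_ne_top hr j b)

lemma norm_floorIndicator (j : ℕ) : ‖floorIndicator hr j 0‖ = Real.sqrt (width r j) := by
  have h := inner_floorIndicator hr j 0 0
  rw [inter_self, Measure.real, measure_iterate_base, ENNReal.toReal_ofReal (width_pos hr j).le,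
    inner_self_eq_norm_sq_to_K] at h
  rw [← Real.sqrt_sq (norm_nonneg (floorIndicator hr j 0))]
  congr 1
  exact Complex.ofReal_injective (by simpa using h)

lemma floorIndicator_cut (j : ℕ) : floorIndicator hr j 0 = ∑ i ∈ Finset.range (r j),
    floorIndicator hr (j + 1) (ternaryHeight r j * (3 ^ i - 1)) := by
  have H := isTernaryGrowth_ternaryHeight hr
  have h0 := height_pos hr j
  refine indicatorConstLp_biUnion (Finset.range (r j))
    (A := fun i => (transf hr)^[ternaryHeight r j * (3 ^ i - 1)] ''
      (((↑) : space r → ℝ) ⁻¹' flr r (j + 1) 0))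
    (fun i => measurableSet_iterate_base hr (j + 1) _)
    (fun i => measure_iterate_base_ne_top hr (j + 1) _) ?_
    (measurableSet_iterate_base hr j 0) (measure_iterate_base_ne_top hr j 0) ?_
  · intro i hi i' hi' hne
    have h1 := H.offset_add_lt (k := 0) (Finset.mem_range.1 hi) (by omega)
    have h := H.offset_add_lt (k := 0) (Finset.mem_range.1 hi') (by omega)
    refine (construction hr).floor_disjoint (j + 1) _ (by rwa [ternaryParams_height]) _
      (by rwa [ternaryParams_height]) fun he => hne ?_
    have he' := Nat.eq_of_mul_eq_mul_left h0 he
    have e1 : 1 ≤ 3 ^ i := Nat.one_le_pow' i 2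
    have e2 : 1 ≤ 3 ^ i' := Nat.one_le_pow' i' 2
    exact Nat.pow_right_injective (by norm_num) (show 3 ^ i = 3 ^ i' by omega)
  · have := floor_cut (construction hr) j 0
    simp only [add_zero] at this
    simp only [Finset.mem_range]
    exact this

/-- Inner products with indicators are integrals over floors; this yields totality of the orbits of
the base vectors. -/
lemma eq_zero_of_inner_floorIndicator (g : Lp ℂ 2 (lebesgueOn (space r)))
    (h : ∀ j k, inner ℂ (floorIndicator hr j k) (show (construction hr).operator.space from g) = 0) : g = 0 := by
  have h1 : ∀ j, ∀ p < ternaryHeight r j,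
      ∫ x in ((↑) : space r → ℝ) ⁻¹' flr r j p, g x ∂lebesgueOn (space r) = 0 := by
    intro j p hp
    rw [← transf_iterate_image hr hp]
    exact (L2.inner_indicatorConstLp_one (measurableSet_iterate_base hr j p)
      (measure_iterate_base_ne_top hr j p) g).symm.trans (h j p)
  refine (Lp.eq_zero_iff_ae_eq_zero (E := ℂ) (p := 2) (μ := lebesgueOn (space r))).2
    (ae_eq_zero_of_setIntegral_flr hr (fun j p hp => ?_) h1)
  refine integrableOn_Lp_of_measure_ne_top (E := ℂ) (p := 2) g one_le_two ?_
  rw [lebesgueOn_flr hp]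
  exact ENNReal.ofReal_ne_top

lemma isRankOneSequence :
    IsRankOneSequence (construction hr).operator (ternaryHeight r) r (baseVector hr) where
  norm_eq j := by
    have h := Real.sqrt_pos.2 (width_pos hr j)
    rw [baseVector, norm_smul, norm_floorIndicator, norm_inv, Complex.norm_real,
      Real.norm_of_nonneg h.le, inv_mul_cancel₀ h.ne']
  decomp j := by
    rw [baseVector, floorIndicator_cut, width_eq hr j, Real.sqrt_mul (Nat.cast_nonneg _),
      Complex.ofReal_mul, mul_inv, mul_smul, Finset.smul_sum]
    congr 1
    refine Finset.sum_congr rfl fun i _ => ?_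
    rw [baseVector, map_smul, ← zpow_neg_floorIndicator]
    have e1 : 1 ≤ 3 ^ i := Nat.one_le_pow' i 2
    push_cast [e1]
    rfl
  orth j m h0 hm := by
    have h : inner ℂ (floorIndicator hr j 0)
        (((construction hr).operator.op ^ m) (floorIndicator hr j 0)) = 0 := by
      -- Applying `U ^ (-m)` to both sides turns the correlation into the measure of the
      -- intersection of the base with its `m`-th image, which is empty by `not_return`.
      rw [← (((construction hr).operator.op ^ (-(m : ℤ)))).inner_map_map,
        zpow_neg_floorIndicator, ← zpow_natCast, zpow_apply_zpow_apply, neg_add_cancel, zpow_zero]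
      change inner ℂ (floorIndicator hr j m) (floorIndicator hr j 0) = 0
      rw [inner_floorIndicator]
      convert Complex.ofReal_zero
      rw [Set.disjoint_iff_inter_eq_empty.1 (Set.disjoint_left.2 ?_), measureReal_empty]
      rintro _ ⟨x, hx, rfl⟩ hx'
      exact not_return (construction hr) h0 hm hx (by
        rwa [Function.iterate_zero, image_id] at hx')
    rw [baseVector, map_smul, inner_smul_left, inner_smul_right, h, mul_zero, mul_zero]
  total := by
    rw [cyclicSpan, Submodule.topologicalClosure_eq_top_iff, Submodule.eq_bot_iff]
    intro g hg
    refine eq_zero_of_inner_floorIndicator hr g fun j k => ?_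
    have h : inner ℂ (((construction hr).operator.op ^ (-(k : ℤ))) (baseVector hr j)) g = 0 :=
      hg _ (Submodule.subset_span ⟨(-(k : ℤ), j), rfl⟩)
    have hw : ((Real.sqrt (width r j) : ℝ) : ℂ)⁻¹ ≠ 0 :=
      inv_ne_zero (Complex.ofReal_ne_zero.2 (Real.sqrt_pos.2 (width_pos hr j)).ne')
    rw [baseVector, map_smul, zpow_neg_floorIndicator, inner_smul_left] at h
    exact (mul_eq_zero.1 h).resolve_left ((map_ne_zero _).2 hw)

end Ternary

theorem theorem1 (n : ℕ) (hn : 1 < n) :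
    ∃ (P : RankOneParams) (R : RankOneConstruction P),
      R.IsSidon ∧ volume R.X = ⊤ ∧
      (R.operator.tensorPower n).HasSingularSpectrum ∧
      (R.operator.tensorPower (n + 1)).HasAbsolutelyContinuousSpectrum ∧
      (∃ ρ, R.operator.IsSpectralMeasure ρ) ∧
      ∀ ρ, R.operator.IsSpectralMeasure ρ →
        (convPower ρ n).MutuallySingular circleLebesgue ∧
        (convPower ρ (n + 1)).AbsolutelyContinuous circleLebesgue := by
  obtain ⟨r, hr, hs, hs'⟩ := exists_cutting_numbers hn
  exact ⟨ternaryParams r hr, Ternary.construction hr, Ternary.isSidon _, Ternary.volume_space hr,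
    (Ternary.isRankOneSequence hr).spectrum (isTernaryGrowth_ternaryHeight hr) hn hs hs'⟩
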